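/- Let $V=\bigoplus_{n\ge 0}V_n$ be a vertex operator algebra over $\mathbb{C}$ of CFT type ($V_0=\mathbb{C}\mathbf 1$), and let $M=\bigoplus_{n\ge 0}M(n)$ and $N=\bigoplus_{n\ge 0}N(n)$ be admissible $V$-modules. Let $O(M)\subseteq M$ be the span of all $\operatorname{Res}_z Y_M(a,z)u\,\frac{(1+z)^{\mathrm{wt}\,a}}{z^2}$ with $a\in V$ homogeneous and $u\in M$, and put $A(M)=M/O(M)$, $A(V)=V/O(V)$. Then $A(V)$ is Zhu's algebra and $A(M)$ is an $A(V)$-bimodule, the products being induced, for homogeneous $a$, by $$a*u=\operatorname{Res}_z Y_M(a,z)u\,\frac{(1+z)^{\mathrm{wt}\,a}}{z},\qquad u*a=\operatorname{Res}_z Y_M(a,z)u\,\frac{(1+z)^{\mathrm{wt}\,a-1}}{z}.$$ Filter $A(V)$ and $A(M)$ by letting $A(V)_n$ be the image of $V_0\oplus\cdots\oplus V_n$ and $A(M)_n$ the image of $M(0)\oplus\cdots\oplus M(n)$. Filter $A(M)\otimes_{A(V)}A(N)$ and $A(V)\otimes_{\mathbb{C}}A(V)^{op}$ by $$(A(M)\otimes_{A(V)}A(N))_n=\operatorname{span}\{u\otimes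 v: u\in A(M)_r,\ v\in A(N)_s,\ r+s\le n\},$$ $$(A(V)\otimes_{\mathbb{C}}A(V)^{op})_n=\operatorname{span}\{a\otimes b: a\in A(V)_i,\ b\in A(V)_j,\ i+j\le n\}.$$ For a filtered object $X$ let $\mathrm{gr}\,X=\bigoplus_{n\ge 0}X_n/X_{n-1}$, where $X_{-1}=0$. Then $\mathrm{gr}(A(M)\otimes_{A(V)}A(N))$ is a graded $\mathrm{gr}\,A(V)$-bimodule and, through $(a\otimes b).(u\otimes v)=a*u\otimes v*b$, a graded left $\mathrm{gr}(A(V)\otimes_{\mathbb{C}}A(V)^{op})$-module; likewise with $M$ and $N$ exchanged. Proposition. There is a $\mathbb{C}$-linear isomorphism $$\varphi:\ \mathrm{gr}(A(M)\otimes_{A(V)}A(N))\ \longrightarrow\ \mathrm{gr}(A(N)\otimes_{A(V)}A(M))$$ such that, for all $n,r,s\ge 0$ with $r+s\le n$, all $u\in A(M)_r$ and all $v\in A(N)_s$, $\varphi$ sends the class of $u\otimes v$ in $(A(M)\otimes_{A(V)}A(N))_n/(A(M)\otimes_{A(V)}A(N))_{n-1}$ to the class of $v\otimes u$ in $(A(N)\otimes_{A(V)}A(M))_n/(A(N)\otimes_{A(V)}A(M))_{n-1}$.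 It maps the component of degree $n$ onto the component of degree $n$ for every $n$, and it is an isomorphism of $\mathrm{gr}\,A(V)$-bimodules and of left $\mathrm{gr}(A(V)\otimes_{\mathbb{C}}A(V)^{op})$-modules. -/

import Mathlib

open scoped TensorProduct DirectSum LaurentSeries

noncomputable section

namespace Zhu

/-! The lemmas below (on residues, on Hasse derivatives of `(1 + z)^p z^q`, on the stability of
`O(M)`, on associativity modulo `O(M)`, on filtrations) serve to prove that `A(V)` is an algebra,
that `A(M)` is an `A(V)`-bimodule, and that the associated graded objects carry their natural ring
and module structures. All these structures are constructed, none is assumed. Coefficients are in a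
field `k` of characteristic zero. -/

/-! ### Residues of vertex operators -/

section Residue

variable {k M : Type*} [Field k] [AddCommGroup M] [Module k M]

/-- For a vertex operator `A = Y(a, z)` on `M` and a Laurent series `f`, the operator
`u ↦ Res_z f(z) Y(a, z) u`, that is, the coefficient of `z⁻¹` in `f(z) Y(a, z) u`. -/
def residue : VertexOperator k M →ₗ[k] LaurentSeries k →ₗ[k] Module.End k M where
  toFun A :=
    { toFun := fun f =>
        { toFun := fun u => ((HahnModule.of k).symm (f • A u)).coeff (-1)
          map_add' := fun u v => by rw [map_add, smul_add]; rfl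
          map_smul' := fun c u => by
            exact congrArg (fun x => ((HahnModule.of k).symm x).coeff (-1))
              ((congrArg (f • ·) (map_smul A c u)).trans (smul_comm c f (A u)).symm) }
      map_add' := fun f g => by
        ext u
        exact congrArg (fun x => ((HahnModule.of k).symm x).coeff (-1)) (add_smul f g (A u))
      map_smul' := fun c f => by
        ext u
        exact congrArg (fun x => ((HahnModule.of k).symm x).coeff (-1)) (smul_assoc c f (A u)) }
  map_add' A B := by
    ext f u
    exact congrArg (fun x => ((HahnModule.of k).symm x).coeff (-1)) (smul_add f (A u) (B u))
  map_smul' c A := by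
    ext f u
    exact congrArg (fun x => ((HahnModule.of k).symm x).coeff (-1)) (smul_comm c f (A u)).symm

theorem residue_apply (A : VertexOperator k M) (f : LaurentSeries k) (u : M) :
    residue A f u = ((HahnModule.of k).symm (f • A u)).coeff (-1) := rfl

/-- The power `z ^ n` as a Laurent series. -/
abbrev zpw {k : Type*} [Field k] (n : ℤ) : LaurentSeries k := HahnSeries.single n (1 : k)

/-- The Laurent series of `(1 + z) ^ p * z ^ q`, expanded in nonnegative powers of `z`
up to the factor `z ^ q`. -/
def kern {k : Type*} [Field k] (p q : ℤ) : LaurentSeries k := (1 + zpw 1) ^ p * zpw q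

theorem residue_zpw (A : VertexOperator k M) (n : ℤ) (u : M) :
    residue A (zpw n) u = VertexOperator.ncoeff A n u := by
  rw [residue_apply]
  have : (-1 : ℤ) = n +ᵥ (-n - 1) := by rw [vadd_eq_add]; ring
  rw [this, HahnModule.coeff_single_smul_vadd, one_smul]
  rfl

/-- The coefficients of `f` in degrees below `K` vanish. -/
def SuppGE (f : LaurentSeries k) (K : ℤ) : Prop := ∀ n < K, f.coeff n = 0

theorem exists_suppGE (f : LaurentSeries k) : ∃ K, SuppGE f K :=
  ⟨f.order, fun _ hn => HahnSeries.coeff_eq_zero_of_lt_order hn⟩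

theorem SuppGE.mul {f g : LaurentSeries k} {K L : ℤ} (hf : SuppGE f K) (hg : SuppGE g L) :
    SuppGE (f * g) (K + L) := by
  intro n hn
  rw [HahnSeries.coeff_mul]
  refine Finset.sum_eq_zero fun ij hij => ?_
  rw [Finset.mem_antidiagonal] at hij
  by_cases h : ij.1 < K
  · rw [hf _ h, zero_mul]
  · rw [hg _ (by lia), mul_zero]

theorem SuppGE.zpw (n : ℤ) : SuppGE (zpw n : LaurentSeries k) n := fun m hm =>
  HahnSeries.coeff_single_of_ne hm.ne

theorem SuppGE.hasseDeriv {f : LaurentSeries k} {K : ℤ} (hf : SuppGE f K) (i : ℕ) :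
    SuppGE (LaurentSeries.hasseDeriv k i f) (K - i) := by
  intro n hn
  rw [LaurentSeries.hasseDeriv_coeff, hf _ (by lia), smul_zero]

theorem SuppGE.mono {f : LaurentSeries k} {K L : ℤ} (hf : SuppGE f K) (h : L ≤ K) :
    SuppGE f L := fun n hn => hf n (by lia)

/-- A linear functional on Laurent series that only sees finitely many positive powers. -/
def Disc {W : Type*} [AddCommGroup W] [Module k W] (φ : LaurentSeries k →ₗ[k] W) : Prop :=
  ∃ K, ∀ f, SuppGE f K → φ f = 0

theorem Disc.eqOn {W : Type*} [AddCommGroup W] [Module k W] {φ ψ : LaurentSeries k →ₗ[k] W}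
    (hφ : Disc φ) (hψ : Disc ψ) (m : ℤ) (h : ∀ n, m ≤ n → φ (zpw n) = ψ (zpw n))
    (f : LaurentSeries k) (hf : SuppGE f m) : φ f = ψ f := by
  obtain ⟨K, hK⟩ := hφ
  obtain ⟨L, hL⟩ := hψ
  set T := max K L
  set s : LaurentSeries k := ∑ n ∈ Finset.Ico m T, f.coeff n • zpw n with hs
  have hsup : SuppGE (f - s) T := by
    intro n hn
    rw [HahnSeries.coeff_sub, hs, HahnSeries.coeff_sum]
    by_cases hm : n < m
    · rw [hf n hm, Finset.sum_eq_zero, sub_zero]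
      intro j hj
      rw [Finset.mem_Ico] at hj
      rw [HahnSeries.coeff_smul, HahnSeries.coeff_single_of_ne (by lia), smul_zero]
    · rw [Finset.sum_eq_single n]
      · simp
      · intro j _ hj
        rw [HahnSeries.coeff_smul, HahnSeries.coeff_single_of_ne hj.symm, smul_zero]
      · intro h; exact absurd (Finset.mem_Ico.2 ⟨by lia, hn⟩) h
  have e1 : φ f = φ s := by
    rw [← sub_eq_zero, ← map_sub]; exact hK _ (hsup.mono (le_max_left _ _))
  have e2 : ψ f = ψ s := by
    rw [← sub_eq_zero, ← map_sub]; exact hL _ (hsup.mono (le_max_right _ _))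
  rw [e1, e2, hs, map_sum, map_sum]
  refine Finset.sum_congr rfl fun n hn => ?_
  rw [map_smul, map_smul, h n (Finset.mem_Ico.1 hn).1]

theorem Disc.sum {W ι : Type*} [AddCommGroup W] [Module k W] (s : Finset ι)
    (φ : ι → LaurentSeries k →ₗ[k] W) (h : ∀ i ∈ s, Disc (φ i)) : Disc (∑ i ∈ s, φ i) := by
  classical
  induction s using Finset.induction_on with
  | empty => exact ⟨0, fun f _ => by simp⟩
  | insert a s ha ih =>
    obtain ⟨K, hK⟩ := ih fun i hi => h i (Finset.mem_insert_of_mem hi)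
    obtain ⟨L, hL⟩ := h a (Finset.mem_insert_self _ _)
    refine ⟨max K L, fun f hf => ?_⟩
    rw [Finset.sum_insert ha, LinearMap.add_apply, hK f (hf.mono (le_max_left _ _)),
      hL f (hf.mono (le_max_right _ _)), add_zero]

theorem Disc.sub {W : Type*} [AddCommGroup W] [Module k W] {φ ψ : LaurentSeries k →ₗ[k] W}
    (hφ : Disc φ) (hψ : Disc ψ) : Disc (φ - ψ) := by
  obtain ⟨K, hK⟩ := hφ
  obtain ⟨L, hL⟩ := hψ
  refine ⟨max K L, fun f hf => ?_⟩
  rw [LinearMap.sub_apply, hK f (hf.mono (le_max_left _ _)),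
      hL f (hf.mono (le_max_right _ _)), sub_zero]

theorem Disc.smul {W : Type*} [AddCommGroup W] [Module k W] {φ : LaurentSeries k →ₗ[k] W}
    (hφ : Disc φ) (c : k) : Disc (c • φ) := by
  obtain ⟨K, hK⟩ := hφ
  exact ⟨K, fun f hf => by rw [LinearMap.smul_apply, hK f hf, smul_zero]⟩

theorem Disc.comp {W W' : Type*} [AddCommGroup W] [Module k W] [AddCommGroup W'] [Module k W']
    {φ : LaurentSeries k →ₗ[k] W} (hφ : Disc φ) (ψ : W →ₗ[k] W') : Disc (ψ ∘ₗ φ) := by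
  obtain ⟨K, hK⟩ := hφ
  exact ⟨K, fun f hf => by rw [LinearMap.comp_apply, hK f hf, map_zero]⟩

theorem Disc.precomp {W : Type*} [AddCommGroup W] [Module k W]
    {φ : LaurentSeries k →ₗ[k] W} (hφ : Disc φ) (T : LaurentSeries k →ₗ[k] LaurentSeries k)
    (c : ℤ) (hT : ∀ f K, SuppGE f K → SuppGE (T f) (K + c)) : Disc (φ ∘ₗ T) := by
  obtain ⟨K, hK⟩ := hφ
  exact ⟨K - c, fun f hf => hK _ ((hT f _ hf).mono (by lia))⟩

/-- `f ↦ Res f(z) A(z) u`. -/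
def resAt (A : VertexOperator k M) (u : M) : LaurentSeries k →ₗ[k] M :=
  LinearMap.applyₗ u ∘ₗ residue A

theorem resAt_apply (A : VertexOperator k M) (u : M) (f : LaurentSeries k) :
    resAt A u f = residue A f u := rfl

theorem disc_residue (A : VertexOperator k M) (u : M) : Disc (resAt A u) := by
  refine ⟨-((HahnModule.of k).symm (A u)).order, fun f hf => ?_⟩
  rw [resAt_apply, residue_apply, HahnModule.coeff_smul]
  refine Finset.sum_eq_zero fun ij hij => ?_
  rw [Finset.mem_vaddAntidiagonal] at hij
  have h3 : ij.1 + ij.2 = -1 := hij.2.2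
  by_cases h : ij.1 < -((HahnModule.of k).symm (A u)).order
  · rw [hf _ h, zero_smul]
  · rw [HahnSeries.coeff_eq_zero_of_lt_order (x := (HahnModule.of k).symm (A u)) (by omega)]
    exact smul_zero _

end Residue

/-! ### Hasse derivatives of the kernels -/

section Hasse

variable {k : Type*} [Field k]

/-- The `i`-th Hasse derivative of Laurent series. -/
abbrev hD (i : ℕ) : LaurentSeries k →ₗ[k] LaurentSeries k := LaurentSeries.hasseDeriv k i

/-- The generalized binomial coefficient `p(p-1)⋯(p-i+1)/i!`, for an integer `p`, as an element of
`k`. -/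
abbrev binom {k : Type*} [Field k] (p : ℤ) (i : ℕ) : k := ((Ring.choose p i : ℤ) : k)

theorem binom_succ_succ (p : ℤ) (i : ℕ) : (binom (p + 1) (i + 1) : k) = binom p i + binom p (i + 1) := by
  rw [binom, Ring.choose_succ_succ]; push_cast; rfl

theorem hD_coeff (i : ℕ) (f : LaurentSeries k) (n : ℤ) :
    (hD i f).coeff n = binom (n + i) i * f.coeff (n + i) := by
  rw [LaurentSeries.hasseDeriv_coeff, zsmul_eq_mul]

theorem hD_zpw (i : ℕ) (n : ℤ) : hD i (zpw n : LaurentSeries k) = (binom n i : k) • (zpw (n - i) : LaurentSeries k) := by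
  rw [hD, LaurentSeries.hasseDeriv_single, zpw, zsmul_eq_mul, mul_one]
  ext m
  by_cases h : m = n - i <;> simp [h]

theorem lsmul_mul (c : k) (f g : LaurentSeries k) : (c • f) * g = c • (f * g) := by
  rw [← HahnSeries.single_zero_mul_eq_smul, ← HahnSeries.single_zero_mul_eq_smul, mul_assoc]

theorem mul_lsmul (c : k) (f g : LaurentSeries k) : f * (c • g) = c • (f * g) := by
  rw [mul_comm, lsmul_mul, mul_comm]

theorem hasse_zpw_mul (i : ℕ) (f : LaurentSeries k) :
    hD (i + 1) (zpw 1 * f) = zpw 1 * hD (i + 1) f + hD i f := by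
  ext n
  have e : ∀ (g : LaurentSeries k) (m : ℤ), (zpw 1 * g).coeff m = g.coeff (m - 1) := by
    intro g m
    have := HahnSeries.coeff_single_mul_add (r := (1:k)) (x := g) (a := m - 1) (b := 1)
    rw [one_mul, sub_add_cancel] at this
    exact this
  rw [HahnSeries.coeff_add, e, hD_coeff, hD_coeff, hD_coeff, e]
  have h1 : n + ((i + 1 : ℕ) : ℤ) - 1 = n + i := by push_cast; ring
  have h2 : n - 1 + ((i + 1 : ℕ) : ℤ) = n + i := by push_cast; ring
  have h3 : n + ((i + 1 : ℕ) : ℤ) = n + i + 1 := by push_cast; ring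
  rw [h1, h2, h3, binom_succ_succ]; ring

theorem zpw_mul (m n : ℤ) : (zpw m * zpw n : LaurentSeries k) = zpw (m + n) := by
  simp [zpw]

theorem zpw_zero_mul (f : LaurentSeries k) : (zpw 0 : LaurentSeries k) * f = f := one_mul f

theorem one_add_ne : (1 + zpw 1 : LaurentSeries k) ≠ 0 := by
  intro h
  have := congrArg (fun f : LaurentSeries k => f.coeff 0) h
  simp [zpw] at this

theorem hasse_one_add_mul (i : ℕ) (f : LaurentSeries k) :
    hD (i + 1) ((1 + zpw 1) * f) = (1 + zpw 1) * hD (i + 1) f + hD i f := by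
  rw [add_mul, map_add, hasse_zpw_mul, one_mul]; ring

theorem hD_zero (f : LaurentSeries k) : hD 0 f = f := by
  rw [hD, LaurentSeries.hasseDeriv_zero]; rfl

theorem hasse_one_add_zpow {k : Type*} [Field k] (p : ℤ) (i : ℕ) :
    hD i ((1 + zpw 1 : LaurentSeries k) ^ p) = (binom p i : k) • (1 + zpw 1 : LaurentSeries k) ^ (p - i) := by
  have key : ∀ (p : ℤ) (i : ℕ), (1 + zpw 1) * hD (i + 1) ((1 + zpw 1 : LaurentSeries k) ^ p)
      = hD (i + 1) ((1 + zpw 1 : LaurentSeries k) ^ (p + 1)) - hD i ((1 + zpw 1 : LaurentSeries k) ^ p) := by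
    intro p i
    rw [zpow_add_one₀ one_add_ne, mul_comm _ (1 + zpw 1), hasse_one_add_mul]; ring
  have pw : ∀ (p : ℤ), (1 + zpw 1) * (1 + zpw 1 : LaurentSeries k) ^ p = (1 + zpw 1 : LaurentSeries k) ^ (p + 1) := by
    intro p; rw [zpow_add_one₀ one_add_ne, mul_comm]
  induction p using Int.induction_on generalizing i with
  | zero =>
    cases i with
    | zero => rw [hD_zero]; simp [binom]
    | succ i =>
      rw [zpow_zero]
      have : (1 : LaurentSeries k) = (zpw 0 : LaurentSeries k) := rfl
      rw [this, hD_zpw, binom, Ring.choose_zero_succ]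
      simp
  | succ p ih =>
    cases i with
    | zero => rw [hD_zero]; simp [binom]
    | succ i =>
      have := key p i
      rw [eq_sub_iff_add_eq] at this
      rw [← this, ih, ih, mul_lsmul, pw, binom_succ_succ, add_smul, add_comm]
      congr 3 <;> push_cast <;> ring
  | pred p ih =>
    induction i with
    | zero => rw [hD_zero]; simp [binom]
    | succ i ih2 =>
      have := key (-p - 1) i
      rw [sub_add_cancel, ih, ih2] at this
      have e : ((-(p:ℤ)) - ((i + 1 : ℕ) : ℤ)) = (-p - 1 - i) := by push_cast; ring
      have c := binom_succ_succ (k := k) (-(p:ℤ) - 1) i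
      rw [sub_add_cancel] at c
      rw [e, c, add_smul, add_sub_cancel_left] at this
      apply mul_left_cancel₀ one_add_ne
      rw [this, mul_lsmul, pw]
      congr 2; push_cast; ring

theorem kern_eq (p q : ℤ) : (kern p q : LaurentSeries k) = (1 + zpw 1) ^ p * zpw q := rfl

theorem zpw_mul_kern (p q m : ℤ) : (zpw m * kern p q : LaurentSeries k) = kern p (q + m) := by
  rw [kern_eq, kern_eq, mul_left_comm, zpw_mul, add_comm m q]

theorem kern_succ (p q : ℤ) : (kern (p + 1) q : LaurentSeries k) = kern p q + kern p (q + 1) := by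
  rw [kern_eq, kern_eq, kern_eq, zpow_add_one₀ one_add_ne, ← zpw_mul]; ring

theorem hasse_kern_zero_mul_kern (p p' q' : ℤ) (i : ℕ) :
    (hD i (kern p 0) : LaurentSeries k) * kern p' q' =
      (binom p i : k) • (kern (p + p' - i) q' : LaurentSeries k) := by
  have : (kern p 0 : LaurentSeries k) = (1 + zpw 1) ^ p := by rw [kern_eq]; exact mul_one _
  rw [this, hasse_one_add_zpow, lsmul_mul, kern_eq, kern_eq, ← mul_assoc,
    ← zpow_add₀ one_add_ne]
  congr 3; ring

end Hasse

/-! ### Vertex operator algebras and admissible modules -/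

section Modes

variable {k V M : Type*} [Field k] [AddCommGroup V] [Module k V] [AddCommGroup M] [Module k M]

/-- The mode `a_n`, where `Y(a, z) = ∑ a_n z^(-n-1)`. -/
def mode (Y : V →ₗ[k] VertexOperator k M) (a : V) (n : ℤ) : Module.End k M :=
  VertexOperator.ncoeff (Y a) n

/-- The Borcherds identity (the Jacobi identity written in modes): for all `a, b ∈ V`, `u ∈ M` and
`l, m, n ∈ ℤ`,
`∑ i, C(m, i) (a_{l+i} b)_{m+n-i} u
  = ∑ i, (-1)^i C(l, i) (a_{m+l-i} b_{n+i} u - (-1)^l b_{n+l-i} a_{m+i} u)`.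
All sums are finite. -/
def BorcherdsIdentity (Y : V →ₗ[k] VertexOperator k V) (YM : V →ₗ[k] VertexOperator k M) : Prop :=
  ∀ (a b : V) (u : M) (l m n : ℤ),
    ∑ᶠ i : ℕ, (binom m i : k) • mode YM (mode Y a (l + i) b) (m + n - i) u =
    ∑ᶠ i : ℕ, ((-1) ^ i * binom l i : k) •
      (mode YM a (m + l - i) (mode YM b (n + i) u) -
        (-1 : k) ^ l • mode YM b (n + l - i) (mode YM a (m + i) u))

theorem exists_mode_eq_zero (Y : V →ₗ[k] VertexOperator k M) (a : V) (u : M) :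
    ∃ K, ∀ n ≥ K, mode Y a n u = 0 := by
  refine ⟨-((HahnModule.of k).symm (Y a u)).order, fun n hn => ?_⟩
  exact VertexOperator.ncoeff_eq_zero_of_lt_order _ _ _ (by omega)

theorem residue_zpw_eq_mode (Y : V →ₗ[k] VertexOperator k M) (a : V) (n : ℤ) (u : M) :
    residue (Y a) (zpw n) u = mode Y a n u := residue_zpw _ _ _

/-- Multiplication by a Laurent series, as a linear map. -/
def mulL (h : LaurentSeries k) : LaurentSeries k →ₗ[k] LaurentSeries k where
  toFun f := h * f
  map_add' := mul_add h
  map_smul' c f := mul_lsmul c h f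

theorem mulL_supp (h : LaurentSeries k) : ∃ c, ∀ f K, SuppGE f K → SuppGE (mulL h f) (K + c) := by
  obtain ⟨c, hc⟩ := exists_suppGE h
  exact ⟨c, fun f K hf => (hc.mul hf).mono (by omega)⟩

theorem Disc.mulL {W : Type*} [AddCommGroup W] [Module k W] {φ : LaurentSeries k →ₗ[k] W}
    (hφ : Disc φ) (h : LaurentSeries k) : Disc (φ ∘ₗ mulL h) := by
  obtain ⟨c, hc⟩ := mulL_supp h
  exact hφ.precomp _ c hc

theorem BorcherdsIdentity.residues {Y : V →ₗ[k] VertexOperator k V}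
    {YM : V →ₗ[k] VertexOperator k M} (hB : BorcherdsIdentity Y YM) (a b : V) (u : M) (l : ℤ)
    (f g : LaurentSeries k) : ∃ N₀ : ℕ, ∀ N ≥ N₀,
    ∑ i ∈ Finset.range N, residue (YM (mode Y a (l + i) b)) (hD i f * g) u =
    ∑ i ∈ Finset.range N, ((-1) ^ i * binom l i : k) •
      (residue (YM a) (zpw (l - i) * f) (residue (YM b) (zpw i * g) u) -
        (-1 : k) ^ l • residue (YM b) (zpw (l - i) * g) (residue (YM a) (zpw i * f) u)) := by
  obtain ⟨m0, hm0⟩ := exists_suppGE f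
  obtain ⟨n0, hn0⟩ := exists_suppGE g
  obtain ⟨K1, hK1⟩ := exists_mode_eq_zero Y a b
  obtain ⟨K2, hK2⟩ := exists_mode_eq_zero YM b u
  obtain ⟨K3, hK3⟩ := exists_mode_eq_zero YM a u
  refine ⟨(max (K1 - l) (max (K2 - n0) (K3 - m0))).toNat, fun N hN => ?_⟩
  have base : ∀ m ≥ m0, ∀ n ≥ n0,
      ∑ i ∈ Finset.range N, residue (YM (mode Y a (l + i) b)) (hD i (zpw m) * zpw n) u =
      ∑ i ∈ Finset.range N, ((-1) ^ i * binom l i : k) •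
      (residue (YM a) (zpw (l - i) * zpw m) (residue (YM b) (zpw i * zpw n) u) -
        (-1 : k) ^ l • residue (YM b) (zpw (l - i) * zpw n)
          (residue (YM a) (zpw i * zpw m) u)) := by
    intro m hm n hn
    have h := hB a b u l m n
    rw [finsum_eq_sum_of_support_subset (s := Finset.range N),
      finsum_eq_sum_of_support_subset (s := Finset.range N)] at h
    · refine (Finset.sum_congr rfl fun i _ => ?_).trans
        (h.trans (Finset.sum_congr rfl fun i _ => ?_))
      · rw [hD_zpw, lsmul_mul, zpw_mul, map_smul, LinearMap.smul_apply, residue_zpw_eq_mode]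
        congr 2; congr 1; ring
      · simp only [zpw_mul, residue_zpw_eq_mode]
        rw [show m + l - (i : ℤ) = l - i + m by ring, show n + (i : ℤ) = i + n by ring,
          show n + l - (i : ℤ) = l - i + n by ring, show m + (i : ℤ) = i + m by ring]
    · intro i hi
      simp only [Finset.coe_range, Set.mem_Iio]
      by_contra hlt
      apply hi
      dsimp only
      rw [hK2 _ (by omega), hK3 _ (by omega), map_zero, map_zero, smul_zero, sub_zero, smul_zero]
    · intro i hi
      simp only [Finset.coe_range, Set.mem_Iio]
      by_contra hlt
      apply hi
      dsimp only
      rw [hK1 _ (by omega)]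
      simp [mode]
  have step1 : ∀ m ≥ m0,
      ∑ i ∈ Finset.range N, residue (YM (mode Y a (l + i) b)) (hD i (zpw m) * g) u =
      ∑ i ∈ Finset.range N, ((-1) ^ i * binom l i : k) •
      (residue (YM a) (zpw (l - i) * zpw m) (residue (YM b) (zpw i * g) u) -
        (-1 : k) ^ l • residue (YM b) (zpw (l - i) * g) (residue (YM a) (zpw i * zpw m) u)) := by
    intro m hm
    have := Disc.eqOn
      (φ := ∑ i ∈ Finset.range N, (resAt (YM (mode Y a (l + i) b)) u ∘ₗ mulL (hD i (zpw m))))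
      (ψ := ∑ i ∈ Finset.range N, ((-1) ^ i * binom l i : k) •
        ((residue (YM a) (zpw (l - i) * zpw m)) ∘ₗ (resAt (YM b) u ∘ₗ mulL (zpw i)) -
          (-1 : k) ^ l • (resAt (YM b) (residue (YM a) (zpw i * zpw m) u) ∘ₗ mulL (zpw (l - i)))))
      (Disc.sum _ _ fun i _ => (disc_residue _ _).mulL _)
      (Disc.sum _ _ fun i _ => ((((disc_residue _ _).mulL _).comp _).sub
        (((disc_residue _ _).mulL _).smul _)).smul _) n0 ?_ g hn0
    · simp only [LinearMap.sum_apply, LinearMap.smul_apply, LinearMap.sub_apply,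
        LinearMap.comp_apply] at this
      exact this
    · intro n hn
      simp only [LinearMap.sum_apply, LinearMap.smul_apply, LinearMap.sub_apply,
        LinearMap.comp_apply]
      exact base m hm n hn
  have := Disc.eqOn
      (φ := ∑ i ∈ Finset.range N, ((resAt (YM (mode Y a (l + i) b)) u ∘ₗ mulL g) ∘ₗ hD i))
      (ψ := ∑ i ∈ Finset.range N, ((-1) ^ i * binom l i : k) •
        ((resAt (YM a) (residue (YM b) (zpw i * g) u)) ∘ₗ mulL (zpw (l - i)) -
          (-1 : k) ^ l • ((residue (YM b) (zpw (l - i) * g)) ∘ₗ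
            (resAt (YM a) u ∘ₗ mulL (zpw i)))))
      (Disc.sum _ _ fun i _ => ((disc_residue _ _).mulL _).precomp _ (-(i : ℤ))
        fun f K hf => (hf.hasseDeriv i))
      (Disc.sum _ _ fun i _ => (((disc_residue _ _).mulL _).sub
        ((((disc_residue _ _).mulL _).comp _).smul _)).smul _) m0 ?_ f hm0
  · simp only [LinearMap.sum_apply, LinearMap.smul_apply, LinearMap.sub_apply,
        LinearMap.comp_apply] at this
    refine Eq.trans (Finset.sum_congr rfl fun i _ => ?_) this
    rw [mul_comm]; rfl
  · intro m hm
    simp only [LinearMap.sum_apply, LinearMap.smul_apply, LinearMap.sub_apply,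
        LinearMap.comp_apply]
    refine Eq.trans (Finset.sum_congr rfl fun i _ => ?_) (step1 m hm)
    rw [mul_comm]; rfl

end Modes

/-- The extension of an `ℕ`-grading to `ℤ` by zero. -/
def intPart {k M : Type*} [Field k] [AddCommGroup M] [Module k M] (W : ℕ → Submodule k M) (n : ℤ) :
    Submodule k M :=
  if 0 ≤ n then W n.toNat else ⊥

/-- An `ℕ`-graded vertex operator algebra `V = ⨁ V_n` over the field `k`. The truncation condition
(`a_n u = 0` for `n` large) is part of the type `VertexOperator`. -/
class VertexOperatorAlgebra (k V : Type*) [Field k] [AddCommGroup V] [Module k V] where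
  /-- The state-field correspondence `a ↦ Y(a, z)`. -/
  vertexOp : V →ₗ[k] VertexOperator k V
  /-- The weight spaces `V_n`. -/
  weight : ℕ → Submodule k V
  /-- The vacuum vector. -/
  vacuum : V
  /-- The conformal (Virasoro) vector. -/
  conformal : V
  /-- The central charge. -/
  centralCharge : k
  weight_isInternal : DirectSum.IsInternal weight
  weight_finite : ∀ n, Module.Finite k (weight n)
  vacuum_mem : vacuum ∈ weight 0
  conformal_mem : conformal ∈ weight 2
  vacuum_mode : ∀ (n : ℤ) (u : V), mode vertexOp vacuum n u = if n = -1 then u else 0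
  mode_vacuum : ∀ (a : V) (n : ℤ), 0 ≤ n → mode vertexOp a n vacuum = 0
  mode_neg_one_vacuum : ∀ a : V, mode vertexOp a (-1) vacuum = a
  borcherds : BorcherdsIdentity vertexOp vertexOp
  mode_mem : ∀ (p q : ℕ) (n : ℤ) (a u : V), a ∈ weight p → u ∈ weight q →
    mode vertexOp a n u ∈ intPart weight (p + q - n - 1)
  /-- The operators `L(n) = ω_{n+1}` satisfy the Virasoro relations. -/
  virasoro : ∀ (m n : ℤ) (u : V),
    mode vertexOp conformal (m + 1) (mode vertexOp conformal (n + 1) u) -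
      mode vertexOp conformal (n + 1) (mode vertexOp conformal (m + 1) u) =
    ((m - n : ℤ) : k) • mode vertexOp conformal (m + n + 1) u +
      (if m + n = 0 then ((m ^ 3 - m : ℤ) : k) / 12 * centralCharge else 0) • u
  /-- `L(0)` acts on `V_n` as multiplication by `n`. -/
  L_zero : ∀ (n : ℕ), ∀ a ∈ weight n, mode vertexOp conformal 1 a = (n : k) • a
  /-- `Y(L(-1) a, z) = d/dz Y(a, z)`. -/
  L_neg_one : ∀ (a : V) (n : ℤ) (u : V),
    mode vertexOp (mode vertexOp conformal 0 a) n u = (-n : k) • mode vertexOp a (n - 1) u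

/-- `V` is of CFT type: `V = V_0 ⊕ V_1 ⊕ ⋯` with `V_0` spanned by the vacuum. -/
def VertexOperatorAlgebra.IsCFTType (k V : Type*) [Field k] [AddCommGroup V] [Module k V]
    [VertexOperatorAlgebra k V] : Prop :=
  weight (k := k) (V := V) 0 = Submodule.span k {vacuum k}

/-- An admissible (`ℕ`-gradable weak) module `M = ⨁ M(n)` over a vertex operator algebra `V`. -/
class AdmissibleModule (k V M : Type*) [Field k] [AddCommGroup V] [Module k V]
    [VertexOperatorAlgebra k V] [AddCommGroup M] [Module k M] where
  /-- The action `a ↦ Y_M(a, z)`. -/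
  moduleOp : V →ₗ[k] VertexOperator k M
  /-- The homogeneous subspaces `M(n)`. -/
  degree : ℕ → Submodule k M
  degree_isInternal : DirectSum.IsInternal degree
  vacuum_mode : ∀ (n : ℤ) (u : M),
    mode moduleOp (VertexOperatorAlgebra.vacuum k) n u = if n = -1 then u else 0
  borcherds : BorcherdsIdentity VertexOperatorAlgebra.vertexOp moduleOp
  mode_mem : ∀ (p q : ℕ) (n : ℤ) (a : V) (u : M), a ∈ VertexOperatorAlgebra.weight (k := k) p →
    u ∈ degree q → mode moduleOp a n u ∈ intPart degree (p + q - n - 1)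

/-- `V` as an admissible module over itself. -/
instance adjointModule (k V : Type*) [Field k] [AddCommGroup V] [Module k V]
    [VertexOperatorAlgebra k V] : AdmissibleModule k V V where
  moduleOp := VertexOperatorAlgebra.vertexOp
  degree := VertexOperatorAlgebra.weight
  degree_isInternal := VertexOperatorAlgebra.weight_isInternal
  vacuum_mode := VertexOperatorAlgebra.vacuum_mode
  borcherds := VertexOperatorAlgebra.borcherds
  mode_mem := VertexOperatorAlgebra.mode_mem

/-! ### Zhu's products -/

section Products

open VertexOperatorAlgebra AdmissibleModule

theorem mem_intPart {k M : Type*} [Field k] [AddCommGroup M] [Module k M]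
    {W : ℕ → Submodule k M} {n : ℤ} {x : M} (h : x ∈ intPart W n) :
    x = 0 ∨ ∃ m : ℕ, (m : ℤ) = n ∧ x ∈ W m := by
  unfold intPart at h
  split_ifs at h with h0
  · exact Or.inr ⟨n.toNat, Int.toNat_of_nonneg h0, h⟩
  · exact Or.inl (by simpa using h)

theorem mem_intPart_of_mem {k M : Type*} [Field k] [AddCommGroup M] [Module k M]
    {W : ℕ → Submodule k M} {n : ℕ} {x : M} (h : x ∈ W n) : x ∈ intPart W n := by
  simpa [intPart] using h

/-- The operator `u ↦ Res_z f(z) Y_M(a, z) u` on `M`, linear in `a ∈ V`. -/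
def res (k : Type*) {V : Type*} (M : Type*) [Field k] [AddCommGroup V] [Module k V]
    [VertexOperatorAlgebra k V] [AddCommGroup M] [Module k M] [AdmissibleModule k V M]
    (f : LaurentSeries k) : V →ₗ[k] Module.End k M :=
  residue.flip f ∘ₗ moduleOp

/-- The linear map on `V = ⨁ V_n` that agrees with `φ n` on `V_n`. -/
def onWeights {k V W : Type*} [Field k] [AddCommGroup V] [Module k V]
    [VertexOperatorAlgebra k V] [AddCommGroup W] [Module k W] (φ : ℕ → V →ₗ[k] W) : V →ₗ[k] W :=
  DirectSum.toModule k ℕ W (fun n => φ n ∘ₗ (weight (k := k) n).subtype) ∘ₗ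
    (LinearEquiv.ofBijective (DirectSum.coeLinearMap (weight (k := k) (V := V)))
      weight_isInternal).symm.toLinearMap

theorem onWeights_apply {k V W : Type*} [Field k] [AddCommGroup V] [Module k V]
    [VertexOperatorAlgebra k V] [AddCommGroup W] [Module k W] (φ : ℕ → V →ₗ[k] W) {n : ℕ} {a : V}
    (ha : a ∈ weight (k := k) n) : onWeights φ a = φ n a := by
  have h : (LinearEquiv.ofBijective (DirectSum.coeLinearMap (weight (k := k) (V := V)))
      weight_isInternal).symm a = DirectSum.lof k ℕ (fun n => weight (k := k) (V := V) n) n ⟨a, ha⟩ := by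
    rw [LinearEquiv.symm_apply_eq]
    exact (DirectSum.coeLinearMap_lof (weight (k := k) (V := V)) n ⟨a, ha⟩).symm
  rw [onWeights, LinearMap.comp_apply]
  erw [h, DirectSum.toModule_lof]
  rfl

variable (k : Type*) {V : Type*} (M : Type*) [Field k] [AddCommGroup V] [Module k V]
  [VertexOperatorAlgebra k V] [AddCommGroup M] [Module k M] [AdmissibleModule k V M]

/-- The left product `a * u = Res_z Y_M(a, z) u (1 + z)^(wt a) / z`, for homogeneous `a`. -/
def leftStar : V →ₗ[k] Module.End k M := onWeights fun n => res k M (kern n (-1))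

/-- The right product `u * a = Res_z Y_M(a, z) u (1 + z)^(wt a - 1) / z`, for homogeneous `a`,
as an operator on `u`. -/
def rightStar : V →ₗ[k] Module.End k M := onWeights fun n => res k M (kern (n - 1) (-1))

variable (V) in
/-- The subspace `O(M)` spanned by all `Res_z Y_M(a, z) u (1 + z)^(wt a) / z^2`, with `a ∈ V`
homogeneous and `u ∈ M`. -/
def zhuO : Submodule k M :=
  Submodule.span k {x | ∃ (n : ℕ) (a : V) (_ : a ∈ weight (k := k) n) (u : M),
    x = res k M (kern n (-2)) a u}

variable {k M}

/-- `a` is homogeneous of weight `n`. -/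
abbrev Hom (k : Type*) {V : Type*} [Field k] [AddCommGroup V] [Module k V]
    [VertexOperatorAlgebra k V] (a : V) (n : ℤ) : Prop :=
  a ∈ intPart (weight (k := k) (V := V)) n

theorem leftStar_hom {a : V} {p : ℤ} (ha : Hom k a p) :
    leftStar k M a = res k M (kern p (-1)) a := by
  rcases mem_intPart ha with rfl | ⟨n, rfl, h⟩
  · simp
  · exact onWeights_apply _ h

theorem rightStar_hom {a : V} {p : ℤ} (ha : Hom k a p) :
    rightStar k M a = res k M (kern (p - 1) (-1)) a := by
  rcases mem_intPart ha with rfl | ⟨n, rfl, h⟩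
  · simp
  · exact onWeights_apply _ h

theorem zhuO_hom {a : V} {p : ℤ} (ha : Hom k a p) (u : M) :
    res k M (kern p (-2)) a u ∈ zhuO k V M := by
  rcases mem_intPart ha with rfl | ⟨n, rfl, h⟩
  · simp
  · exact Submodule.subset_span ⟨n, a, h, u, rfl⟩

theorem mode_hom {a b : V} {p r : ℤ} (ha : Hom k a p) (hb : Hom k b r) (n : ℤ) :
    Hom k (mode (vertexOp (k := k)) a n b) (p + r - n - 1) := by
  rcases mem_intPart ha with rfl | ⟨p, rfl, h⟩
  · simp [mode, Hom]
  rcases mem_intPart hb with rfl | ⟨r, rfl, h'⟩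
  · simp [Hom]
  exact VertexOperatorAlgebra.mode_mem _ _ _ _ _ h h'

theorem module_mode_hom {a : V} {u : M} {p r : ℤ} (ha : Hom k a p)
    (hu : u ∈ intPart (degree (k := k) V) r) (n : ℤ) :
    mode (moduleOp (k := k)) a n u ∈ intPart (degree (k := k) (M := M) V) (p + r - n - 1) := by
  rcases mem_intPart ha with rfl | ⟨p, rfl, h⟩
  · simp [mode]
  rcases mem_intPart hu with rfl | ⟨r, rfl, h'⟩
  · simp
  exact AdmissibleModule.mode_mem _ _ _ _ _ h h'

theorem res_apply (f : LaurentSeries k) (a : V) (u : M) :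
    res k M f a u = residue (moduleOp (k := k) a) f u := rfl

theorem res_add (f g : LaurentSeries k) (a : V) (u : M) :
    res k M (f + g) a u = res k M f a u + res k M g a u := by
  rw [res_apply, map_add]; rfl

theorem res_eq_zero (a : V) (u : M) :
    ∃ K, ∀ f : LaurentSeries k, SuppGE f K → res k M f a u = 0 :=
  disc_residue (moduleOp (k := k) a) u

/-! Coefficients of the kernel. -/

theorem one_add_zpow_supp (p : ℤ) :
    SuppGE ((1 + zpw 1 : LaurentSeries k) ^ p) 0 ∧ ((1 + zpw 1 : LaurentSeries k) ^ p).coeff 0 = 1 := by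
  have e : ∀ (f : LaurentSeries k) (n : ℤ),
      ((1 + zpw 1) * f).coeff n = f.coeff n + f.coeff (n - 1) := by
    intro f n
    rw [add_mul, one_mul, HahnSeries.coeff_add]
    have := HahnSeries.coeff_single_mul_add (r := (1:k)) (x := f) (a := n - 1) (b := 1)
    rw [one_mul, sub_add_cancel] at this
    rw [this]
  induction p using Int.induction_on with
  | zero =>
    rw [zpow_zero]
    exact ⟨SuppGE.zpw 0, by simp⟩
  | succ p ih =>
    rw [zpow_add_one₀ one_add_ne, mul_comm]
    refine ⟨fun n hn => ?_, ?_⟩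
    · rw [e, ih.1 n hn, ih.1 (n - 1) (by omega), add_zero]
    · rw [e, ih.1 (0 - 1) (by omega), ih.2, add_zero]
  | pred p ih =>
    set f : LaurentSeries k := (1 + zpw 1) ^ (-(p : ℤ) - 1) with hf
    have hm : (1 + zpw 1) * f = (1 + zpw 1 : LaurentSeries k) ^ (-(p : ℤ)) := by
      rw [hf, mul_comm, ← zpow_add_one₀ one_add_ne, sub_add_cancel]
    rw [← hm] at ih
    obtain ⟨K, hK⟩ := exists_suppGE f
    have hs : SuppGE f 0 := by
      intro n hn
      by_cases hKn : n < K
      · exact hK n hKn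
      · push Not at hKn
        revert hn
        induction n, hKn using Int.leInduction with
        | base =>
          intro hn
          have := ih.1 K hn
          rwa [e, hK (K - 1) (by omega), add_zero] at this
        | succ n hn' ih' =>
          intro hn
          have := ih.1 (n + 1) hn
          rwa [e, add_sub_cancel_right, ih' (by omega), add_zero] at this
    refine ⟨hs, ?_⟩
    have := ih.2
    rwa [e, hs (0 - 1) (by omega), add_zero] at this

theorem kern_supp (p q : ℤ) : SuppGE (kern p q : LaurentSeries k) q :=
  ((one_add_zpow_supp p).1.mul (SuppGE.zpw q)).mono (by omega)

theorem one_add_zpow_coeff (p : ℤ) (i : ℕ) :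
    ((1 + zpw 1 : LaurentSeries k) ^ p).coeff i = binom p i := by
  have h := congrArg (fun f : LaurentSeries k => f.coeff 0) (hasse_one_add_zpow (k := k) p i)
  simp only [hD_coeff, HahnSeries.coeff_smul, (one_add_zpow_supp (k := k) (p - i)).2] at h
  simpa [binom, Ring.choose_natCast] using h

theorem res_kern (p q : ℤ) (a : V) (u : M) : ∃ N₀ : ℕ, ∀ N ≥ N₀,
    res k M (kern p q) a u = ∑ i ∈ Finset.range N, (binom p i : k) • mode (moduleOp (k := k)) a (q + i) u := by
  obtain ⟨K, hK⟩ := res_eq_zero (k := k) a u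
  refine ⟨(K - q).toNat, fun N hN => ?_⟩
  set s : LaurentSeries k := ∑ i ∈ Finset.range N, (binom p i : k) • zpw (i : ℤ) with hs
  have h0 : SuppGE ((1 + zpw 1 : LaurentSeries k) ^ p - s) N := by
    intro n hn
    rw [HahnSeries.coeff_sub, hs, HahnSeries.coeff_sum]
    by_cases hm : n < 0
    · rw [(one_add_zpow_supp p).1 n hm, Finset.sum_eq_zero, sub_zero]
      intro j _
      rw [HahnSeries.coeff_smul, HahnSeries.coeff_single_of_ne (by omega), smul_zero]
    · obtain ⟨m, rfl⟩ := Int.eq_ofNat_of_zero_le (not_lt.1 hm)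
      rw [Finset.sum_eq_single m]
      · rw [one_add_zpow_coeff]; simp
      · intro j _ hj
        rw [HahnSeries.coeff_smul, HahnSeries.coeff_single_of_ne (by omega), smul_zero]
      · intro h; exact absurd (Finset.mem_range.2 (by omega)) h
  have h1 : res k M (kern p q - s * zpw q) a u = 0 := by
    apply hK
    rw [kern_eq, ← sub_mul]
    exact (h0.mul (SuppGE.zpw q)).mono (by omega)
  have h2 : res k M (kern p q) a u = res k M (s * zpw q) a u := by
    rw [← sub_eq_zero, ← h1, res_apply, res_apply, res_apply, map_sub]; rfl
  rw [h2, res_apply, hs, Finset.sum_mul, map_sum, LinearMap.sum_apply]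
  refine Finset.sum_congr rfl fun i _ => ?_
  rw [lsmul_mul, zpw_mul, map_smul, LinearMap.smul_apply, residue_zpw_eq_mode, add_comm q]

theorem binom_neg_one (i : ℕ) : ((-1) ^ i * binom (-1) i : k) = 1 := by
  have h : ∀ i : ℕ, (binom (-1) i : k) = (-1) ^ i := by
    intro i
    induction i with
    | zero => simp [binom]
    | succ i ih =>
      have := binom_succ_succ (k := k) (-1) i
      rw [ih, neg_add_cancel, binom, Ring.choose_zero_succ] at this
      rw [pow_succ]; push_cast at this
      linear_combination -this
  rw [h, ← mul_pow]; simp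

theorem binom_neg_two (i : ℕ) : ((-1) ^ i * binom (-2) i : k) = i + 1 := by
  induction i with
  | zero => simp [binom]
  | succ i ih =>
    have := binom_succ_succ (k := k) (-2) i
    have h1 := binom_neg_one (k := k) (i + 1)
    rw [show (-2 + 1 : ℤ) = -1 by norm_num] at this
    rw [this] at h1
    push_cast
    rw [pow_succ] at h1 ⊢
    linear_combination h1 + ih

theorem mode_shift (a : V) (n : ℤ) (u : M) :
    mode (moduleOp (k := k)) (mode (vertexOp (k := k)) a (-2) (vacuum k)) n u =
      (-n : k) • mode (moduleOp (k := k)) a (n - 1) u := by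
  have h := AdmissibleModule.borcherds (k := k) a (vacuum k) u (-2) 0 n
  rw [finsum_eq_single _ 0] at h
  · have e1 : mode (moduleOp (k := k)) (mode (vertexOp (k := k)) a (-2) (vacuum k)) n u =
        (binom 0 0 : k) • mode (moduleOp (k := k))
          (mode (vertexOp (k := k)) a (-2 + (0 : ℕ)) (vacuum k)) (0 + n - (0 : ℕ)) u := by
      simp [binom]
    rw [e1, h]
    simp only [AdmissibleModule.vacuum_mode]
    rcases lt_trichotomy n 0 with hn | rfl | hn
    · rw [finsum_eq_single _ (-1 - n).toNat]
      · rw [binom_neg_two, if_pos (by omega), if_neg (by omega), smul_zero, sub_zero]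
        have : (((-1 - n).toNat : ℕ) : ℤ) = -1 - n := by omega
        rw [this, show (0 + -2 - (-1 - n) : ℤ) = n - 1 by ring]
        congr 1
        have := congrArg (fun z : ℤ => (z : k)) this
        push_cast at this
        rw [this]; ring
      · intro i hi
        rw [if_neg (by omega), if_neg (by omega)]; simp
    · rw [finsum_eq_zero_of_forall_eq_zero]
      · simp
      · intro i
        rw [if_neg (by omega), if_neg (by omega)]; simp
    · rw [finsum_eq_single _ (n - 1).toNat]
      · rw [binom_neg_two, if_neg (by omega), if_pos (by omega), map_zero]
        have : (((n - 1).toNat : ℕ) : ℤ) = n - 1 := by omega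
        rw [this, show (0 + (n - 1) : ℤ) = n - 1 by ring]
        have := congrArg (fun z : ℤ => (z : k)) this
        push_cast at this
        rw [this, zero_sub, show ((-1 : k) ^ (-2 : ℤ)) = 1 by norm_num [zpow_neg], one_smul, smul_neg,
          ← neg_smul]
        congr 1; ring
      · intro i hi
        rw [if_neg (by omega), if_neg (by omega)]; simp
  · intro i hi
    obtain ⟨j, rfl⟩ := Nat.exists_eq_succ_of_ne_zero hi
    rw [binom, Nat.succ_eq_add_one, Ring.choose_zero_succ]; simp

theorem res_shift (f : LaurentSeries k) (a : V) (u : M) :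
    res k M f (mode (vertexOp (k := k)) a (-2) (vacuum k)) u = - res k M (hD 1 f) a u := by
  obtain ⟨m, hm⟩ := exists_suppGE f
  have := Disc.eqOn
    (φ := resAt (moduleOp (mode (vertexOp (k := k)) a (-2) (vacuum k))) u)
    (ψ := (-1 : k) • (resAt (moduleOp a) u ∘ₗ hD 1)) (disc_residue _ _)
    (((disc_residue _ _).precomp _ (-((1 : ℕ) : ℤ)) fun f K hf => hf.hasseDeriv 1).smul _) m ?_ f hm
  · rw [LinearMap.smul_apply, neg_smul, one_smul] at this
    exact this
  · intro n _
    rw [LinearMap.smul_apply, LinearMap.comp_apply, hD_zpw, map_smul, resAt_apply, resAt_apply,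
      residue_zpw_eq_mode, residue_zpw_eq_mode, mode_shift, smul_smul]
    congr 1
    simp [binom]

theorem hD_one_kern (p q : ℤ) :
    hD 1 (kern p q : LaurentSeries k) = (p : k) • kern (p - 1) q + (q : k) • kern p (q - 1) := by
  have key : ∀ q : ℤ, hD 1 (kern p (q + 1) : LaurentSeries k) =
      zpw 1 * hD 1 (kern p q : LaurentSeries k) + kern p q := by
    intro q
    rw [← zpw_mul_kern, hasse_zpw_mul 0, hD_zero]
  induction q using Int.induction_on with
  | zero =>
    have : (kern p 0 : LaurentSeries k) = (1 + zpw 1) ^ p := by rw [kern_eq]; exact mul_one _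
    rw [this, hasse_one_add_zpow]
    have : (kern (p - 1) 0 : LaurentSeries k) = (1 + zpw 1) ^ (p - 1) := by
      rw [kern_eq]; exact mul_one _
    rw [this]; simp [binom]
  | succ q ih =>
    rw [key, ih, mul_add, mul_lsmul, mul_lsmul, zpw_mul_kern, zpw_mul_kern, add_assoc]
    congr 1
    rw [sub_add_cancel, add_sub_cancel_right]; push_cast; rw [add_smul, one_smul]
  | pred q ih =>
    have h := key (-q - 1)
    rw [sub_add_cancel, ih] at h
    have h' : zpw (-1) * (zpw 1 * hD 1 (kern p (-(q:ℤ) - 1) : LaurentSeries k)) =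
        hD 1 (kern p (-(q:ℤ) - 1)) := by
      rw [← mul_assoc, zpw_mul]; exact one_mul _
    rw [← h', ← sub_eq_iff_eq_add.2 h, mul_sub, mul_add, mul_lsmul, mul_lsmul, zpw_mul_kern,
      zpw_mul_kern, ← sub_eq_add_neg, ← sub_eq_add_neg]
    push_cast
    rw [sub_smul (-(q : k)) 1, one_smul, add_sub_assoc]

theorem iter (a b : V) (u : M) (l p r q : ℤ) : ∃ N₀ : ℕ, ∀ N ≥ N₀,
    ∑ i ∈ Finset.range N, (binom p i : k) •
      res k M (kern (p + r - i) q) (mode (vertexOp (k := k)) a (l + i) b) u =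
    ∑ i ∈ Finset.range N, ((-1) ^ i * binom l i : k) •
      (res k M (kern p (l - i)) a (res k M (kern r (q + i)) b u) -
        (-1 : k) ^ l • res k M (kern r (q + (l - i))) b (res k M (kern p i) a u)) := by
  obtain ⟨N₀, h⟩ := (AdmissibleModule.borcherds (k := k) (V := V) (M := M)).residues a b u l
    (kern p 0) (kern r q)
  refine ⟨N₀, fun N hN => ?_⟩
  refine Eq.trans (Finset.sum_congr rfl fun i _ => ?_)
    ((h N hN).trans (Finset.sum_congr rfl fun i _ => ?_))
  · rw [hasse_kern_zero_mul_kern, map_smul]; rfl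
  · simp only [zpw_mul_kern, zero_add]; rfl

theorem shift_hom {a : V} {p : ℤ} (ha : Hom k a p) :
    Hom k (mode (vertexOp (k := k)) a (-2) (vacuum k)) (p + 1) := by
  have := mode_hom ha (mem_intPart_of_mem (vacuum_mem (k := k) (V := V))) (-2)
  rw [show p + ((0 : ℕ) : ℤ) - -2 - 1 = p + 1 by push_cast; ring] at this
  exact this

theorem kern_mem_zero [CharZero k] (m : ℕ) : ∀ {a : V} {p : ℤ} (_ : Hom k a p) (u : M),
    res k M (kern p (-2 - m)) a u ∈ zhuO k V M := by
  induction m with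
  | zero => intro a p ha u; simpa using zhuO_hom ha u
  | succ m ih =>
    intro a p ha u
    have h1 := ih (shift_hom ha) u
    have h2 := ih ha u
    rw [res_shift, hD_one_kern, add_sub_cancel_right, kern_succ, sub_add_cancel] at h1
    have e : (((m : k) + 2) • res k M (kern p (-2 - ((m + 1 : ℕ) : ℤ))) a u) =
        - res k M (((p + 1 : ℤ) : k) • kern p (-2 - (m : ℤ)) + ((-2 - m : ℤ) : k) •
          (kern p (-2 - (m : ℤ) - 1) + kern p (-2 - (m : ℤ)))) a u +
        ((p : k) - 1 - m) • res k M (kern p (-2 - (m : ℤ))) a u := by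
      have e' : (-2 - ((m + 1 : ℕ) : ℤ)) = -2 - (m : ℤ) - 1 := by push_cast; ring
      rw [e']
      simp only [res_apply, map_add, map_smul, LinearMap.add_apply, LinearMap.smul_apply]
      push_cast
      module
    have hne : ((m : k) + 2) ≠ 0 := by exact_mod_cast (Nat.succ_ne_zero (m + 1))
    rw [← Submodule.smul_mem_iff _ hne, e]
    exact Submodule.add_mem _ h1 (Submodule.smul_mem _ _ h2)

theorem kern_mem [CharZero k] (n : ℕ) : ∀ (m : ℕ) (_ : n ≤ m) {a : V} {p : ℤ} (_ : Hom k a p)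
    (u : M), res k M (kern (p + n) (-2 - m)) a u ∈ zhuO k V M := by
  induction n with
  | zero => intro m _ a p ha u; simpa using kern_mem_zero m ha u
  | succ n ih =>
    intro m hm a p ha u
    obtain ⟨m, rfl⟩ := Nat.exists_eq_succ_of_ne_zero (by omega : m ≠ 0)
    have e : (kern (p + ((n + 1 : ℕ) : ℤ)) (-2 - ((m.succ : ℕ) : ℤ)) : LaurentSeries k) =
        kern (p + n) (-2 - ((m.succ : ℕ) : ℤ)) + kern (p + n) (-2 - (m : ℤ)) := by
      rw [show p + ((n + 1 : ℕ) : ℤ) = p + n + 1 by push_cast; ring, kern_succ]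
      congr 2; push_cast; ring
    rw [e, res_add]
    exact Submodule.add_mem _ (ih _ (by omega) ha u) (ih _ (by omega) ha u)

theorem kern_mem' [CharZero k] {a : V} {p : ℤ} (ha : Hom k a p) (u : M) {p' q : ℤ}
    (h1 : p ≤ p') (h2 : q ≤ -2 - (p' - p)) : res k M (kern p' q) a u ∈ zhuO k V M := by
  have := kern_mem (p' - p).toNat (-2 - q).toNat (by omega) ha u
  rw [show p + ((p' - p).toNat : ℤ) = p' by omega, show -2 - ((-2 - q).toNat : ℤ) = q by omega]
    at this
  exact this

/-- The operator `Res_z Y(a, z) (1 + z)^(wt a - 1)`, which is `u ↦ a * u - u * a`. -/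
def cOp (k : Type*) {V : Type*} (M : Type*) [Field k] [AddCommGroup V] [Module k V]
    [VertexOperatorAlgebra k V] [AddCommGroup M] [Module k M] [AdmissibleModule k V M]
    (p : ℤ) (a : V) : Module.End k M := res k M (kern (p - 1) 0) a

theorem left_sub_right {a : V} {p : ℤ} (ha : Hom k a p) (u : M) :
    leftStar k M a u = rightStar k M a u + cOp k M p a u := by
  rw [leftStar_hom ha, rightStar_hom ha, cOp, ← res_add]
  have := kern_succ (k := k) (p - 1) (-1)
  rw [sub_add_cancel, neg_add_cancel] at this
  rw [this]

theorem cOp_comm (a b : V) (u : M) (p r q : ℤ) : ∃ N₀ : ℕ, ∀ N ≥ N₀,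
    cOp k M p a (res k M (kern r q) b u) = res k M (kern r q) b (cOp k M p a u) +
    ∑ i ∈ Finset.range N, (binom (p - 1) i : k) •
      res k M (kern (p - 1 + r - i) q) (mode (vertexOp (k := k)) a i b) u := by
  obtain ⟨N₀, h⟩ := iter (k := k) a b u 0 (p - 1) r q
  refine ⟨max N₀ 1, fun N hN => ?_⟩
  have h := h N (le_trans (le_max_left _ _) hN)
  simp only [zero_add] at h
  rw [h, Finset.sum_eq_single 0]
  · simp [binom, cOp]
  · intro i _ hi
    obtain ⟨j, rfl⟩ := Nat.exists_eq_succ_of_ne_zero hi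
    simp only [binom, Nat.succ_eq_add_one, Ring.choose_zero_succ]; simp
  · intro h0
    exact absurd (Finset.mem_range.2 (by have := le_max_right N₀ 1; omega)) h0

/-- The submodule `O(M)` is stable under `T` as soon as this holds on generators. -/
theorem zhuO_le {T : Module.End k M}
    (h : ∀ (b : V) (r : ℤ) (_ : Hom k b r) (u : M), T (res k M (kern r (-2)) b u) ∈ zhuO k V M)
    {x : M} (hx : x ∈ zhuO k V M) : T x ∈ zhuO k V M := by
  induction hx using Submodule.span_induction with
  | mem x hx =>
    obtain ⟨n, b, hb, u, rfl⟩ := hx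
    exact h b n (mem_intPart_of_mem hb) u
  | zero => simp
  | add x y _ _ hx hy => rw [map_add]; exact Submodule.add_mem _ hx hy
  | smul c x _ hx => rw [map_smul]; exact Submodule.smul_mem _ _ hx

theorem cOp_mem [CharZero k] {a : V} {p : ℤ} (ha : Hom k a p) {x : M} (hx : x ∈ zhuO k V M) :
    cOp k M p a x ∈ zhuO k V M := by
  refine zhuO_le (fun b r hb u => ?_) hx
  obtain ⟨N₀, h⟩ := cOp_comm (k := k) a b u p r (-2)
  rw [h N₀ le_rfl]
  refine Submodule.add_mem _ (zhuO_hom hb _) (Submodule.sum_mem _ fun i _ => ?_)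
  refine Submodule.smul_mem _ _ (kern_mem' (mode_hom ha hb i) u ?_ ?_) <;> omega

theorem left_mem_hom [CharZero k] {a : V} {p : ℤ} (ha : Hom k a p) {x : M}
    (hx : x ∈ zhuO k V M) : leftStar k M a x ∈ zhuO k V M := by
  refine zhuO_le (fun b r hb u => ?_) hx
  rw [leftStar_hom ha]
  obtain ⟨N₀, h⟩ := iter (k := k) a b u (-1) p r (-2)
  have h := (h (N₀ + 1) (by omega)).symm
  rw [Finset.sum_range_succ', ← eq_sub_iff_add_eq] at h
  simp only [binom_neg_one, one_smul, Nat.cast_zero, sub_zero, add_zero] at h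
  have key : res k M (kern p (-1)) a (res k M (kern r (-2)) b u) =
      (∑ i ∈ Finset.range (N₀ + 1), (binom p i : k) •
        res k M (kern (p + r - i) (-2)) (mode (vertexOp (k := k)) a (-1 + i) b) u) -
      (∑ i ∈ Finset.range N₀, (res k M (kern p (-1 - ((i + 1 : ℕ) : ℤ))) a
          (res k M (kern r (-2 + ((i + 1 : ℕ) : ℤ))) b u) -
        (-1 : k) ^ (-1 : ℤ) • res k M (kern r (-2 + (-1 - ((i + 1 : ℕ) : ℤ)))) b
          (res k M (kern p ((i + 1 : ℕ) : ℤ)) a u))) +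
      (-1 : k) ^ (-1 : ℤ) • res k M (kern r (-2 + -1)) b (res k M (kern p 0) a u) := by
    rw [h]; abel
  rw [key]
  refine Submodule.add_mem _ (Submodule.sub_mem _ (Submodule.sum_mem _ fun i _ => ?_)
    (Submodule.sum_mem _ fun i _ => Submodule.sub_mem _ ?_ ?_)) ?_
  · exact Submodule.smul_mem _ _ (kern_mem' (mode_hom ha hb _) u (by omega) (by omega))
  · exact kern_mem' ha _ (by omega) (by omega)
  · exact Submodule.smul_mem _ _ (kern_mem' hb _ (by omega) (by omega))
  · exact Submodule.smul_mem _ _ (kern_mem' hb _ (by omega) (by omega))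

theorem right_mem_hom [CharZero k] {a : V} {p : ℤ} (ha : Hom k a p) {x : M}
    (hx : x ∈ zhuO k V M) : rightStar k M a x ∈ zhuO k V M := by
  have := left_sub_right ha x
  rw [← sub_eq_iff_eq_add] at this
  rw [← this]
  exact Submodule.sub_mem _ (left_mem_hom ha hx) (cOp_mem ha hx)

theorem res_kern_V (p q : ℤ) (a b : V) : ∃ N₀ : ℕ, ∀ N ≥ N₀, res k V (kern p q) a b =
    ∑ i ∈ Finset.range N, (binom p i : k) • mode (vertexOp (k := k)) a (q + i) b :=
  res_kern p q a b

theorem iter_two_mem [CharZero k] {a b : V} {p r : ℤ} (ha : Hom k a p) (hb : Hom k b r) (u : M)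
    {r' : ℤ} (h1 : r ≤ r') (h2 : r' ≤ r + 1) : ∃ N₀ : ℕ, ∀ N ≥ N₀,
    ∑ i ∈ Finset.range N, (binom p i : k) •
      res k M (kern (p + r' - i) (-1)) (mode (vertexOp (k := k)) a (-2 + i) b) u ∈
      zhuO k V M := by
  obtain ⟨N₀, h⟩ := iter (k := k) a b u (-2) p r' (-1)
  refine ⟨N₀, fun N hN => ?_⟩
  rw [h N hN]
  refine Submodule.sum_mem _ fun i _ => Submodule.smul_mem _ _ (Submodule.sub_mem _ ?_ ?_)
  · exact kern_mem' ha _ (by omega) (by omega)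
  · exact Submodule.smul_mem _ _ (kern_mem' hb _ (by omega) (by omega))

theorem left_zhuO_hom [CharZero k] {a b : V} {p r : ℤ} (ha : Hom k a p) (hb : Hom k b r) (u : M) :
    leftStar k M (res k V (kern p (-2)) a b) u ∈ zhuO k V M := by
  obtain ⟨N₀, h⟩ := res_kern_V (k := k) p (-2) a b
  obtain ⟨N₁, h'⟩ := iter_two_mem ha hb u (r' := r + 1) (by omega) (by omega)
  rw [h (max N₀ N₁) (le_max_left _ _), map_sum, LinearMap.sum_apply]
  have := h' (max N₀ N₁) (le_max_right _ _)
  convert this using 2 with i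
  rw [map_smul, LinearMap.smul_apply, leftStar_hom (mode_hom ha hb _)]
  rw [show p + r - (-2 + (i : ℤ)) - 1 = p + (r + 1) - i by ring]

theorem right_zhuO_hom [CharZero k] {a b : V} {p r : ℤ} (ha : Hom k a p) (hb : Hom k b r) (u : M) :
    rightStar k M (res k V (kern p (-2)) a b) u ∈ zhuO k V M := by
  obtain ⟨N₀, h⟩ := res_kern_V (k := k) p (-2) a b
  obtain ⟨N₁, h'⟩ := iter_two_mem ha hb u (r' := r) (by omega) (by omega)
  rw [h (max N₀ N₁) (le_max_left _ _), map_sum, LinearMap.sum_apply]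
  have := h' (max N₀ N₁) (le_max_right _ _)
  convert this using 2 with i
  rw [map_smul, LinearMap.smul_apply, rightStar_hom (mode_hom ha hb _)]
  rw [show p + r - (-2 + (i : ℤ)) - 1 - 1 = p + r - i by ring]

theorem left_assoc_hom [CharZero k] {a b : V} {p r : ℤ} (ha : Hom k a p) (hb : Hom k b r) (u : M) :
    leftStar k M (leftStar k V a b) u - leftStar k M a (leftStar k M b u) ∈
      zhuO k V M := by
  obtain ⟨N₀, h⟩ := res_kern_V (k := k) p (-1) a b
  obtain ⟨N₁, h'⟩ := iter (k := k) a b u (-1) p r (-1)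
  have h := h (N₀ + N₁ + 1) (by omega)
  have h' := h' (N₀ + N₁ + 1) (by omega)
  have e : leftStar k M (leftStar k V a b) u =
      ∑ i ∈ Finset.range (N₀ + N₁ + 1), (binom p i : k) •
      res k M (kern (p + r - i) (-1)) (mode (vertexOp (k := k)) a (-1 + i) b) u := by
    rw [leftStar_hom ha, h, map_sum, LinearMap.sum_apply]
    refine Finset.sum_congr rfl fun i _ => ?_
    rw [map_smul, LinearMap.smul_apply, leftStar_hom (mode_hom ha hb _)]
    rw [show p + r - (-1 + (i : ℤ)) - 1 = p + r - i by ring]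
  rw [e, h', Finset.sum_range_succ', leftStar_hom ha, leftStar_hom hb]
  simp only [binom_neg_one, one_smul, Nat.cast_zero, sub_zero, add_zero]
  rw [add_sub_assoc, sub_sub_cancel_left]
  refine Submodule.add_mem _ (Submodule.sum_mem _ fun i _ => Submodule.sub_mem _ ?_ ?_)
    (Submodule.neg_mem _ ?_)
  · exact kern_mem' ha _ (by omega) (by omega)
  · exact Submodule.smul_mem _ _ (kern_mem' hb _ (by omega) (by omega))
  · exact Submodule.smul_mem _ _ (kern_mem' hb _ (by omega) (by omega))

theorem hD_kern_mem (p : ℤ) (i : ℕ) : (hD i (kern p (-1)) : LaurentSeries k) ∈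
    Submodule.span k {f | ∃ j m : ℕ, j + m = i ∧ f = kern (p - j) (-1 - m)} := by
  induction i with
  | zero =>
    rw [hD_zero]
    exact Submodule.subset_span ⟨0, 0, rfl, by simp⟩
  | succ i ih =>
    have h := hasse_zpw_mul i (kern p (-1) : LaurentSeries k)
    rw [zpw_mul_kern, neg_add_cancel] at h
    have h0 : (kern p 0 : LaurentSeries k) = (1 + zpw 1) ^ p := by rw [kern_eq]; exact mul_one _
    have h0' : (kern (p - ((i + 1 : ℕ) : ℤ)) 0 : LaurentSeries k) =
      (1 + zpw 1) ^ (p - ((i + 1 : ℕ) : ℤ)) := by rw [kern_eq]; exact mul_one _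
    rw [h0, hasse_one_add_zpow, ← h0'] at h
    have e : hD (i + 1) (kern p (-1) : LaurentSeries k) =
        (binom p (i + 1) : k) • kern (p - ((i + 1 : ℕ) : ℤ)) (-1) -
          mulL (zpw (-1)) (hD i (kern p (-1))) := by
      have h1 : zpw (-1) * (zpw 1 * hD (i + 1) (kern p (-1) : LaurentSeries k)) =
          hD (i + 1) (kern p (-1)) := by
        rw [← mul_assoc, zpw_mul]; exact one_mul _
      rw [← h1, ← sub_eq_iff_eq_add.2 h, mul_sub, mul_lsmul, zpw_mul_kern, zero_add]; rfl
    rw [e]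
    refine Submodule.sub_mem _ (Submodule.smul_mem _ _ (Submodule.subset_span
      ⟨i + 1, 0, by omega, by simp⟩)) ?_
    refine (Submodule.map_span_le (mulL (zpw (-1))) _ _).2 ?_ (Submodule.mem_map_of_mem ih)
    rintro _ ⟨j, m, hjm, rfl⟩
    refine Submodule.subset_span ⟨j, m + 1, by omega, ?_⟩
    change zpw (-1) * kern (p - j) (-1 - (m : ℤ)) = _
    rw [zpw_mul_kern]; congr 1; push_cast; ring

theorem left_right_hom [CharZero k] {a b : V} {p r : ℤ} (ha : Hom k a p) (hb : Hom k b r) (u : M) :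
    leftStar k M a (rightStar k M b u) - rightStar k M b (leftStar k M a u) ∈ zhuO k V M := by
  obtain ⟨N₀, h⟩ := (AdmissibleModule.borcherds (k := k) (V := V) (M := M)).residues a b u 0
    (kern p (-1)) (kern (r - 1) (-1))
  have h := h (N₀ + 1) (by omega)
  have e : leftStar k M a (rightStar k M b u) - rightStar k M b (leftStar k M a u) =
      ∑ i ∈ Finset.range (N₀ + 1),
        residue (moduleOp (k := k) (mode (vertexOp (k := k)) a (0 + (i : ℤ)) b))
          (hD i (kern p (-1)) * kern (r - 1) (-1)) u := by
    rw [h, Finset.sum_eq_single 0, leftStar_hom ha, rightStar_hom hb]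
    · simp only [Nat.cast_zero, sub_zero, zpw_zero_mul, zpow_zero, one_smul, pow_zero, one_mul]
      simp [binom]; rfl
    · intro i _ hi
      obtain ⟨j, rfl⟩ := Nat.exists_eq_succ_of_ne_zero hi
      simp only [binom, Nat.succ_eq_add_one, Ring.choose_zero_succ]; simp
    · intro h0
      exact absurd (Finset.mem_range.2 (by omega)) h0
  rw [e]
  refine Submodule.sum_mem _ fun i _ => ?_
  have hc := mode_hom ha hb (0 + (i : ℤ))
  set c := mode (vertexOp (k := k)) a (0 + (i : ℤ)) b
  have key : ∀ f ∈ Submodule.span k {f : LaurentSeries k | ∃ j m : ℕ, j + m = i ∧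
      f = kern (p - j) (-1 - m)}, res k M (f * kern (r - 1) (-1)) c u ∈ zhuO k V M := by
    intro f hf
    induction hf using Submodule.span_induction with
    | mem f hf =>
      obtain ⟨j, m, hjm, rfl⟩ := hf
      have : (kern (p - j) (-1 - (m : ℤ)) * kern (r - 1) (-1) : LaurentSeries k) =
          kern (p + r - 1 - j) (-2 - m) := by
        rw [kern_eq, kern_eq, kern_eq, mul_mul_mul_comm, zpw_mul, ← zpow_add₀ one_add_ne,
          show p - j + (r - 1) = p + r - 1 - j by ring,
          show -1 - (m : ℤ) + -1 = -2 - m by ring]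
      rw [this]
      exact kern_mem' hc u (by omega) (by omega)
    | zero => simp [res_apply]
    | add f g _ _ hf hg => rw [add_mul, res_add]; exact Submodule.add_mem _ hf hg
    | smul t f _ hf =>
      rw [lsmul_mul, res_apply, map_smul]; exact Submodule.smul_mem _ _ hf
  exact key _ (hD_kern_mem p i)

theorem alt_sum (p : ℤ) (a : V) (u : M) : ∃ N₀ : ℕ, ∀ N ≥ N₀,
    ∑ i ∈ Finset.range N, ((-1 : k) ^ i) • res k M (kern p i) a u = cOp k M p a u := by
  obtain ⟨K, hK⟩ := res_eq_zero (k := k) a u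
  refine ⟨K.toNat, fun N hN => ?_⟩
  have h : ∀ N : ℕ, ∑ i ∈ Finset.range N, ((-1 : k) ^ i) • res k M (kern p i) a u =
      cOp k M p a u - (-1 : k) ^ N • res k M (kern (p - 1) N) a u := by
    intro N
    induction N with
    | zero => simp [cOp]
    | succ N ih =>
      have := kern_succ (k := k) (p - 1) N
      rw [sub_add_cancel] at this
      rw [Finset.sum_range_succ, ih, this, res_add]
      push_cast
      rw [pow_succ]
      module
  rw [h, hK _ ((kern_supp _ _).mono (by omega)), smul_zero, sub_zero]

theorem right_shift_mem [CharZero k] {b : V} {r : ℤ} (hb : Hom k b r) (v : M) (i : ℕ) :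
    res k M (kern (r - 1) (-1 - (i : ℤ))) b v - (-1 : k) ^ i • rightStar k M b v ∈ zhuO k V M := by
  induction i with
  | zero => rw [rightStar_hom hb]; simp
  | succ i ih =>
    have h := kern_mem' hb v (p' := r) (q := -2 - i) le_rfl (by omega)
    have e := kern_succ (k := k) (r - 1) (-2 - i)
    rw [sub_add_cancel, show -2 - (i : ℤ) + 1 = -1 - i by ring] at e
    rw [e, res_add] at h
    have := Submodule.sub_mem _ h ih
    rw [show -1 - ((i + 1 : ℕ) : ℤ) = -2 - i by push_cast; ring, pow_succ]
    convert this using 1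
    module

theorem right_assoc_hom [CharZero k] {a b : V} {p r : ℤ} (ha : Hom k a p) (hb : Hom k b r)
    (u : M) : rightStar k M (leftStar k V a b) u - rightStar k M b (rightStar k M a u) ∈
      zhuO k V M := by
  obtain ⟨N₀, h⟩ := res_kern_V (k := k) p (-1) a b
  obtain ⟨N₁, h'⟩ := iter (k := k) a b u (-1) p (r - 1) (-1)
  obtain ⟨N₂, h''⟩ := alt_sum (k := k) p a u
  have h := h (N₀ + N₁ + N₂ + 1) (by omega)
  have h' := h' (N₀ + N₁ + N₂ + 1) (by omega)
  have h'' := h'' (N₀ + N₁ + N₂ + 1) (by omega)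
  set N := N₀ + N₁ + N₂ with hN
  have e : rightStar k M (leftStar k V a b) u =
      ∑ i ∈ Finset.range (N + 1), (binom p i : k) •
      res k M (kern (p + (r - 1) - i) (-1)) (mode (vertexOp (k := k)) a (-1 + i) b) u := by
    rw [leftStar_hom ha, h, map_sum, LinearMap.sum_apply]
    refine Finset.sum_congr rfl fun i _ => ?_
    rw [map_smul, LinearMap.smul_apply, rightStar_hom (mode_hom ha hb _)]
    rw [show p + r - (-1 + (i : ℤ)) - 1 - 1 = p + (r - 1) - i by ring]
  have m1 : ∑ i ∈ Finset.range (N + 1), res k M (kern p (-1 - (i : ℤ))) a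
      (res k M (kern (r - 1) (-1 + (i : ℤ))) b u) - leftStar k M a (rightStar k M b u) ∈
      zhuO k V M := by
    rw [Finset.sum_range_succ', leftStar_hom ha, rightStar_hom hb]
    simp only [Nat.cast_zero, sub_zero, add_zero, add_sub_cancel_right]
    refine Submodule.sum_mem _ fun i _ => ?_
    exact kern_mem' ha _ (by omega) (by omega)
  have m2 : ∑ i ∈ Finset.range (N + 1), res k M (kern (r - 1) (-1 + (-1 - (i : ℤ)))) b
      (res k M (kern p i) a u) + rightStar k M b (cOp k M p a u) ∈ zhuO k V M := by
    rw [← h'', map_sum, ← Finset.sum_add_distrib]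
    refine Submodule.sum_mem _ fun i _ => ?_
    have := right_shift_mem hb (res k M (kern p i) a u) (i + 1)
    rw [show -1 - ((i + 1 : ℕ) : ℤ) = -1 + (-1 - (i : ℤ)) by push_cast; ring] at this
    convert this using 1
    rw [map_smul, pow_succ]
    module
  have m3 := left_right_hom ha hb u
  have hc : cOp k M p a u = leftStar k M a u - rightStar k M a u := by
    rw [left_sub_right ha]; abel
  rw [hc, map_sub] at m2
  have := Submodule.add_mem _ (Submodule.add_mem _ m1 m2) m3
  rw [e, h']
  convert this using 1
  simp only [binom_neg_one, one_smul, show ((-1 : k) ^ (-1 : ℤ)) = -1 by norm_num, neg_smul,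
    sub_neg_eq_add, Finset.sum_add_distrib]
  abel

theorem leftStar_vacuum (u : M) : leftStar k M (vacuum k : V) u = u := by
  rw [leftStar_hom (mem_intPart_of_mem vacuum_mem)]
  obtain ⟨N₀, h⟩ := res_kern (k := k) ((0 : ℕ) : ℤ) (-1) (vacuum k : V) u
  rw [h (N₀ + 1) (by omega), Finset.sum_eq_single 0]
  · simp [binom, AdmissibleModule.vacuum_mode]
  · intro i _ hi
    rw [AdmissibleModule.vacuum_mode, if_neg (by omega), smul_zero]
  · intro h; exact absurd (Finset.mem_range.2 (by omega)) h

theorem rightStar_vacuum (u : M) : rightStar k M (vacuum k : V) u = u := by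
  rw [rightStar_hom (mem_intPart_of_mem vacuum_mem)]
  obtain ⟨N₀, h⟩ := res_kern (k := k) (((0 : ℕ) : ℤ) - 1) (-1) (vacuum k : V) u
  rw [h (N₀ + 1) (by omega), Finset.sum_eq_single 0]
  · simp [binom, AdmissibleModule.vacuum_mode]
  · intro i _ hi
    rw [AdmissibleModule.vacuum_mode, if_neg (by omega), smul_zero]
  · intro h; exact absurd (Finset.mem_range.2 (by omega)) h

theorem leftStar_self_vacuum_hom {a : V} {p : ℤ} (ha : Hom k a p) :
    leftStar k V a (vacuum k) = a := by
  rw [leftStar_hom ha]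
  obtain ⟨N₀, h⟩ := res_kern_V (k := k) p (-1) a (vacuum k)
  rw [h (N₀ + 1) (by omega), Finset.sum_eq_single 0]
  · simp [binom, mode_neg_one_vacuum]
  · intro i _ hi
    rw [mode_vacuum _ _ (by omega), smul_zero]
  · intro h; exact absurd (Finset.mem_range.2 (by omega)) h

theorem linear_mem {W : Type*} [AddCommGroup W] [Module k W] (φ : V →ₗ[k] W) {S : Submodule k W}
    (h : ∀ (n : ℕ) (a : V), Hom k a n → φ a ∈ S) (a : V) : φ a ∈ S := by
  have ha : a ∈ iSup (weight (k := k) (V := V)) := by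
    rw [weight_isInternal.submodule_iSup_eq_top]; trivial
  have hle : iSup (weight (k := k) (V := V)) ≤ S.comap φ :=
    iSup_le fun n a ha => h n a (mem_intPart_of_mem ha)
  exact hle ha

theorem left_mem [CharZero k] (a : V) {x : M} (hx : x ∈ zhuO k V M) :
    leftStar k M a x ∈ zhuO k V M :=
  linear_mem ((leftStar k M).flip x) (fun _ _ ha => left_mem_hom ha hx) a

theorem right_mem [CharZero k] (a : V) {x : M} (hx : x ∈ zhuO k V M) :
    rightStar k M a x ∈ zhuO k V M :=
  linear_mem ((rightStar k M).flip x) (fun _ _ ha => right_mem_hom ha hx) a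

theorem left_zhuO [CharZero k] {a : V} (ha : a ∈ zhuO k V V) (u : M) :
    leftStar k M a u ∈ zhuO k V M := by
  induction ha using Submodule.span_induction with
  | mem x hx =>
    obtain ⟨n, a, ha, b, rfl⟩ := hx
    exact linear_mem ((leftStar k M).flip u ∘ₗ res k V (kern n (-2)) a)
      (fun _ _ hb => left_zhuO_hom (mem_intPart_of_mem ha) hb u) b
  | zero => simp
  | add x y _ _ hx hy => rw [map_add]; exact Submodule.add_mem _ hx hy
  | smul c x _ hx => rw [map_smul]; exact Submodule.smul_mem _ _ hx

theorem right_zhuO [CharZero k] {a : V} (ha : a ∈ zhuO k V V) (u : M) :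
    rightStar k M a u ∈ zhuO k V M := by
  induction ha using Submodule.span_induction with
  | mem x hx =>
    obtain ⟨n, a, ha, b, rfl⟩ := hx
    exact linear_mem ((rightStar k M).flip u ∘ₗ res k V (kern n (-2)) a)
      (fun _ _ hb => right_zhuO_hom (mem_intPart_of_mem ha) hb u) b
  | zero => simp
  | add x y _ _ hx hy => rw [map_add]; exact Submodule.add_mem _ hx hy
  | smul c x _ hx => rw [map_smul]; exact Submodule.smul_mem _ _ hx

theorem bilin_mem {φ : V →ₗ[k] V →ₗ[k] M}
    (h : ∀ (a b : V) (p r : ℤ), Hom k a p → Hom k b r → φ a b ∈ zhuO k V M) (a b : V) :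
    φ a b ∈ zhuO k V M :=
  linear_mem (φ.flip b) (fun _ a ha => linear_mem (φ a) (fun _ b hb => h a b _ _ ha hb) b) a

theorem left_assoc [CharZero k] (a b : V) (u : M) :
    leftStar k M (leftStar k V a b) u - leftStar k M a (leftStar k M b u) ∈ zhuO k V M := by
  refine bilin_mem (k := k) (φ := LinearMap.mk₂ k (fun a b =>
    leftStar k M (leftStar k V a b) u - leftStar k M a (leftStar k M b u)) ?_ ?_ ?_ ?_)
    (fun a b p r ha hb => left_assoc_hom ha hb u) a b
  all_goals intros
  all_goals simp only [map_add, map_smul, LinearMap.add_apply, LinearMap.smul_apply]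
  all_goals module

theorem right_assoc [CharZero k] (a b : V) (u : M) :
    rightStar k M (leftStar k V a b) u - rightStar k M b (rightStar k M a u) ∈ zhuO k V M := by
  refine bilin_mem (k := k) (φ := LinearMap.mk₂ k (fun a b =>
    rightStar k M (leftStar k V a b) u - rightStar k M b (rightStar k M a u)) ?_ ?_ ?_ ?_)
    (fun a b p r ha hb => right_assoc_hom ha hb u) a b
  all_goals intros
  all_goals simp only [map_add, map_smul, LinearMap.add_apply, LinearMap.smul_apply]
  all_goals module

theorem left_right [CharZero k] (a b : V) (u : M) :
    leftStar k M a (rightStar k M b u) - rightStar k M b (leftStar k M a u) ∈ zhuO k V M := by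
  refine bilin_mem (k := k) (φ := LinearMap.mk₂ k (fun a b =>
    leftStar k M a (rightStar k M b u) - rightStar k M b (leftStar k M a u)) ?_ ?_ ?_ ?_)
    (fun a b p r ha hb => left_right_hom ha hb u) a b
  all_goals intros
  all_goals simp only [map_add, map_smul, LinearMap.add_apply, LinearMap.smul_apply]
  all_goals module

theorem leftStar_self_vacuum (a : V) : leftStar k V a (vacuum k) = a := by
  have := linear_mem (k := k) ((leftStar k V).flip (vacuum k) - LinearMap.id) (S := ⊥)
    (fun n a ha => by
      rw [Submodule.mem_bot]; exact sub_eq_zero.2 (leftStar_self_vacuum_hom ha)) a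
  exact sub_eq_zero.1 ((Submodule.mem_bot k).1 this)

end Products

/-! ### Zhu's algebra `A(V)` and the bimodule `A(M)` -/

section ZhuAlgebra

open VertexOperatorAlgebra AdmissibleModule

/-- The space `A(M) = M / O(M)`. -/
def ZhuBimodule (k V M : Type*) [Field k] [AddCommGroup V] [Module k V]
    [VertexOperatorAlgebra k V] [AddCommGroup M] [Module k M] [AdmissibleModule k V M] : Type _ :=
  M ⧸ zhuO k V M

/-- Zhu's algebra `A(V) = V / O(V)`. -/
def ZhuAlgebra (k V : Type*) [Field k] [AddCommGroup V] [Module k V]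
    [VertexOperatorAlgebra k V] : Type _ :=
  V ⧸ zhuO k V V

variable (k V M : Type*) [Field k] [AddCommGroup V] [Module k V]
  [VertexOperatorAlgebra k V] [AddCommGroup M] [Module k M] [AdmissibleModule k V M]

instance : AddCommGroup (ZhuBimodule k V M) := inferInstanceAs (AddCommGroup (M ⧸ zhuO k V M))
instance : Module k (ZhuBimodule k V M) := inferInstanceAs (Module k (M ⧸ zhuO k V M))
instance : AddCommGroup (ZhuAlgebra k V) := inferInstanceAs (AddCommGroup (V ⧸ zhuO k V V))
instance zhuAlgebraModule : Module k (ZhuAlgebra k V) := inferInstanceAs (Module k (V ⧸ zhuO k V V))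

/-- The projection `M → A(M)`. -/
def ZhuBimodule.mk : M →ₗ[k] ZhuBimodule k V M := (zhuO k V M).mkQ

/-- The projection `V → A(V)`. -/
def ZhuAlgebra.mk : V →ₗ[k] ZhuAlgebra k V := (zhuO k V V).mkQ

variable {k V M}

theorem ZhuBimodule.mk_surjective : Function.Surjective (ZhuBimodule.mk k V M) :=
  Submodule.mkQ_surjective _

theorem ZhuAlgebra.mk_surjective : Function.Surjective (ZhuAlgebra.mk k V) :=
  Submodule.mkQ_surjective _

theorem ZhuBimodule.mk_eq_mk {x y : M} :
    ZhuBimodule.mk k V M x = ZhuBimodule.mk k V M y ↔ x - y ∈ zhuO k V M :=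
  Submodule.Quotient.eq _

theorem ZhuAlgebra.mk_eq_mk {x y : V} :
    ZhuAlgebra.mk k V x = ZhuAlgebra.mk k V y ↔ x - y ∈ zhuO k V V :=
  Submodule.Quotient.eq _

variable [CharZero k]

variable (k V M) in
/-- The left action of `A(V)` on `A(M)` induced by `a * u`. -/
def leftAct : ZhuAlgebra k V →ₗ[k] ZhuBimodule k V M →ₗ[k] ZhuBimodule k V M :=
  (zhuO k V V).liftQ
    { toFun := fun a => (zhuO k V M).mapQ (zhuO k V M) (leftStar k M a) fun _ => left_mem a
      map_add' := fun a b => Submodule.linearMap_qext _ (LinearMap.ext fun u =>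
        congrArg (zhuO k V M).mkQ (LinearMap.congr_fun (map_add (leftStar k M) a b) u))
      map_smul' := fun c a => Submodule.linearMap_qext _ (LinearMap.ext fun u =>
        congrArg (zhuO k V M).mkQ (LinearMap.congr_fun (map_smul (leftStar k M) c a) u)) }
    (fun a ha => Submodule.linearMap_qext _ (LinearMap.ext fun u =>
      (Submodule.Quotient.mk_eq_zero _).2 (left_zhuO ha u)))

variable (k V M) in
/-- The right action of `A(V)` on `A(M)` induced by `u * a`. -/
def rightAct : ZhuAlgebra k V →ₗ[k] ZhuBimodule k V M →ₗ[k] ZhuBimodule k V M :=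
  (zhuO k V V).liftQ
    { toFun := fun a => (zhuO k V M).mapQ (zhuO k V M) (rightStar k M a) fun _ => right_mem a
      map_add' := fun a b => Submodule.linearMap_qext _ (LinearMap.ext fun u =>
        congrArg (zhuO k V M).mkQ (LinearMap.congr_fun (map_add (rightStar k M) a b) u))
      map_smul' := fun c a => Submodule.linearMap_qext _ (LinearMap.ext fun u =>
        congrArg (zhuO k V M).mkQ (LinearMap.congr_fun (map_smul (rightStar k M) c a) u)) }
    (fun a ha => Submodule.linearMap_qext _ (LinearMap.ext fun u =>
      (Submodule.Quotient.mk_eq_zero _).2 (right_zhuO ha u)))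

theorem leftAct_mk (a : V) (u : M) : leftAct k V M (ZhuAlgebra.mk k V a) (ZhuBimodule.mk k V M u) =
    ZhuBimodule.mk k V M (leftStar k M a u) := rfl

theorem rightAct_mk (a : V) (u : M) :
    rightAct k V M (ZhuAlgebra.mk k V a) (ZhuBimodule.mk k V M u) =
    ZhuBimodule.mk k V M (rightStar k M a u) := rfl

instance : Ring (ZhuAlgebra k V) :=
  { (inferInstance : AddCommGroup (ZhuAlgebra k V)) with
    mul := fun x y => leftAct k V V x y
    one := ZhuAlgebra.mk k V (vacuum k)
    left_distrib := fun x y z => map_add (leftAct k V V x) y z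
    right_distrib := fun x y z => LinearMap.congr_fun (map_add (leftAct k V V) x y) z
    zero_mul := fun x => LinearMap.congr_fun (map_zero (leftAct k V V)) x
    mul_zero := fun x => map_zero (leftAct k V V x)
    mul_assoc := fun x y z => by
      obtain ⟨a, rfl⟩ := ZhuAlgebra.mk_surjective x
      obtain ⟨b, rfl⟩ := ZhuAlgebra.mk_surjective y
      obtain ⟨c, rfl⟩ := ZhuAlgebra.mk_surjective z
      exact ZhuAlgebra.mk_eq_mk.2 (left_assoc a b c)
    one_mul := fun x => by
      obtain ⟨a, rfl⟩ := ZhuAlgebra.mk_surjective x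
      exact congrArg (ZhuAlgebra.mk k V) (leftStar_vacuum a)
    mul_one := fun x => by
      obtain ⟨a, rfl⟩ := ZhuAlgebra.mk_surjective x
      exact congrArg (ZhuAlgebra.mk k V) (leftStar_self_vacuum a) }

theorem ZhuAlgebra.mk_mul_mk (a b : V) :
    ZhuAlgebra.mk k V a * ZhuAlgebra.mk k V b = ZhuAlgebra.mk k V (leftStar k V a b) := rfl

theorem ZhuAlgebra.one_def : (1 : ZhuAlgebra k V) = ZhuAlgebra.mk k V (vacuum k) := rfl

instance : Algebra k (ZhuAlgebra k V) :=
  Algebra.ofModule (fun c x y => LinearMap.congr_fun (map_smul (leftAct k V V) c x) y)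
    (fun c x y => map_smul (leftAct k V V x) c y)

instance : Module (ZhuAlgebra k V) (ZhuBimodule k V M) where
  smul x u := leftAct k V M x u
  smul_zero x := map_zero (leftAct k V M x)
  smul_add x := map_add (leftAct k V M x)
  add_smul x y u := LinearMap.congr_fun (map_add (leftAct k V M) x y) u
  zero_smul u := LinearMap.congr_fun (map_zero (leftAct k V M)) u
  one_smul u := by
    obtain ⟨u, rfl⟩ := ZhuBimodule.mk_surjective u
    exact congrArg (ZhuBimodule.mk k V M) (leftStar_vacuum u)
  mul_smul x y u := by
    obtain ⟨a, rfl⟩ := ZhuAlgebra.mk_surjective x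
    obtain ⟨b, rfl⟩ := ZhuAlgebra.mk_surjective y
    obtain ⟨u, rfl⟩ := ZhuBimodule.mk_surjective u
    exact ZhuBimodule.mk_eq_mk.2 (left_assoc a b u)

instance : Module (ZhuAlgebra k V)ᵐᵒᵖ (ZhuBimodule k V M) where
  smul x u := rightAct k V M x.unop u
  smul_zero x := map_zero (rightAct k V M x.unop)
  smul_add x := map_add (rightAct k V M x.unop)
  add_smul x y u := LinearMap.congr_fun (map_add (rightAct k V M) x.unop y.unop) u
  zero_smul u := LinearMap.congr_fun (map_zero (rightAct k V M)) u
  one_smul u := by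
    obtain ⟨u, rfl⟩ := ZhuBimodule.mk_surjective u
    exact congrArg (ZhuBimodule.mk k V M) (rightStar_vacuum u)
  mul_smul x y u := by
    obtain ⟨x⟩ := x
    obtain ⟨y⟩ := y
    obtain ⟨a, rfl⟩ := ZhuAlgebra.mk_surjective x
    obtain ⟨b, rfl⟩ := ZhuAlgebra.mk_surjective y
    obtain ⟨u, rfl⟩ := ZhuBimodule.mk_surjective u
    exact ZhuBimodule.mk_eq_mk.2 (right_assoc b a u)

theorem ZhuBimodule.mk_smul_mk (a : V) (u : M) :
    ZhuAlgebra.mk k V a • ZhuBimodule.mk k V M u = ZhuBimodule.mk k V M (leftStar k M a u) := rfl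

theorem ZhuBimodule.op_mk_smul_mk (a : V) (u : M) :
    MulOpposite.op (ZhuAlgebra.mk k V a) • ZhuBimodule.mk k V M u =
      ZhuBimodule.mk k V M (rightStar k M a u) := rfl

instance : SMulCommClass (ZhuAlgebra k V) (ZhuAlgebra k V)ᵐᵒᵖ (ZhuBimodule k V M) where
  smul_comm x y u := by
    obtain ⟨y⟩ := y
    obtain ⟨a, rfl⟩ := ZhuAlgebra.mk_surjective x
    obtain ⟨b, rfl⟩ := ZhuAlgebra.mk_surjective y
    obtain ⟨u, rfl⟩ := ZhuBimodule.mk_surjective u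
    exact ZhuBimodule.mk_eq_mk.2 (left_right a b u)

instance : IsScalarTower k (ZhuAlgebra k V) (ZhuBimodule k V M) where
  smul_assoc c x u := LinearMap.congr_fun (map_smul (leftAct k V M) c x) u

instance : IsScalarTower k (ZhuAlgebra k V)ᵐᵒᵖ (ZhuBimodule k V M) where
  smul_assoc c x u := LinearMap.congr_fun (map_smul (rightAct k V M) c x.unop) u

end ZhuAlgebra

/-! ### Filtered algebras and modules, and their associated graded objects -/

section Filtered

variable {k A B C : Type*} [CommRing k] [AddCommGroup A] [Module k A] [AddCommGroup B] [Module k B]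
  [AddCommGroup C] [Module k C]

/-- The step `F_{n-1}` of a filtration, with `F_{-1} = 0`. -/
def below (F : ℕ → Submodule k A) : ℕ → Submodule k A
  | 0 => ⊥
  | n + 1 => F n

/-- The quotient `F_n / F_{n-1}` (for an increasing filtration `F`). -/
abbrev GrPiece (F : ℕ → Submodule k A) (n : ℕ) : Type _ := F n ⧸ (below F n).submoduleOf (F n)

/-- The associated graded space `gr A = ⨁ F_n / F_{n-1}`. -/
def Gr (F : ℕ → Submodule k A) : Type _ := ⨁ n, GrPiece F n

instance (F : ℕ → Submodule k A) : AddCommGroup (Gr F) :=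
  inferInstanceAs (AddCommGroup (⨁ n, GrPiece F n))

instance (F : ℕ → Submodule k A) : Module k (Gr F) :=
  inferInstanceAs (Module k (⨁ n, GrPiece F n))

/-- The inclusion of the component of degree `n`. -/
def Gr.incl (F : ℕ → Submodule k A) (n : ℕ) : GrPiece F n →ₗ[k] Gr F :=
  DirectSum.lof k ℕ (GrPiece F) n

/-- The linear map on `gr A` with the given restrictions to the components. -/
def Gr.lift (F : ℕ → Submodule k A) (φ : ∀ n, GrPiece F n →ₗ[k] B) : Gr F →ₗ[k] B :=
  DirectSum.toModule k ℕ B φ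

theorem Gr.lift_incl (F : ℕ → Submodule k A) (φ : ∀ n, GrPiece F n →ₗ[k] B) (n : ℕ)
    (x : GrPiece F n) : Gr.lift F φ (Gr.incl F n x) = φ n x :=
  DirectSum.toModule_lof k n x

/-- The class in `F_n / F_{n-1} ⊆ gr A` of an element of `F_n`. -/
def Gr.symbol (F : ℕ → Submodule k A) (n : ℕ) : F n →ₗ[k] Gr F :=
  Gr.incl F n ∘ₗ Submodule.mkQ _

/-- The component `F_n / F_{n-1}` of degree `n` of `gr A`. -/
def Gr.part (F : ℕ → Submodule k A) (n : ℕ) : Submodule k (Gr F) :=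
  LinearMap.range (Gr.symbol F n)

theorem Gr.symbol_congr (F : ℕ → Submodule k A) {m n : ℕ} (h : m = n) (x : F m) (y : F n)
    (hxy : (x : A) = y) : Gr.symbol F m x = Gr.symbol F n y := by
  subst h
  rw [Subtype.ext hxy]

theorem Gr.induction_on {F : ℕ → Submodule k A} {P : Gr F → Prop} (x : Gr F) (h0 : P 0)
    (hadd : ∀ x y, P x → P y → P (x + y)) (hs : ∀ n x, P (Gr.symbol F n x)) : P x := by
  refine DirectSum.induction_on x h0 (fun i y => ?_) hadd
  obtain ⟨y, rfl⟩ := Submodule.mkQ_surjective _ y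
  exact hs i y

theorem mem_below (F : ℕ → Submodule k A) (G : ℕ → Submodule k B) (H : ℕ → Submodule k C)
    (μ : A →ₗ[k] B →ₗ[k] C) (hμ : ∀ i j, ∀ a ∈ F i, ∀ b ∈ G j, μ a b ∈ H (i + j)) (i j : ℕ) :
    (∀ a ∈ below F i, ∀ b ∈ G j, μ a b ∈ below H (i + j)) ∧
    (∀ a ∈ F i, ∀ b ∈ below G j, μ a b ∈ below H (i + j)) := by
  constructor
  · intro a ha b hb
    cases i with
    | zero => rw [(Submodule.mem_bot k).1 ha, map_zero]; exact Submodule.zero_mem _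
    | succ i => rw [Nat.succ_add]; exact hμ i j a ha b hb
  · intro a ha b hb
    cases j with
    | zero => rw [(Submodule.mem_bot k).1 hb, map_zero]; exact Submodule.zero_mem _
    | succ j => exact hμ i j a ha b hb

/-- The pairing `(F_i / F_{i-1}) × (G_j / G_{j-1}) → gr` induced by a bilinear map `μ` with
`μ (F_i, G_j) ⊆ H_{i+j}`. -/
def Gr.piece₂ (F : ℕ → Submodule k A) (G : ℕ → Submodule k B) (H : ℕ → Submodule k C)
    (μ : A →ₗ[k] B →ₗ[k] C) (hμ : ∀ i j, ∀ a ∈ F i, ∀ b ∈ G j, μ a b ∈ H (i + j)) (i j : ℕ) :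
    GrPiece F i →ₗ[k] GrPiece G j →ₗ[k] GrPiece H (i + j) :=
  Submodule.liftQ _
    (LinearMap.mk₂ k (fun (a : F i) (b : GrPiece G j) =>
      Submodule.liftQ ((below G j).submoduleOf (G j))
        (Submodule.mkQ ((below H (i + j)).submoduleOf (H (i + j))) ∘ₗ
          ((μ a ∘ₗ (G j).subtype).codRestrict (H (i + j)) fun b => hμ i j a a.2 b b.2))
        (fun b hb => (Submodule.Quotient.mk_eq_zero _).2
          ((mem_below F G H μ hμ i j).2 a a.2 b hb)) b)
      (fun a a' b => by
        obtain ⟨b, rfl⟩ := Submodule.mkQ_surjective _ b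
        refine congrArg (Submodule.mkQ _) (Subtype.ext ?_)
        exact LinearMap.congr_fun (map_add μ (a : A) a') (b : B))
      (fun c a b => by
        obtain ⟨b, rfl⟩ := Submodule.mkQ_surjective _ b
        refine congrArg (Submodule.mkQ _) (Subtype.ext ?_)
        exact LinearMap.congr_fun (map_smul μ c (a : A)) (b : B))
      (fun a b b' => map_add _ _ _)
      (fun c a b => map_smul _ _ _))
    (fun a ha => LinearMap.ext fun b => by
      obtain ⟨b, rfl⟩ := Submodule.mkQ_surjective _ b
      exact (Submodule.Quotient.mk_eq_zero _).2 ((mem_below F G H μ hμ i j).1 a ha b b.2))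

/-- The bilinear map `gr A × gr B → gr C`, `(ā, b̄) ↦ class of μ (a, b)`, induced by a bilinear map
`μ` with `μ (F_i, G_j) ⊆ H_{i+j}`. -/
def Gr.map₂ (F : ℕ → Submodule k A) (G : ℕ → Submodule k B) (H : ℕ → Submodule k C)
    (μ : A →ₗ[k] B →ₗ[k] C) (hμ : ∀ i j, ∀ a ∈ F i, ∀ b ∈ G j, μ a b ∈ H (i + j)) :
    Gr F →ₗ[k] Gr G →ₗ[k] Gr H :=
  Gr.lift F fun i => LinearMap.flip <| Gr.lift G fun j =>
    LinearMap.flip <| (Gr.piece₂ F G H μ hμ i j).compr₂ (Gr.incl H (i + j))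

theorem Gr.map₂_symbol (F : ℕ → Submodule k A) (G : ℕ → Submodule k B) (H : ℕ → Submodule k C)
    (μ : A →ₗ[k] B →ₗ[k] C) (hμ : ∀ i j, ∀ a ∈ F i, ∀ b ∈ G j, μ a b ∈ H (i + j)) (i j : ℕ)
    (a : F i) (b : G j) : Gr.map₂ F G H μ hμ (Gr.symbol F i a) (Gr.symbol G j b) =
      Gr.symbol H (i + j) ⟨μ a b, hμ i j a a.2 b b.2⟩ := by
  rw [Gr.map₂, Gr.symbol, Gr.symbol, LinearMap.comp_apply, LinearMap.comp_apply, Gr.lift_incl,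
    LinearMap.flip_apply, Gr.lift_incl]
  rfl

variable {R T : Type*} [Ring R] [Algebra k R] [AddCommGroup T] [Module k T]

/-- `F` is a filtration of the algebra `R`. -/
class IsFilteredAlgebra (F : ℕ → Submodule k R) : Prop where
  mono : Monotone F
  exhaustive : ∀ x, ∃ n, x ∈ F n
  one_mem : 1 ∈ F 0
  mul_mem : ∀ i j, ∀ a ∈ F i, ∀ b ∈ F j, a * b ∈ F (i + j)

/-- `G` is a filtration of the left `R`-module `T`, compatible with the filtration `F` of `R`. -/
class IsFilteredModule (F : ℕ → Submodule k R) (G : ℕ → Submodule k T) [Module R T] : Prop where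
  mono : Monotone G
  exhaustive : ∀ x, ∃ n, x ∈ G n
  smul_mem : ∀ i j, ∀ a ∈ F i, ∀ t ∈ G j, a • t ∈ G (i + j)

/-- `G` is a filtration of the right `R`-module `T`, compatible with the filtration `F` of `R`. -/
class IsFilteredRightModule (F : ℕ → Submodule k R) (G : ℕ → Submodule k T) [Module Rᵐᵒᵖ T] :
    Prop where
  mono : Monotone G
  exhaustive : ∀ x, ∃ n, x ∈ G n
  smul_mem : ∀ i j, ∀ a ∈ F i, ∀ t ∈ G j, MulOpposite.op a • t ∈ G (i + j)

section Ring

variable (F : ℕ → Submodule k R) [IsFilteredAlgebra F]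

/-- The multiplication of `gr R`, given by `ā b̄ = class of a b`. -/
def Gr.mul : Gr F →ₗ[k] Gr F →ₗ[k] Gr F :=
  Gr.map₂ F F F (LinearMap.mul k R) fun i j a ha b hb => IsFilteredAlgebra.mul_mem i j a ha b hb

theorem Gr.mul_symbol (i j : ℕ) (a : F i) (b : F j) :
    Gr.mul F (Gr.symbol F i a) (Gr.symbol F j b) =
      Gr.symbol F (i + j) ⟨(a : R) * (b : R),
        IsFilteredAlgebra.mul_mem (F := F) i j a a.2 b b.2⟩ :=
  Gr.map₂_symbol _ _ _ _ _ _ _ _ _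

/-- The associated graded ring of a filtered algebra. -/
instance : Ring (Gr F) :=
  { (inferInstance : AddCommGroup (Gr F)) with
    mul := fun x y => Gr.mul F x y
    one := Gr.symbol F 0 ⟨1, IsFilteredAlgebra.one_mem⟩
    left_distrib := fun x y z => map_add (Gr.mul F x) y z
    right_distrib := fun x y z => LinearMap.congr_fun (map_add (Gr.mul F) x y) z
    zero_mul := fun x => LinearMap.congr_fun (map_zero (Gr.mul F)) x
    mul_zero := fun x => map_zero (Gr.mul F x)
    mul_assoc := fun x y z => by
      change Gr.mul F (Gr.mul F x y) z = Gr.mul F x (Gr.mul F y z)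
      induction x using Gr.induction_on with
      | h0 => simp
      | hadd x x' h h' => simp only [map_add, LinearMap.add_apply, h, h']
      | hs i a =>
      induction y using Gr.induction_on with
      | h0 => simp
      | hadd x x' h h' => simp only [map_add, LinearMap.add_apply, h, h']
      | hs j b =>
      induction z using Gr.induction_on with
      | h0 => simp
      | hadd x x' h h' => simp only [map_add, LinearMap.add_apply, h, h']
      | hs l c =>
      rw [Gr.mul_symbol, Gr.mul_symbol, Gr.mul_symbol, Gr.mul_symbol]
      exact Gr.symbol_congr F (add_assoc i j l) _ _ (mul_assoc _ _ _)
    one_mul := fun x => by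
      change Gr.mul F (Gr.symbol F 0 ⟨1, IsFilteredAlgebra.one_mem⟩) x = x
      induction x using Gr.induction_on with
      | h0 => simp
      | hadd x x' h h' => simp only [map_add, LinearMap.add_apply, h, h']
      | hs i a =>
      rw [Gr.mul_symbol]
      exact Gr.symbol_congr F (zero_add i) _ _ (one_mul _)
    mul_one := fun x => by
      change Gr.mul F x (Gr.symbol F 0 ⟨1, IsFilteredAlgebra.one_mem⟩) = x
      induction x using Gr.induction_on with
      | h0 => simp
      | hadd x x' h h' => simp only [map_add, LinearMap.add_apply, h, h']
      | hs i a =>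
      rw [Gr.mul_symbol]
      exact Gr.symbol_congr F (add_zero i) _ _ (mul_one _) }

theorem Gr.symbol_mul_symbol (i j : ℕ) (a : F i) (b : F j) :
    Gr.symbol F i a * Gr.symbol F j b =
      Gr.symbol F (i + j) ⟨(a : R) * (b : R),
        IsFilteredAlgebra.mul_mem (F := F) i j a a.2 b b.2⟩ :=
  Gr.mul_symbol F i j a b

theorem Gr.one_def : (1 : Gr F) = Gr.symbol F 0 ⟨1, IsFilteredAlgebra.one_mem⟩ := rfl

end Ring

section LeftModule

variable (F : ℕ → Submodule k R) (G : ℕ → Submodule k T) [Module R T] [IsScalarTower k R T]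
  [IsFilteredModule F G]

/-- The left action of `gr R` on `gr T`, given by `ā t̄ = class of a t`. -/
def Gr.lact : Gr F →ₗ[k] Gr G →ₗ[k] Gr G :=
  Gr.map₂ F G G (LinearMap.mk₂ k (fun (a : R) (t : T) => a • t) add_smul smul_assoc smul_add
    (fun c a t => smul_comm a c t))
    fun i j a ha t ht => IsFilteredModule.smul_mem (F := F) i j a ha t ht

theorem Gr.lact_symbol (i j : ℕ) (a : F i) (t : G j) :
    Gr.lact F G (Gr.symbol F i a) (Gr.symbol G j t) =
      Gr.symbol G (i + j) ⟨(a : R) • (t : T),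
        IsFilteredModule.smul_mem (F := F) (G := G) i j a a.2 t t.2⟩ :=
  Gr.map₂_symbol _ _ _ _ _ _ _ _ _

/-- The associated graded module of a filtered left module. -/
instance Gr.instModule [IsFilteredAlgebra F] : Module (Gr F) (Gr G) where
  smul x t := Gr.lact F G x t
  smul_zero x := map_zero (Gr.lact F G x)
  smul_add x := map_add (Gr.lact F G x)
  add_smul x y t := LinearMap.congr_fun (map_add (Gr.lact F G) x y) t
  zero_smul t := LinearMap.congr_fun (map_zero (Gr.lact F G)) t
  one_smul t := by
    change Gr.lact F G (Gr.symbol F 0 ⟨1, IsFilteredAlgebra.one_mem⟩) t = t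
    induction t using Gr.induction_on with
    | h0 => simp
    | hadd x x' h h' => simp only [map_add, LinearMap.add_apply, h, h']
    | hs i a =>
    rw [Gr.lact_symbol]
    exact Gr.symbol_congr G (zero_add i) _ _ (one_smul _ _)
  mul_smul x y t := by
    change Gr.lact F G (Gr.mul F x y) t = Gr.lact F G x (Gr.lact F G y t)
    induction x using Gr.induction_on with
    | h0 => simp
    | hadd x x' h h' => simp only [map_add, LinearMap.add_apply, h, h']
    | hs i a =>
    induction y using Gr.induction_on with
    | h0 => simp
    | hadd x x' h h' => simp only [map_add, LinearMap.add_apply, h, h']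
    | hs j b =>
    induction t using Gr.induction_on with
    | h0 => simp
    | hadd x x' h h' => simp only [map_add, LinearMap.add_apply, h, h']
    | hs l c =>
    rw [Gr.mul_symbol, Gr.lact_symbol, Gr.lact_symbol, Gr.lact_symbol]
    exact Gr.symbol_congr G (add_assoc i j l) _ _ (mul_smul _ _ _)

theorem Gr.symbol_smul_symbol [IsFilteredAlgebra F] (i j : ℕ) (a : F i) (t : G j) :
    Gr.symbol F i a • Gr.symbol G j t =
      Gr.symbol G (i + j) ⟨(a : R) • (t : T),
        IsFilteredModule.smul_mem (F := F) (G := G) i j a a.2 t t.2⟩ :=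
  Gr.lact_symbol F G i j a t

end LeftModule

section RightModule

variable (F : ℕ → Submodule k R) (G : ℕ → Submodule k T) [Module Rᵐᵒᵖ T] [IsScalarTower k Rᵐᵒᵖ T]
  [IsFilteredRightModule F G]

/-- The right action of `gr R` on `gr T`, given by `t̄ ā = class of t a`. -/
def Gr.ract : Gr F →ₗ[k] Gr G →ₗ[k] Gr G :=
  Gr.map₂ F G G (LinearMap.mk₂ k (fun (a : R) (t : T) => MulOpposite.op a • t)
    (fun a b t => add_smul (MulOpposite.op a) (MulOpposite.op b) t)
    (fun c a t => smul_assoc c (MulOpposite.op a) t) (fun a t t' => smul_add _ t t')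
    (fun c a t => smul_comm (MulOpposite.op a) c t))
    fun i j a ha t ht => IsFilteredRightModule.smul_mem (F := F) i j a ha t ht

theorem Gr.ract_symbol (i j : ℕ) (a : F i) (t : G j) :
    Gr.ract F G (Gr.symbol F i a) (Gr.symbol G j t) =
      Gr.symbol G (i + j) ⟨MulOpposite.op (a : R) • (t : T),
        IsFilteredRightModule.smul_mem (F := F) (G := G) i j a a.2 t t.2⟩ :=
  Gr.map₂_symbol _ _ _ _ _ _ _ _ _

/-- The associated graded right module of a filtered right module. -/
instance Gr.instModuleOp [IsFilteredAlgebra F] : Module (Gr F)ᵐᵒᵖ (Gr G) where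
  smul x t := Gr.ract F G x.unop t
  smul_zero x := map_zero (Gr.ract F G x.unop)
  smul_add x := map_add (Gr.ract F G x.unop)
  add_smul x y t := LinearMap.congr_fun (map_add (Gr.ract F G) x.unop y.unop) t
  zero_smul t := LinearMap.congr_fun (map_zero (Gr.ract F G)) t
  one_smul t := by
    change Gr.ract F G (Gr.symbol F 0 ⟨1, IsFilteredAlgebra.one_mem⟩) t = t
    induction t using Gr.induction_on with
    | h0 => simp
    | hadd x x' h h' => simp only [map_add, LinearMap.add_apply, h, h']
    | hs i a =>
    rw [Gr.ract_symbol]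
    exact Gr.symbol_congr G (zero_add i) _ _ (one_smul _ _)
  mul_smul x y t := by
    change Gr.ract F G (Gr.mul F y.unop x.unop) t = Gr.ract F G x.unop (Gr.ract F G y.unop t)
    generalize x.unop = x
    generalize y.unop = y
    induction x using Gr.induction_on with
    | h0 => simp
    | hadd x x' h h' => simp only [map_add, LinearMap.add_apply, h, h']
    | hs i a =>
    induction y using Gr.induction_on with
    | h0 => simp
    | hadd x x' h h' => simp only [map_add, LinearMap.add_apply, h, h']
    | hs j b =>
    induction t using Gr.induction_on with
    | h0 => simp
    | hadd x x' h h' => simp only [map_add, LinearMap.add_apply, h, h']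
    | hs l c =>
    rw [Gr.mul_symbol, Gr.ract_symbol, Gr.ract_symbol, Gr.ract_symbol]
    exact Gr.symbol_congr G (by omega) _ _
      (mul_smul (MulOpposite.op (a : R)) (MulOpposite.op (b : R)) (c : T))

theorem Gr.op_symbol_smul_symbol [IsFilteredAlgebra F] (i j : ℕ) (a : F i) (t : G j) :
    MulOpposite.op (Gr.symbol F i a) • Gr.symbol G j t =
      Gr.symbol G (i + j) ⟨MulOpposite.op (a : R) • (t : T),
        IsFilteredRightModule.smul_mem (F := F) (G := G) i j a a.2 t t.2⟩ :=
  Gr.ract_symbol F G i j a t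

/-- The associated graded module of a filtered bimodule is a bimodule. -/
instance [Module R T] [IsScalarTower k R T] [SMulCommClass R Rᵐᵒᵖ T] [IsFilteredAlgebra F]
    [IsFilteredModule F G] : SMulCommClass (Gr F) (Gr F)ᵐᵒᵖ (Gr G) where
  smul_comm x y t := by
    change Gr.lact F G x (Gr.ract F G y.unop t) = Gr.ract F G y.unop (Gr.lact F G x t)
    generalize y.unop = y
    induction x using Gr.induction_on with
    | h0 => simp
    | hadd x x' h h' => simp only [map_add, LinearMap.add_apply, h, h']
    | hs i a =>
    induction y using Gr.induction_on with
    | h0 => simp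
    | hadd x x' h h' => simp only [map_add, LinearMap.add_apply, h, h']
    | hs j b =>
    induction t using Gr.induction_on with
    | h0 => simp
    | hadd x x' h h' => simp only [map_add, LinearMap.add_apply, h, h']
    | hs l c =>
    rw [Gr.lact_symbol, Gr.ract_symbol, Gr.ract_symbol, Gr.lact_symbol]
    exact Gr.symbol_congr G (by omega) _ _
      (smul_comm (a : R) (MulOpposite.op (b : R)) (c : T))

end RightModule

end Filtered

/-! ### Tensor products of bimodules -/

section Bimodules

open MulOpposite

variable (k A X Y : Type*) [CommRing k] [Ring A] [Algebra k A]
  [AddCommGroup X] [Module k X] [Module A X] [Module Aᵐᵒᵖ X]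
  [AddCommGroup Y] [Module k Y] [Module A Y] [Module Aᵐᵒᵖ Y]

/-- The relations `x a ⊗ y = x ⊗ a y`. -/
def balRel : Submodule k (X ⊗[k] Y) :=
  Submodule.span k {t | ∃ (x : X) (a : A) (y : Y), t = (op a • x) ⊗ₜ[k] y - x ⊗ₜ[k] (a • y)}

/-- The tensor product `X ⊗_A Y` of a right `A`-module `X` and a left `A`-module `Y`, for an algebra
`A` over `k` that need not be commutative. -/
def BalTensor : Type _ := (X ⊗[k] Y) ⧸ balRel k A X Y

instance : AddCommGroup (BalTensor k A X Y) :=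
  inferInstanceAs (AddCommGroup ((X ⊗[k] Y) ⧸ balRel k A X Y))

instance BalTensor.instModuleBase : Module k (BalTensor k A X Y) :=
  inferInstanceAs (Module k ((X ⊗[k] Y) ⧸ balRel k A X Y))

/-- The bilinear map `(x, y) ↦ x ⊗ y`. -/
def BalTensor.mk : X →ₗ[k] Y →ₗ[k] BalTensor k A X Y :=
  (TensorProduct.mk k X Y).compr₂ (balRel k A X Y).mkQ

variable {k A X Y}

theorem BalTensor.induction_on {P : BalTensor k A X Y → Prop} (t : BalTensor k A X Y)
    (h0 : P 0) (hadd : ∀ s t, P s → P t → P (s + t)) (hmk : ∀ x y, P (BalTensor.mk k A X Y x y)) :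
    P t := by
  obtain ⟨t, rfl⟩ := Submodule.mkQ_surjective _ t
  induction t using TensorProduct.induction_on with
  | zero => exact h0
  | tmul x y => exact hmk x y
  | add s t hs ht => exact hadd _ _ hs ht

theorem BalTensor.balanced (x : X) (a : A) (y : Y) :
    BalTensor.mk k A X Y (op a • x) y = BalTensor.mk k A X Y x (a • y) :=
  (Submodule.Quotient.eq _).2 (Submodule.subset_span ⟨x, a, y, rfl⟩)

/-- The endomorphism of `X ⊗_A Y` induced by endomorphisms `f` of `X` and `g` of `Y`. -/
def BalTensor.map (f : X →ₗ[k] X) (g : Y →ₗ[k] Y) (hf : ∀ (a : A) x, f (op a • x) = op a • f x)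
    (hg : ∀ (a : A) y, g (a • y) = a • g y) : BalTensor k A X Y →ₗ[k] BalTensor k A X Y :=
  (balRel k A X Y).mapQ (balRel k A X Y) (TensorProduct.map f g) <| by
    refine Submodule.span_le.2 ?_
    rintro _ ⟨x, a, y, rfl⟩
    refine Submodule.subset_span ⟨f x, a, g y, ?_⟩
    rw [map_sub, TensorProduct.map_tmul, TensorProduct.map_tmul, hf, hg]

theorem BalTensor.map_mk (f : X →ₗ[k] X) (g : Y →ₗ[k] Y)
    (hf : ∀ (a : A) x, f (op a • x) = op a • f x) (hg : ∀ (a : A) y, g (a • y) = a • g y)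
    (x : X) (y : Y) : BalTensor.map f g hf hg (BalTensor.mk k A X Y x y) =
      BalTensor.mk k A X Y (f x) (g y) := rfl

variable [IsScalarTower k A X] [IsScalarTower k Aᵐᵒᵖ Y] [SMulCommClass A Aᵐᵒᵖ X]
  [SMulCommClass A Aᵐᵒᵖ Y]

/-- The operator `x ⊗ y ↦ a x ⊗ y`. -/
def BalTensor.lmul (a : A) : BalTensor k A X Y →ₗ[k] BalTensor k A X Y :=
  BalTensor.map (Algebra.lsmul k k X a) LinearMap.id (fun b x => smul_comm a (op b) x)
    (fun _ _ => rfl)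

/-- The operator `x ⊗ y ↦ x ⊗ y a`. -/
def BalTensor.rmul (a : Aᵐᵒᵖ) : BalTensor k A X Y →ₗ[k] BalTensor k A X Y :=
  BalTensor.map LinearMap.id (Algebra.lsmul k k Y a) (fun _ _ => rfl)
    (fun b y => (smul_comm b a y).symm)

theorem BalTensor.lmul_mk (a : A) (x : X) (y : Y) :
    BalTensor.lmul a (BalTensor.mk k A X Y x y) = BalTensor.mk k A X Y (a • x) y := rfl

theorem BalTensor.rmul_mk (a : Aᵐᵒᵖ) (x : X) (y : Y) :
    BalTensor.rmul a (BalTensor.mk k A X Y x y) = BalTensor.mk k A X Y x (a • y) := rfl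

/-- The left action `a (x ⊗ y) = a x ⊗ y`. -/
instance BalTensor.instModule : Module A (BalTensor k A X Y) where
  smul a t := BalTensor.lmul a t
  smul_zero a := map_zero (BalTensor.lmul a)
  smul_add a := map_add (BalTensor.lmul a)
  one_smul t := by
    change BalTensor.lmul 1 t = t
    induction t using BalTensor.induction_on with
    | h0 => exact map_zero _
    | hadd s t hs ht => rw [map_add, hs, ht]
    | hmk x y => rw [BalTensor.lmul_mk, one_smul]
  mul_smul a b t := by
    change BalTensor.lmul (a * b) t = BalTensor.lmul a (BalTensor.lmul b t)
    induction t using BalTensor.induction_on with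
    | h0 => simp only [map_zero]
    | hadd s t hs ht => simp only [map_add, hs, ht]
    | hmk x y => simp only [BalTensor.lmul_mk, mul_smul]
  zero_smul t := by
    change BalTensor.lmul 0 t = 0
    induction t using BalTensor.induction_on with
    | h0 => exact map_zero _
    | hadd s t hs ht => rw [map_add, hs, ht, add_zero]
    | hmk x y => rw [BalTensor.lmul_mk, zero_smul, map_zero]; rfl
  add_smul a b t := by
    change BalTensor.lmul (a + b) t = BalTensor.lmul a t + BalTensor.lmul b t
    induction t using BalTensor.induction_on with
    | h0 => simp only [map_zero, add_zero]
    | hadd s t hs ht => rw [map_add, map_add, map_add, hs, ht]; abel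
    | hmk x y => simp only [BalTensor.lmul_mk, add_smul, map_add]; rfl

/-- The right action `(x ⊗ y) a = x ⊗ y a`. -/
instance BalTensor.instModuleOp : Module Aᵐᵒᵖ (BalTensor k A X Y) where
  smul a t := BalTensor.rmul a t
  smul_zero a := map_zero (BalTensor.rmul a)
  smul_add a := map_add (BalTensor.rmul a)
  one_smul t := by
    change BalTensor.rmul 1 t = t
    induction t using BalTensor.induction_on with
    | h0 => exact map_zero _
    | hadd s t hs ht => rw [map_add, hs, ht]
    | hmk x y => rw [BalTensor.rmul_mk, one_smul]
  mul_smul a b t := by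
    change BalTensor.rmul (a * b) t = BalTensor.rmul a (BalTensor.rmul b t)
    induction t using BalTensor.induction_on with
    | h0 => simp only [map_zero]
    | hadd s t hs ht => simp only [map_add, hs, ht]
    | hmk x y => simp only [BalTensor.rmul_mk, mul_smul]
  zero_smul t := by
    change BalTensor.rmul 0 t = 0
    induction t using BalTensor.induction_on with
    | h0 => exact map_zero _
    | hadd s t hs ht => rw [map_add, hs, ht, add_zero]
    | hmk x y => rw [BalTensor.rmul_mk, zero_smul, map_zero]
  add_smul a b t := by
    change BalTensor.rmul (a + b) t = BalTensor.rmul a t + BalTensor.rmul b t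
    induction t using BalTensor.induction_on with
    | h0 => simp only [map_zero, add_zero]
    | hadd s t hs ht => rw [map_add, map_add, map_add, hs, ht]; abel
    | hmk x y => simp only [BalTensor.rmul_mk, add_smul, map_add]

theorem BalTensor.smul_mk (a : A) (x : X) (y : Y) :
    a • BalTensor.mk k A X Y x y = BalTensor.mk k A X Y (a • x) y := rfl

theorem BalTensor.op_smul_mk (a : Aᵐᵒᵖ) (x : X) (y : Y) :
    a • BalTensor.mk k A X Y x y = BalTensor.mk k A X Y x (a • y) := rfl

instance : SMulCommClass A Aᵐᵒᵖ (BalTensor k A X Y) where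
  smul_comm a b t := by
    induction t using BalTensor.induction_on with
    | h0 => simp only [smul_zero]
    | hadd s t hs ht => simp only [smul_add, hs, ht]
    | hmk x y => rfl

instance : IsScalarTower k A (BalTensor k A X Y) where
  smul_assoc c a t := by
    induction t using BalTensor.induction_on with
    | h0 => simp only [smul_zero]
    | hadd s t hs ht => simp only [smul_add, hs, ht]
    | hmk x y => rw [BalTensor.smul_mk, BalTensor.smul_mk, smul_assoc, map_smul]; rfl

instance : IsScalarTower k Aᵐᵒᵖ (BalTensor k A X Y) where
  smul_assoc c a t := by
    induction t using BalTensor.induction_on with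
    | h0 => simp only [smul_zero]
    | hadd s t hs ht => simp only [smul_add, hs, ht]
    | hmk x y => rw [BalTensor.op_smul_mk, BalTensor.op_smul_mk, smul_assoc, map_smul]

/-- The action `(a ⊗ b) t = a t b` of the enveloping algebra `A ⊗ Aᵒᵖ` on the bimodule `X ⊗_A Y`. -/
instance BalTensor.instModuleEnv : Module (A ⊗[k] Aᵐᵒᵖ) (BalTensor k A X Y) :=
  TensorProduct.Algebra.module

theorem BalTensor.tmul_smul (a : A) (b : Aᵐᵒᵖ) (t : BalTensor k A X Y) :
    (a ⊗ₜ[k] b) • t = a • b • t := rfl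

instance : IsScalarTower k (A ⊗[k] Aᵐᵒᵖ) (BalTensor k A X Y) where
  smul_assoc c z t := LinearMap.congr_fun
    (map_smul (TensorProduct.Algebra.moduleAux (R := k) (A := A) (B := Aᵐᵒᵖ)) c z) t

end Bimodules

section TensorFiltration

open MulOpposite

variable {k A X Y : Type*} [CommRing k] [Ring A] [Algebra k A]
  [AddCommGroup X] [Module k X] [Module A X] [Module Aᵐᵒᵖ X]
  [AddCommGroup Y] [Module k Y] [Module A Y] [Module Aᵐᵒᵖ Y]

variable (A) in
/-- The filtration of `X ⊗_A Y` by the spans of all `x ⊗ y` with `x ∈ F_r`, `y ∈ G_s`,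
`r + s ≤ n`. -/
def tensorFil (F : ℕ → Submodule k X) (G : ℕ → Submodule k Y) (n : ℕ) :
    Submodule k (BalTensor k A X Y) :=
  Submodule.span k {t | ∃ r s : ℕ, r + s ≤ n ∧ ∃ x ∈ F r, ∃ y ∈ G s, t = BalTensor.mk k A X Y x y}

theorem mk_mem_tensorFil {F : ℕ → Submodule k X} {G : ℕ → Submodule k Y} {n r s : ℕ}
    (h : r + s ≤ n) {x : X} (hx : x ∈ F r) {y : Y} (hy : y ∈ G s) :
    BalTensor.mk k A X Y x y ∈ tensorFil A F G n :=
  Submodule.subset_span ⟨r, s, h, x, hx, y, hy, rfl⟩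

/-- The filtration of the enveloping algebra `A ⊗ Aᵒᵖ` by the spans of all `a ⊗ b` with `a ∈ F_i`,
`b ∈ F_j`, `i + j ≤ n`. -/
def envFil (F : ℕ → Submodule k A) (n : ℕ) : Submodule k (A ⊗[k] Aᵐᵒᵖ) :=
  Submodule.span k {t | ∃ i j : ℕ, i + j ≤ n ∧ ∃ a ∈ F i, ∃ b ∈ F j, t = a ⊗ₜ[k] op b}

theorem tensorFil_mono (F : ℕ → Submodule k X) (G : ℕ → Submodule k Y) :
    Monotone (tensorFil A F G) := fun m n hmn => Submodule.span_mono <| by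
  rintro _ ⟨r, s, h, x, hx, y, hy, rfl⟩
  exact ⟨r, s, h.trans hmn, x, hx, y, hy, rfl⟩

theorem tensorFil_exhaustive {F : ℕ → Submodule k X} {G : ℕ → Submodule k Y}
    (hF : ∀ x, ∃ n, x ∈ F n) (hG : ∀ y, ∃ n, y ∈ G n) (t : BalTensor k A X Y) :
    ∃ n, t ∈ tensorFil A F G n := by
  induction t using BalTensor.induction_on with
  | h0 => exact ⟨0, Submodule.zero_mem _⟩
  | hadd s t hs ht =>
    obtain ⟨m, hm⟩ := hs
    obtain ⟨n, hn⟩ := ht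
    exact ⟨max m n, Submodule.add_mem _ (tensorFil_mono F G (le_max_left _ _) hm)
      (tensorFil_mono F G (le_max_right _ _) hn)⟩
  | hmk x y =>
    obtain ⟨r, hr⟩ := hF x
    obtain ⟨s, hs⟩ := hG y
    exact ⟨r + s, mk_mem_tensorFil le_rfl hr hs⟩

variable (F : ℕ → Submodule k A) (G : ℕ → Submodule k X) (H : ℕ → Submodule k Y)

instance [IsFilteredAlgebra F] : IsFilteredAlgebra (envFil F) where
  mono m n hmn := Submodule.span_mono <| by
    rintro _ ⟨i, j, h, a, ha, b, hb, rfl⟩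
    exact ⟨i, j, h.trans hmn, a, ha, b, hb, rfl⟩
  exhaustive t := by
    have mono : Monotone (envFil F) := fun m n hmn => Submodule.span_mono <| by
      rintro _ ⟨i, j, h, a, ha, b, hb, rfl⟩
      exact ⟨i, j, h.trans hmn, a, ha, b, hb, rfl⟩
    induction t using TensorProduct.induction_on with
    | zero => exact ⟨0, Submodule.zero_mem _⟩
    | add s t hs ht =>
      obtain ⟨m, hm⟩ := hs
      obtain ⟨n, hn⟩ := ht
      exact ⟨max m n, Submodule.add_mem _ (mono (le_max_left _ _) hm)
        (mono (le_max_right _ _) hn)⟩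
    | tmul a b =>
      obtain ⟨i, hi⟩ := IsFilteredAlgebra.exhaustive (F := F) a
      obtain ⟨j, hj⟩ := IsFilteredAlgebra.exhaustive (F := F) b.unop
      exact ⟨i + j, Submodule.subset_span ⟨i, j, le_rfl, a, hi, b.unop, hj, rfl⟩⟩
  one_mem := Submodule.subset_span ⟨0, 0, le_rfl, 1, IsFilteredAlgebra.one_mem, 1,
    IsFilteredAlgebra.one_mem, rfl⟩
  mul_mem m n s hs t ht := by
    induction hs, ht using Submodule.span_induction₂ with
    | mem_mem s t hs ht =>
      obtain ⟨i, j, h, a, ha, b, hb, rfl⟩ := hs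
      obtain ⟨i', j', h', a', ha', b', hb', rfl⟩ := ht
      refine Submodule.subset_span ⟨i + i', j' + j, by omega, a * a',
        IsFilteredAlgebra.mul_mem _ _ _ ha _ ha', b' * b,
        IsFilteredAlgebra.mul_mem _ _ _ hb' _ hb, ?_⟩
      rw [Algebra.TensorProduct.tmul_mul_tmul, op_mul]
    | zero_left t _ => rw [zero_mul]; exact Submodule.zero_mem _
    | zero_right s _ => rw [mul_zero]; exact Submodule.zero_mem _
    | add_left x y z _ _ _ hx hy => rw [add_mul]; exact Submodule.add_mem _ hx hy
    | add_right x y z _ _ _ hx hy => rw [mul_add]; exact Submodule.add_mem _ hx hy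
    | smul_left c x y _ _ h => rw [smul_mul_assoc]; exact Submodule.smul_mem _ _ h
    | smul_right c x y _ _ h => rw [mul_smul_comm]; exact Submodule.smul_mem _ _ h

variable [IsScalarTower k A X] [IsScalarTower k Aᵐᵒᵖ Y] [SMulCommClass A Aᵐᵒᵖ X]
  [SMulCommClass A Aᵐᵒᵖ Y]

theorem smul_mem_tensorFil [IsFilteredModule F G] {m n : ℕ} {a : A} (ha : a ∈ F m)
    {t : BalTensor k A X Y} (ht : t ∈ tensorFil A G H n) : a • t ∈ tensorFil A G H (m + n) := by
  induction ht using Submodule.span_induction with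
  | mem t ht =>
    obtain ⟨r, s, h, x, hx, y, hy, rfl⟩ := ht
    rw [BalTensor.smul_mk]
    exact mk_mem_tensorFil (by omega) (IsFilteredModule.smul_mem (F := F) m r a ha x hx) hy
  | zero => rw [smul_zero]; exact Submodule.zero_mem _
  | add x y _ _ hx hy => rw [smul_add]; exact Submodule.add_mem _ hx hy
  | smul c x _ h => rw [smul_comm]; exact Submodule.smul_mem _ _ h

theorem op_smul_mem_tensorFil [IsFilteredRightModule F H] {m n : ℕ} {a : A} (ha : a ∈ F m)
    {t : BalTensor k A X Y} (ht : t ∈ tensorFil A G H n) :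
    op a • t ∈ tensorFil A G H (m + n) := by
  induction ht using Submodule.span_induction with
  | mem t ht =>
    obtain ⟨r, s, h, x, hx, y, hy, rfl⟩ := ht
    rw [BalTensor.op_smul_mk]
    exact mk_mem_tensorFil (by omega) hx
      (IsFilteredRightModule.smul_mem (F := F) m s a ha y hy)
  | zero => rw [smul_zero]; exact Submodule.zero_mem _
  | add x y _ _ hx hy => rw [smul_add]; exact Submodule.add_mem _ hx hy
  | smul c x _ h => rw [smul_comm]; exact Submodule.smul_mem _ _ h

instance [IsFilteredModule F G] [IsFilteredRightModule F H] :
    IsFilteredModule F (tensorFil A G H) where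
  mono := tensorFil_mono G H
  exhaustive := tensorFil_exhaustive (IsFilteredModule.exhaustive F)
    (IsFilteredRightModule.exhaustive F)
  smul_mem _ _ _ ha _ ht := smul_mem_tensorFil F G H ha ht

instance [IsFilteredModule F G] [IsFilteredRightModule F H] :
    IsFilteredRightModule F (tensorFil A G H) where
  mono := tensorFil_mono G H
  exhaustive := tensorFil_exhaustive (IsFilteredModule.exhaustive F)
    (IsFilteredRightModule.exhaustive F)
  smul_mem _ _ _ ha _ ht := op_smul_mem_tensorFil F G H ha ht

instance [IsFilteredModule F G] [IsFilteredRightModule F H] :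
    IsFilteredModule (envFil F) (tensorFil A G H) where
  mono := tensorFil_mono G H
  exhaustive := tensorFil_exhaustive (IsFilteredModule.exhaustive F)
    (IsFilteredRightModule.exhaustive F)
  smul_mem m n z hz t ht := by
    induction hz using Submodule.span_induction with
    | mem z hz =>
      obtain ⟨i, j, h, a, ha, b, hb, rfl⟩ := hz
      rw [BalTensor.tmul_smul]
      exact tensorFil_mono G H (by omega : i + (j + n) ≤ m + n)
        (smul_mem_tensorFil F G H ha (op_smul_mem_tensorFil F G H hb ht))
    | zero => exact (zero_smul (A ⊗[k] Aᵐᵒᵖ) t).symm ▸ Submodule.zero_mem _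
    | add x y _ _ hx hy => exact (add_smul x y t).symm ▸ Submodule.add_mem _ hx hy
    | smul c x _ h => exact (smul_assoc c x t).symm ▸ Submodule.smul_mem _ _ h

end TensorFiltration

/-! ### The filtrations of `A(V)` and `A(M)` -/

section ZhuFiltration

open VertexOperatorAlgebra AdmissibleModule

variable (k V M : Type*) [Field k] [AddCommGroup V] [Module k V]
  [VertexOperatorAlgebra k V] [AddCommGroup M] [Module k M] [AdmissibleModule k V M]

/-- The filtration of `A(M)`: `A(M)_n` is the image of `M(0) ⊕ ⋯ ⊕ M(n)`. -/
def ZhuBimodule.fil (n : ℕ) : Submodule k (ZhuBimodule k V M) :=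
  (⨆ i : ℕ, ⨆ _ : i ≤ n, degree (k := k) (M := M) V i).map (ZhuBimodule.mk k V M)

/-- The filtration of `A(V)`: `A(V)_n` is the image of `V_0 ⊕ ⋯ ⊕ V_n`. -/
def ZhuAlgebra.fil (n : ℕ) : Submodule k (ZhuAlgebra k V) :=
  (⨆ i : ℕ, ⨆ _ : i ≤ n, weight (k := k) (V := V) i).map (ZhuAlgebra.mk k V)

variable {k V M}

theorem mono_iSup {E : Type*} [AddCommGroup E] [Module k E] (W : ℕ → Submodule k E) :
    Monotone fun n : ℕ => ⨆ i : ℕ, ⨆ _ : i ≤ n, W i := fun _ _ h =>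
  iSup_le fun i => iSup_le fun hi => le_iSup₂_of_le i (hi.trans h) le_rfl

theorem exhaustive_iSup {E : Type*} [AddCommGroup E] [Module k E] {W : ℕ → Submodule k E}
    (hW : DirectSum.IsInternal W) (x : E) : ∃ n : ℕ, x ∈ ⨆ i : ℕ, ⨆ _ : i ≤ n, W i := by
  have hx : x ∈ ⨆ i, W i := by rw [hW.submodule_iSup_eq_top]; trivial
  induction hx using Submodule.iSup_induction' with
  | mem i x hx => exact ⟨i, Submodule.mem_iSup_of_mem i (Submodule.mem_iSup_of_mem le_rfl hx)⟩
  | zero => exact ⟨0, Submodule.zero_mem _⟩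
  | add x y _ _ hx hy =>
    obtain ⟨m, hm⟩ := hx
    obtain ⟨n, hn⟩ := hy
    exact ⟨max m n, Submodule.add_mem _ (mono_iSup W (le_max_left _ _) hm)
      (mono_iSup W (le_max_right _ _) hn)⟩

theorem mem_iSup_of_intPart {E : Type*} [AddCommGroup E] [Module k E] {W : ℕ → Submodule k E}
    {d : ℤ} {n : ℕ} (h : d ≤ n) {x : E} (hx : x ∈ intPart W d) :
    x ∈ ⨆ i : ℕ, ⨆ _ : i ≤ n, W i := by
  rcases mem_intPart hx with rfl | ⟨i, rfl, hi⟩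
  · exact Submodule.zero_mem _
  · exact Submodule.mem_iSup_of_mem i (Submodule.mem_iSup_of_mem (by omega) hi)

/-- A bilinear operation which maps `V_i × M(j)` into `M(0) ⊕ ⋯ ⊕ M(i + j)` respects the
filtrations. -/
theorem bilin_iSup {E E' : Type*} [AddCommGroup E] [Module k E] [AddCommGroup E'] [Module k E']
    {W : ℕ → Submodule k E} {W' : ℕ → Submodule k E'} (φ : E →ₗ[k] E' →ₗ[k] E')
    (h : ∀ i j, ∀ a ∈ W i, ∀ u ∈ W' j, φ a u ∈ ⨆ l : ℕ, ⨆ _ : l ≤ i + j, W' l) (m n : ℕ)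
    {a : E} (ha : a ∈ ⨆ i : ℕ, ⨆ _ : i ≤ m, W i) {u : E'} (hu : u ∈ ⨆ i : ℕ, ⨆ _ : i ≤ n, W' i) :
    φ a u ∈ ⨆ l : ℕ, ⨆ _ : l ≤ m + n, W' l := by
  have h1 : ∀ i ≤ m, ∀ a ∈ W i, φ a u ∈ ⨆ l : ℕ, ⨆ _ : l ≤ m + n, W' l := by
    intro i hi a ha
    have : (⨆ i : ℕ, ⨆ _ : i ≤ n, W' i) ≤ (⨆ l : ℕ, ⨆ _ : l ≤ m + n, W' l).comap (φ a) :=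
      iSup_le fun j => iSup_le fun hj u hu =>
        mono_iSup W' (by omega : i + j ≤ m + n) (h i j a ha u hu)
    exact this hu
  have : (⨆ i : ℕ, ⨆ _ : i ≤ m, W i) ≤ (⨆ l : ℕ, ⨆ _ : l ≤ m + n, W' l).comap (φ.flip u) :=
    iSup_le fun i => iSup_le fun hi a ha => h1 i hi a ha
  exact this ha

theorem res_mem_iSup (p q : ℤ) {i j n : ℕ} (h : (i + j : ℤ) - q - 1 ≤ n) {a : V}
    (ha : a ∈ weight (k := k) i) {u : M} (hu : u ∈ degree (k := k) V j) :
    res k M (kern p q) a u ∈ ⨆ l : ℕ, ⨆ _ : l ≤ n, degree (k := k) (M := M) V l := by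
  obtain ⟨N₀, hN⟩ := res_kern (k := k) p q a u
  rw [hN N₀ le_rfl]
  exact Submodule.sum_mem _ fun l _ => Submodule.smul_mem _ _
    (mem_iSup_of_intPart (by omega) (AdmissibleModule.mode_mem i j (q + l) a u ha hu))

theorem leftStar_mem_iSup (m n : ℕ) {a : V} (ha : a ∈ ⨆ i : ℕ, ⨆ _ : i ≤ m, weight (k := k) i)
    {u : M} (hu : u ∈ ⨆ i : ℕ, ⨆ _ : i ≤ n, degree (k := k) V i) :
    leftStar k M a u ∈ ⨆ l : ℕ, ⨆ _ : l ≤ m + n, degree (k := k) (M := M) V l :=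
  bilin_iSup (leftStar k M) (fun i j a ha u hu => by
    rw [leftStar_hom (mem_intPart_of_mem ha)]
    exact res_mem_iSup _ _ (by push_cast; omega) ha hu) m n ha hu

theorem rightStar_mem_iSup (m n : ℕ) {a : V} (ha : a ∈ ⨆ i : ℕ, ⨆ _ : i ≤ m, weight (k := k) i)
    {u : M} (hu : u ∈ ⨆ i : ℕ, ⨆ _ : i ≤ n, degree (k := k) V i) :
    rightStar k M a u ∈ ⨆ l : ℕ, ⨆ _ : l ≤ m + n, degree (k := k) (M := M) V l :=
  bilin_iSup (rightStar k M) (fun i j a ha u hu => by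
    rw [rightStar_hom (mem_intPart_of_mem ha)]
    exact res_mem_iSup _ _ (by push_cast; omega) ha hu) m n ha hu

theorem ZhuBimodule.fil_mono : Monotone (ZhuBimodule.fil k V M) := fun _ _ h =>
  Submodule.map_mono (mono_iSup _ h)

theorem ZhuBimodule.fil_exhaustive (x : ZhuBimodule k V M) : ∃ n, x ∈ ZhuBimodule.fil k V M n := by
  obtain ⟨u, rfl⟩ := ZhuBimodule.mk_surjective x
  obtain ⟨n, hn⟩ := exhaustive_iSup (degree_isInternal (k := k) (V := V) (M := M)) u
  exact ⟨n, Submodule.mem_map_of_mem hn⟩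

variable [CharZero k]

instance : IsFilteredAlgebra (ZhuAlgebra.fil k V) where
  mono _ _ h := Submodule.map_mono (mono_iSup _ h)
  exhaustive x := by
    obtain ⟨u, rfl⟩ := ZhuAlgebra.mk_surjective x
    obtain ⟨n, hn⟩ := exhaustive_iSup (weight_isInternal (k := k) (V := V)) u
    exact ⟨n, Submodule.mem_map_of_mem hn⟩
  one_mem := Submodule.mem_map_of_mem
    (Submodule.mem_iSup_of_mem 0 (Submodule.mem_iSup_of_mem le_rfl vacuum_mem))
  mul_mem i j := by
    rintro _ ⟨a, ha, rfl⟩ _ ⟨b, hb, rfl⟩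
    exact Submodule.mem_map_of_mem (leftStar_mem_iSup i j ha hb)

instance : IsFilteredModule (ZhuAlgebra.fil k V) (ZhuBimodule.fil k V M) where
  mono := ZhuBimodule.fil_mono
  exhaustive := ZhuBimodule.fil_exhaustive
  smul_mem i j := by
    rintro _ ⟨a, ha, rfl⟩ _ ⟨u, hu, rfl⟩
    exact Submodule.mem_map_of_mem (leftStar_mem_iSup i j ha hu)

instance : IsFilteredRightModule (ZhuAlgebra.fil k V) (ZhuBimodule.fil k V M) where
  mono := ZhuBimodule.fil_mono
  exhaustive := ZhuBimodule.fil_exhaustive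
  smul_mem i j := by
    rintro _ ⟨a, ha, rfl⟩ _ ⟨u, hu, rfl⟩
    exact Submodule.mem_map_of_mem (rightStar_mem_iSup i j ha hu)

variable (k V M) in
/-- The tensor product `A(M) ⊗_{A(V)} A(N)`. -/
abbrev ZhuTensor (N : Type*) [AddCommGroup N] [Module k N] [AdmissibleModule k V N] : Type _ :=
  BalTensor k (ZhuAlgebra k V) (ZhuBimodule k V M) (ZhuBimodule k V N)

variable (k V M) in
/-- The filtration of `A(M) ⊗_{A(V)} A(N)` induced by those of `A(M)` and `A(N)`. -/
abbrev ZhuTensor.fil (N : Type*) [AddCommGroup N] [Module k N] [AdmissibleModule k V N] :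
    ℕ → Submodule k (ZhuTensor k V M N) :=
  tensorFil (ZhuAlgebra k V) (ZhuBimodule.fil k V M) (ZhuBimodule.fil k V N)

variable (V) in
/-- The element `u ⊗ v` of `A(M) ⊗_{A(V)} A(N)`. -/
abbrev ZhuTensor.mk {N : Type*} [AddCommGroup N] [Module k N] [AdmissibleModule k V N]
    (u : ZhuBimodule k V M) (v : ZhuBimodule k V N) : ZhuTensor k V M N :=
  BalTensor.mk k (ZhuAlgebra k V) (ZhuBimodule k V M) (ZhuBimodule k V N) u v

variable (k V) in
/-- The filtration of the enveloping algebra `A(V) ⊗ A(V)ᵒᵖ`. -/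
abbrev ZhuAlgebra.envFil : ℕ → Submodule k (ZhuAlgebra k V ⊗[k] (ZhuAlgebra k V)ᵐᵒᵖ) :=
  Zhu.envFil (ZhuAlgebra.fil k V)

end ZhuFiltration

end Zhu

end

noncomputable section

namespace Zhu

/-! ### The exponential of `L(1)` -/

/-! ### Rearrangement of finite sums and a recursion for binomial coefficients. -/

section SumLemmas

/-! The bare swap `u ⊗ v ↦ v ⊗ u` does not respect the relations `u * a ⊗ v = u ⊗ a * v`. It
respects them up to terms of lower degree, because `a * u - u * a` has lower degree, but that does
not yet give a map on `gr`: an element of degree at most `n - 1` may be a combination of pure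
tensors whose top parts cancel only through balancing relations of high degree, and the errors of
the bare swap are then not controlled in degree `n`. What is needed is an honest map between the
tensor products whose symbol is the swap up to sign.

Such a map comes from `θ = e^{L(1)} (-1)^{deg}`. It preserves `O(M)` and exchanges the two products:
`θ(a * u) = θ(u) * θ(a)` and `θ(u * a) = θ(a) * θ(u)` (`theta_mem_zhuO`, `theta_leftStar`,
`theta_rightStar`). Hence `u ⊗ v ↦ θ(v) ⊗ θ(u)` is well defined (`BalTensor.antiSwap`). Since `L(1)`
lowers degrees, `θ` is `(-1)^r` on `A(M)_r` modulo `A(M)_{r-1}`. So this map respects the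
filtrations, and `(-1)^n` times its action in degree `n` is the swap (`exists_isGrSwap`). The same
construction with `M` and `N` exchanged gives the inverse.

The computation behind this is `theta_res_kern`: conjugation by `θ` amounts to the substitution `z ↦
-z/(1+z)` in the residue. Formally it is `e^{L(1)} Y(a,z) e^{-L(1)} = Y(e^{(1-z)L(1)} (1-z)^{-2L(0)}
a, z/(1-z))`. In modes, the commutator `lOne_mode` is iterated to `lOne_pow_mode`, summed to
`theta_mode`, and extended to all powers of `1 + z`. The substitution keeps the kernel of `O(M)` and
interchanges the kernels of the two products.

The swap is linear over `gr A(V)` because `v * a` and `a * v` have the same symbol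
(`ZhuBimodule.op_smul_sub_smul_mem_below`), so the class of `v ⊗ a * u = v * a ⊗ u` is that of `a *
v ⊗ u`. Linearity over the enveloping algebra follows from that of the two one-sided actions. -/

/-- Discrete Leibniz rule: a factor `m + 1` is split into a share of each index. The two boundary
terms vanish, and each share is reindexed to the previous antidiagonal. -/
theorem sum_antidiagonal_succ_add {M : Type*} [AddCommMonoid M] (m : ℕ) (G H : ℕ → ℕ → M)
    (hG : ∀ l, G 0 l = 0) (hH : ∀ i, H i 0 = 0) :
    ∑ x ∈ Finset.HasAntidiagonal.antidiagonal (m + 1), (G x.1 x.2 + H x.1 x.2) =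
      ∑ x ∈ Finset.HasAntidiagonal.antidiagonal m, (G (x.1 + 1) x.2 + H x.1 (x.2 + 1)) := by
  rw [Finset.sum_add_distrib, Finset.Nat.sum_antidiagonal_succ,
    Finset.Nat.sum_antidiagonal_succ' (f := fun x => H x.1 x.2), hG, hH, zero_add,
    Finset.sum_add_distrib, zero_add]

/-- Lets a sum of homogeneous components of a product of two exponentials factor: the triangle `i +
l < N` is filled up to a square by terms that vanish. -/
theorem sum_range_sum_antidiagonal {M : Type*} [AddCommMonoid M] (N : ℕ) (F : ℕ → ℕ → M)
    (hF : ∀ i l, N ≤ i + l → F i l = 0) :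
    ∑ m ∈ Finset.range N, ∑ x ∈ Finset.HasAntidiagonal.antidiagonal m, F x.1 x.2 =
      ∑ i ∈ Finset.range N, ∑ l ∈ Finset.range N, F i l := by
  simp only [Finset.Nat.sum_antidiagonal_eq_sum_range_succ F]
  rw [Finset.sum_range_diag_flip]
  refine Finset.sum_congr rfl fun i _ => ?_
  refine Finset.sum_subset (Finset.range_mono (Nat.sub_le _ _)) fun l _ hl => hF _ _ ?_
  rw [Finset.mem_range] at hl
  omega

/-- Comparison of the descending Pochhammer polynomials of lengths `i` and `i + 1`. The factorial
`i!` is cancelled over `ℤ` before casting to `k`. -/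
theorem succ_mul_binom_succ {k : Type*} [Field k] [CharZero k] (n : ℤ) (i : ℕ) :
    ((i + 1 : k)) * binom n (i + 1) = (n - i : k) * binom n i := by
  have h1 := Ring.descPochhammer_eq_factorial_smul_choose n i
  have h2 := Ring.descPochhammer_eq_factorial_smul_choose n (i + 1)
  rw [descPochhammer_succ_right, Polynomial.smeval_mul, h1] at h2
  simp only [Polynomial.smeval_sub, Polynomial.smeval_X, Polynomial.smeval_natCast, pow_one,
    pow_zero, nsmul_eq_mul, mul_one, Nat.factorial_succ] at h2
  have h3 : ((i : ℤ) + 1) * Ring.choose n (i + 1) = (n - i) * Ring.choose n i := by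
    apply mul_left_cancel₀ (Nat.cast_ne_zero.2 (Nat.factorial_ne_zero i) : (i.factorial : ℤ) ≠ 0)
    push_cast at h2
    linear_combination -h2
  have := congrArg (fun z : ℤ => (z : k)) h3
  push_cast at this
  exact this

end SumLemmas

/-! ### The operator `L(1)`, its commutators with modes, and their iterates. -/

section LOne

open VertexOperatorAlgebra AdmissibleModule

variable (k V M : Type*) [Field k] [AddCommGroup V] [Module k V]
  [VertexOperatorAlgebra k V] [AddCommGroup M] [Module k M] [AdmissibleModule k V M]

/-- The operator `L(1) = ω_2` on `M`. -/
def lOne : Module.End k M := mode (moduleOp (k := k)) (conformal k : V) 2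

variable {k V M}

theorem lOne_mem {u : M} {r : ℤ} (hu : u ∈ intPart (degree (k := k) V) r) :
    lOne k V M u ∈ intPart (degree (k := k) (M := M) V) (r - 1) := by
  have := module_mode_hom (mem_intPart_of_mem (conformal_mem (k := k) (V := V))) hu 2
  rwa [show ((2 : ℕ) : ℤ) + r - 2 - 1 = r - 1 by push_cast; ring] at this

theorem lOne_pow_mem {u : M} {r : ℤ} (hu : u ∈ intPart (degree (k := k) V) r) (l : ℕ) :
    (lOne k V M ^ l) u ∈ intPart (degree (k := k) (M := M) V) (r - l) := by
  induction l with
  | zero => simpa using hu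
  | succ l ih =>
    rw [pow_succ', Module.End.mul_apply]
    have := lOne_mem ih
    rwa [show r - (l : ℤ) - 1 = r - ((l + 1 : ℕ) : ℤ) by push_cast; ring] at this

theorem lOne_pow_hom {a : V} {p : ℤ} (ha : Hom k a p) (l : ℕ) :
    Hom k ((lOne k V V ^ l) a) (p - l) := lOne_pow_mem (k := k) (V := V) (M := V) ha l

/-- The source of finiteness for the exponentials: powers of `L(1)` and high modes push a
homogeneous vector into negative degree. -/
theorem eq_zero_of_mem_intPart_neg {E : Type*} [AddCommGroup E] [Module k E]
    {W : ℕ → Submodule k E} {d : ℤ} (hd : d < 0) {x : E} (hx : x ∈ intPart W d) : x = 0 := by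
  rcases mem_intPart hx with rfl | ⟨n, rfl, _⟩
  · rfl
  · omega

/-- The axiom `L_neg_one` concerns `V` only. Applied to the vacuum it gives `L(-1) b = b_{-2} 1`,
and the modes of this vector on any module are known from the Borcherds identity through
`mode_shift`. -/
theorem mode_translation (b : V) (n : ℤ) (u : M) :
    mode (moduleOp (k := k)) (mode (vertexOp (k := k)) (conformal k) 0 b) n u =
      (-n : k) • mode (moduleOp (k := k)) b (n - 1) u := by
  have h := L_neg_one (k := k) b (-1) (vacuum k)
  rw [mode_neg_one_vacuum] at h
  rw [h]
  simp only [Int.cast_neg, Int.cast_one, neg_neg, one_smul]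
  exact mode_shift b n u

theorem mode_L_zero {b : V} {p : ℤ} (hb : Hom k b p) :
    mode (vertexOp (k := k)) (conformal k) 1 b = (p : k) • b := by
  rcases mem_intPart hb with rfl | ⟨n, rfl, h⟩
  · simp
  · simpa using L_zero n b h

/-- The commutator of `L(1)` with the modes of a homogeneous vector. -/
theorem lOne_mode {b : V} {p : ℤ} (hb : Hom k b p) (n : ℤ) (u : M) :
    lOne k V M (mode (moduleOp (k := k)) b n u) =
      mode (moduleOp (k := k)) b n (lOne k V M u) +
      (((2 * p - n - 2 : ℤ) : k) • mode (moduleOp (k := k)) b (n + 1) u +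
        mode (moduleOp (k := k)) (lOne k V V b) n u) := by
  -- For `l = 0`, `m = 2` the right side is the commutator of `ω_2 = L(1)` with `b_n`. On the left
  -- only `i = 0, 1, 2` survive, contributing `L(-1) b`, `L(0) b` and `L(1) b`.
  have h := AdmissibleModule.borcherds (k := k) (conformal k : V) b u 0 2 n
  rw [finsum_eq_sum_of_support_subset (s := Finset.range 3), finsum_eq_single _ 0] at h
  · simp only [Finset.sum_range_succ, Finset.sum_range_zero] at h
    have b1 : (binom 2 1 : k) = 2 := by simp [binom]
    have b2 : (binom 2 2 : k) = 1 := by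
      have := Ring.choose_natCast (R := ℤ) 2 2
      rw [binom]; push_cast at this; rw [this]; simp
    have b0 : ∀ n : ℤ, (binom n 0 : k) = 1 := fun n => by simp [binom]
    simp only [b0, b1, b2, zero_add, pow_zero, mul_one, one_smul, zpow_zero, Nat.cast_zero,
      sub_zero, add_zero, Nat.cast_one, Nat.cast_ofNat, mode_translation, mode_L_zero hb] at h
    have e : lOne k V V b = mode (vertexOp (k := k)) (conformal k) 2 b := rfl
    rw [e, lOne, ← sub_eq_iff_eq_add', ← h]
    rw [show (2 + n - 1 : ℤ) = n + 1 by ring, show (2 + n - 2 : ℤ) = n by ring]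
    have e2 : mode (moduleOp (k := k)) ((p : k) • b) (n + 1) u =
        (p : k) • mode (moduleOp (k := k)) b (n + 1) u := by
      simp [mode]
    rw [e2]
    push_cast
    module
  · intro i hi
    obtain ⟨j, rfl⟩ := Nat.exists_eq_succ_of_ne_zero hi
    rw [binom, Nat.succ_eq_add_one, Ring.choose_zero_succ]; simp
  · intro i hi
    simp only [Finset.coe_range, Set.mem_Iio]
    by_contra hlt
    apply hi
    have := Ring.choose_natCast (R := ℤ) 2 i
    push_cast at this
    dsimp only
    rw [binom, this, Nat.choose_eq_zero_of_lt (by omega)]; simp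

/-- The homogeneous components of `e^{L(1)} a_n e^{-L(1)}`, for `a` of weight `p`. -/
def conjMode (k : Type*) {V : Type*} (M : Type*) [Field k] [AddCommGroup V] [Module k V]
    [VertexOperatorAlgebra k V] [AddCommGroup M] [Module k M] [AdmissibleModule k V M]
    (p n : ℤ) (a : V) (m : ℕ) : Module.End k M :=
  ∑ x ∈ Finset.HasAntidiagonal.antidiagonal m, ((x.2.factorial : k)⁻¹ * binom (2 * p - 2 - n - x.2) x.1) •
    mode (moduleOp (k := k)) ((lOne k V V ^ x.2) a) (n + x.1)

variable [CharZero k]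

/-- Compares, up to the factor `1 / j!`, the coefficients of `(L(1)^j a)_{n+i+1}` in
`lOne_conjMode`, with `c = 2p - 2 - n`. The first term on the right comes from the part of the
commutator that raises the mode index, the second from the part that applies `L(1)` to the vector.
-/
theorem conjMode_coeff (c : ℤ) (i j : ℕ) :
    ((i + 1 : k) + j) * binom (c - j) (i + 1) =
      (((c - j : ℤ) : k) - i - j) * binom (c - j) i + j * binom (c - j + 1) (i + 1) := by
  rw [binom_succ_succ, add_mul, succ_mul_binom_succ]
  ring

/-- Identifies `conjMode` in degree `m` with the divided power `(ad L(1))^m / m!` of `a_n`: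
bracketing with `L(1)` multiplies the next one by `m + 1`. -/
theorem lOne_conjMode {a : V} {p : ℤ} (ha : Hom k a p) (n : ℤ) (m : ℕ) (u : M) :
    lOne k V M (conjMode k M p n a m u) =
      conjMode k M p n a m (lOne k V M u) + (m + 1 : k) • conjMode k M p n a (m + 1) u := by
  set c : ℤ := 2 * p - 2 - n with hc
  set B : ℕ → ℕ → M := fun i j => mode (moduleOp (k := k)) ((lOne k V V ^ j) a) (n + i) u with hB
  -- `G + H` carries `(i + j)` times the coefficient of `conjMode`. The share `H` is chosen to match
  -- the terms `(L(1) b)_n` of the commutator, and `G` is what remains for the terms `b_{n+1}`. The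
  -- plain split into `i` and `j` would fail, because the upper entry of the binomial depends on
  -- `j`.
  set G : ℕ → ℕ → M := fun i j => ((j.factorial : k)⁻¹ *
    (i * binom (c - j) i - j * (binom (c - j + 1) i - binom (c - j) i))) • B i j with hG
  set H : ℕ → ℕ → M := fun i j => ((j.factorial : k)⁻¹ * (j * binom (c - j + 1) i)) • B i j with hH
  have e1 : (m + 1 : k) • conjMode k M p n a (m + 1) u =
      ∑ x ∈ Finset.HasAntidiagonal.antidiagonal (m + 1), (G x.1 x.2 + H x.1 x.2) := by
    rw [conjMode, LinearMap.sum_apply, Finset.smul_sum]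
    refine Finset.sum_congr rfl fun x hx => ?_
    have hx : ((x.1 : k) + x.2) = m + 1 := by
      exact_mod_cast congrArg (fun n : ℕ => (n : k)) (Finset.HasAntidiagonal.mem_antidiagonal.1 hx)
    rw [hG, hH, ← hx, LinearMap.smul_apply, ← add_smul, smul_smul]
    congr 1
    ring
  have hG0 : ∀ l, G 0 l = 0 := fun l => by simp [hG, binom]
  have hH0 : ∀ i, H i 0 = 0 := fun i => by simp [hH]
  rw [e1, sum_antidiagonal_succ_add m G H hG0 hH0, conjMode, LinearMap.sum_apply,
    LinearMap.sum_apply, map_sum, ← Finset.sum_add_distrib]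
  refine Finset.sum_congr rfl fun x _ => ?_
  obtain ⟨i, j⟩ := x
  rw [LinearMap.smul_apply, map_smul, lOne_mode (lOne_pow_hom ha j), smul_add, smul_add, smul_smul]
  congr 2
  · simp only [hG, hB]
    rw [add_assoc, show ((i : ℤ) + 1) = ((i + 1 : ℕ) : ℤ) by push_cast; ring]
    congr 1
    have := conjMode_coeff (k := k) c i j
    rw [mul_assoc]
    congr 1
    -- The commutator was applied to `L(1)^j a`, of weight `p - j`, and to the mode `n + i`.
    rw [show (2 * (p - (j : ℤ)) - (n + i) - 2 : ℤ) = c - j - i - j by rw [hc]; ring]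
    push_cast at this ⊢
    linear_combination -this
  · simp only [hH, hB]
    rw [← Module.End.mul_apply, ← pow_succ', Nat.factorial_succ]
    congr 1
    rw [show (c - ((j + 1 : ℕ) : ℤ) + 1) = c - j by push_cast; ring]
    have h1 : ((j : k) + 1) ≠ 0 := by exact_mod_cast Nat.succ_ne_zero j
    push_cast
    field_simp
    rw [hc]

theorem lOne_divPow (l : ℕ) (u : M) :
    lOne k V M ((l.factorial : k)⁻¹ • (lOne k V M ^ l) u) =
      (l + 1 : k) • ((l + 1).factorial : k)⁻¹ • (lOne k V M ^ (l + 1)) u := by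
  have hl : ((l : k) + 1) ≠ 0 := by exact_mod_cast Nat.succ_ne_zero l
  rw [map_smul, pow_succ', Module.End.mul_apply, smul_smul, Nat.factorial_succ]
  congr 1
  push_cast
  field_simp

/-- The divided powers `L(1)^m / m!` applied to `a_n u`. -/
theorem lOne_pow_mode {a : V} {p : ℤ} (ha : Hom k a p) (n : ℤ) (m : ℕ) (u : M) :
    (m.factorial : k)⁻¹ • (lOne k V M ^ m) (mode (moduleOp (k := k)) a n u) =
      ∑ x ∈ Finset.HasAntidiagonal.antidiagonal m, conjMode k M p n a x.1
        ((x.2.factorial : k)⁻¹ • (lOne k V M ^ x.2) u) := by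
  induction m with
  | zero => simp [conjMode, binom]
  | succ m ih =>
    have hm : ((m : k) + 1) ≠ 0 := by exact_mod_cast Nat.succ_ne_zero m
    apply smul_right_injective M hm
    set w : ℕ → M := fun l => (l.factorial : k)⁻¹ • (lOne k V M ^ l) u with hw
    dsimp only
    rw [Finset.smul_sum]
    -- The factor `m + 1` is the sum of the two indices. One share advances the conjugated mode
    -- (`lOne_conjMode`), the other the divided power on `u` (`lOne_divPow`).
    have e2 : ∀ x ∈ Finset.HasAntidiagonal.antidiagonal (m + 1), (m + 1 : k) • conjMode k M p n a x.1 (w x.2) =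
        (x.1 : k) • conjMode k M p n a x.1 (w x.2) +
          (x.2 : k) • conjMode k M p n a x.1 (w x.2) := by
      intro x hx
      have hx : ((x.1 : k) + x.2) = m + 1 := by
        exact_mod_cast congrArg (fun n : ℕ => (n : k)) (Finset.HasAntidiagonal.mem_antidiagonal.1 hx)
      rw [← add_smul, hx]
    rw [← lOne_divPow, ih, Finset.sum_congr rfl e2, sum_antidiagonal_succ_add m
      (fun i l => (i : k) • conjMode k M p n a i (w l))
      (fun i l => (l : k) • conjMode k M p n a i (w l)) (by simp) (by simp), map_sum]
    refine Finset.sum_congr rfl fun x _ => ?_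
    rw [lOne_conjMode ha, lOne_divPow, map_smul]
    push_cast
    exact add_comm _ _

end LOne

/-! ### The anti-involution `e^{L(1)} (-1)^{deg}` -/

section Theta

open VertexOperatorAlgebra AdmissibleModule

variable (k V M : Type*) [Field k] [AddCommGroup V] [Module k V]
  [VertexOperatorAlgebra k V] [AddCommGroup M] [Module k M] [AdmissibleModule k V M]

/-- The operator `e^{L(1)} (-1)^{deg}` on `M`. -/
def theta : Module.End k M :=
  DirectSum.toModule k ℕ M (fun n => ((-1 : k) ^ n • ∑ i ∈ Finset.range (n + 1),
      (i.factorial : k)⁻¹ • lOne k V M ^ i) ∘ₗ (degree (k := k) V n).subtype) ∘ₗ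
    (LinearEquiv.ofBijective (DirectSum.coeLinearMap (degree (k := k) (M := M) V))
      degree_isInternal).symm.toLinearMap

variable {k V M}

/-- Terms beyond the degree of `u` vanish, so any larger `N` may be used. The freedom in `N`, and a
degree in `ℤ`, allow the vectors `u` and `a_n u` to be expanded over the same range even when the
degree of `a_n u` is negative. -/
theorem theta_apply {u : M} {r : ℤ} (hu : u ∈ intPart (degree (k := k) V) r) {N : ℕ} (hN : r < N) :
    theta k V M u =
      (-1 : k) ^ r • ∑ i ∈ Finset.range N, (i.factorial : k)⁻¹ • (lOne k V M ^ i) u := by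
  rcases mem_intPart hu with rfl | ⟨n, rfl, h⟩
  · simp
  have e : (LinearEquiv.ofBijective (DirectSum.coeLinearMap (degree (k := k) (M := M) V))
      degree_isInternal).symm u =
        DirectSum.lof k ℕ (fun n => degree (k := k) (M := M) V n) n ⟨u, h⟩ := by
    rw [LinearEquiv.symm_apply_eq]
    exact (DirectSum.coeLinearMap_lof (degree (k := k) (M := M) V) n ⟨u, h⟩).symm
  have e2 : theta k V M u = (-1 : k) ^ n • ∑ i ∈ Finset.range (n + 1),
      (i.factorial : k)⁻¹ • (lOne k V M ^ i) u := by
    rw [theta, LinearMap.comp_apply]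
    erw [e, DirectSum.toModule_lof]
    simp
  rw [e2, zpow_natCast]
  congr 1
  refine Finset.sum_subset (Finset.range_mono (by omega)) fun l _ hl => ?_
  rw [Finset.mem_range] at hl
  rw [eq_zero_of_mem_intPart_neg (by omega) (lOne_pow_mem hu l), smul_zero]

theorem degree_linear_ext {W : Type*} [AddCommGroup W] [Module k W] {φ ψ : M →ₗ[k] W}
    (h : ∀ (n : ℕ) (u : M), u ∈ intPart (degree (k := k) V) n → φ u = ψ u) : φ = ψ := by
  ext u
  have hu : u ∈ iSup (degree (k := k) (M := M) V) := by
    rw [degree_isInternal.submodule_iSup_eq_top]; trivial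
  have hle : iSup (degree (k := k) (M := M) V) ≤ LinearMap.eqLocus φ ψ :=
    iSup_le fun n a ha => h n a (mem_intPart_of_mem ha)
  exact hle hu

/-- Replaces the inexplicit bound of `res_kern` by any `N` beyond which the modes kill `u`, so that
several residues can share one range. -/
theorem res_kern_eq_sum (p q : ℤ) (a : V) (u : M) {N : ℕ}
    (hN : ∀ i : ℕ, N ≤ i → mode (moduleOp (k := k)) a (q + i) u = 0) :
    res k M (kern p q) a u =
      ∑ i ∈ Finset.range N, (binom p i : k) • mode (moduleOp (k := k)) a (q + i) u := by
  obtain ⟨N₀, h⟩ := res_kern (k := k) p q a u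
  rw [h (max N₀ N) (le_max_left _ _)]
  refine (Finset.sum_subset (Finset.range_mono (le_max_right _ _)) fun i _ hi => ?_).symm
  rw [Finset.mem_range, not_lt] at hi
  rw [hN i hi, smul_zero]

theorem lOne_pow_eq_zero {a : V} {p : ℤ} (ha : Hom k a p) {j : ℕ} (hj : p < j) :
    (lOne k V V ^ j) a = 0 :=
  eq_zero_of_mem_intPart_neg (by omega) (lOne_pow_hom ha j)

/-- For fixed `j` the sum over `i` is the expansion of a power of `1 + z`, so the components of the
conjugated mode assemble into residues. The degree of `(L(1)^j a)_{n+i} u` is `p + r - n - 1 - i -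
j`, which explains the bound on `N`. -/
theorem sum_conjMode {a : V} {p r n : ℤ} (ha : Hom k a p) {u : M}
    (hu : u ∈ intPart (degree (k := k) V) r) {J N : ℕ} (hJ : p < J) (hJN : J ≤ N)
    (hN : p + r - n - 1 < N) :
    ∑ m ∈ Finset.range N, conjMode k M p n a m u =
      ∑ j ∈ Finset.range J, (j.factorial : k)⁻¹ •
        res k M (kern (2 * p - 2 - n - j) n) ((lOne k V V ^ j) a) u := by
  have hz : ∀ i j : ℕ, N ≤ i + j →
      mode (moduleOp (k := k)) ((lOne k V V ^ j) a) (n + i) u = 0 := fun i j hij =>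
    eq_zero_of_mem_intPart_neg (by omega) (module_mode_hom (lOne_pow_hom ha j) hu (n + i))
  simp only [conjMode, LinearMap.sum_apply, LinearMap.smul_apply]
  rw [sum_range_sum_antidiagonal N (fun i j => ((j.factorial : k)⁻¹ * binom (2 * p - 2 - n - j) i) •
    mode (moduleOp (k := k)) ((lOne k V V ^ j) a) (n + i) u)
    (fun i j hij => by rw [hz i j hij, smul_zero]), Finset.sum_comm]
  refine (Finset.sum_subset (Finset.range_mono hJN) fun j _ hj => ?_).symm.trans
    (Finset.sum_congr rfl fun j _ => ?_)
  · rw [Finset.mem_range, not_lt] at hj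
    refine Finset.sum_eq_zero fun i _ => ?_
    rw [lOne_pow_eq_zero ha (by omega)]
    simp [mode]
  · rw [res_kern_eq_sum _ _ _ _ (N := N) fun i hi => hz i j (by omega), Finset.smul_sum]
    simp only [smul_smul]

theorem theta_adjoint {a : V} {p : ℤ} (ha : Hom k a p) {J : ℕ} (hJ : p < J) :
    theta k V V a =
      (-1 : k) ^ p • ∑ j ∈ Finset.range J, (j.factorial : k)⁻¹ • (lOne k V V ^ j) a :=
  theta_apply (k := k) (V := V) (M := V) ha hJ

variable [CharZero k]

/-- Conjugation of the modes of a homogeneous vector by `e^{L(1)} (-1)^{deg}`. -/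
theorem theta_mode {a : V} {p : ℤ} (ha : Hom k a p) (n : ℤ) {J : ℕ} (hJ : p < J) (u : M) :
    theta k V M (mode (moduleOp (k := k)) a n u) =
      (-1 : k) ^ (p - n - 1) • ∑ j ∈ Finset.range J, (j.factorial : k)⁻¹ •
        res k M (kern (2 * p - 2 - n - j) n) ((lOne k V V ^ j) a) (theta k V M u) := by
  set R : Module.End k M := ∑ j ∈ Finset.range J, (j.factorial : k)⁻¹ •
        res k M (kern (2 * p - 2 - n - j) n) ((lOne k V V ^ j) a) with hR
  suffices h : theta k V M ∘ₗ mode (moduleOp (k := k)) a n =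
      (-1 : k) ^ (p - n - 1) • (R ∘ₗ theta k V M) by
    have := LinearMap.congr_fun h u
    simpa [hR] using this
  refine degree_linear_ext (k := k) (V := V) fun r u hu => ?_
  -- `N` must exceed the degrees of `u` and of `a_n u` and be at least `J`, which bounds the powers
  -- of `L(1)` on `a`.
  obtain ⟨N, hNJ, hNr, hN⟩ : ∃ N : ℕ, J ≤ N ∧ (r : ℤ) < N ∧ p + r - n - 1 < N :=
    ⟨J + r + 1 + (p + r - n).toNat, by omega, by omega, by omega⟩
  set w : ℕ → M := fun l => (l.factorial : k)⁻¹ • (lOne k V M ^ l) u with hw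
  have hwm : ∀ l : ℕ, w l ∈ intPart (degree (k := k) (M := M) V) (r - l) := fun l =>
    Submodule.smul_mem _ _ (lOne_pow_mem hu l)
  have hz : ∀ i l : ℕ, N ≤ i + l → conjMode k M p n a i (w l) = 0 := by
    intro i l hil
    rw [conjMode, LinearMap.sum_apply]
    refine Finset.sum_eq_zero fun x hx => ?_
    have hx := Finset.HasAntidiagonal.mem_antidiagonal.1 hx
    rw [LinearMap.smul_apply, eq_zero_of_mem_intPart_neg _
      (module_mode_hom (lOne_pow_hom ha x.2) (hwm l) (n + x.1)), smul_zero]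
    omega
  have e : ∀ l, ∑ i ∈ Finset.range N, conjMode k M p n a i (w l) = R (w l) := by
    intro l
    rw [sum_conjMode ha (hwm l) hJ hNJ (by omega), hR]
    simp
  rw [LinearMap.comp_apply, LinearMap.smul_apply, LinearMap.comp_apply,
    theta_apply (module_mode_hom ha hu n) hN, theta_apply hu hNr]
  simp only [lOne_pow_mode ha]
  -- The double sum factors as the conjugated mode applied to `e^{L(1)} u`. The sign is `(-1)` to
  -- the difference `p - n - 1` of the degrees of `a_n u` and `u`.
  rw [sum_range_sum_antidiagonal N (fun i l => conjMode k M p n a i (w l)) hz, Finset.sum_comm,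
    Finset.sum_congr rfl fun l _ => e l, ← map_sum, map_smul, smul_smul,
    ← zpow_add₀ (by norm_num : (-1 : k) ≠ 0)]
  congr 2
  ring

/-- Conjugation of `Res_z (1 + z)^s z^q Y(a, z)` by `e^{L(1)} (-1)^{deg}`, for homogeneous `a`. -/
theorem theta_res_kern {a : V} {p : ℤ} (ha : Hom k a p) {J : ℕ} (hJ : p < J) (u : M) (s q : ℤ) :
    theta k V M (res k M (kern s q) a u) =
      (-1 : k) ^ (p - q - 1) • ∑ j ∈ Finset.range J, (j.factorial : k)⁻¹ •
        res k M (kern (2 * p - 2 - q - s - j) q) ((lOne k V V ^ j) a) (theta k V M u) := by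
  -- `E` is the defect of the formula. The case `s = 0` is `theta_mode`; both sides obey the
  -- recursion of the kernels coming from `(1 + z)^{s+1} = (1 + z)^s + z (1 + z)^s`, which carries
  -- it to every `s`.
  set E : ℤ → ℤ → M := fun s q => theta k V M (res k M (kern s q) a u) -
    (-1 : k) ^ (p - q - 1) • ∑ j ∈ Finset.range J, (j.factorial : k)⁻¹ •
        res k M (kern (2 * p - 2 - q - s - j) q) ((lOne k V V ^ j) a) (theta k V M u) with hE
  suffices h : ∀ s q, E s q = 0 from sub_eq_zero.1 (h s q)
  have hrec : ∀ s q, E (s + 1) q = E s q + E s (q + 1) := by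
    intro s q
    -- Under the substitution the recursion is reversed: here the term for `(s, q)` is the sum of
    -- those for `(s + 1, q)` and `(s, q + 1)`. The sign, which flips with `q`, restores the
    -- original form.
    have e1 : ∀ j : ℕ, res k M (kern (2 * p - 2 - q - s - j) q) ((lOne k V V ^ j) a)
        (theta k V M u) = res k M (kern (2 * p - 2 - q - (s + 1) - j) q) ((lOne k V V ^ j) a)
        (theta k V M u) + res k M (kern (2 * p - 2 - (q + 1) - s - j) (q + 1))
          ((lOne k V V ^ j) a) (theta k V M u) := by
      intro j
      rw [show 2 * p - 2 - q - s - (j : ℤ) = 2 * p - 2 - q - (s + 1) - j + 1 by ring, kern_succ,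
        res_add, show 2 * p - 2 - (q + 1) - s - (j : ℤ) = 2 * p - 2 - q - (s + 1) - j by ring]
    simp only [hE, e1, kern_succ, res_add, map_add, smul_add, Finset.sum_add_distrib]
    rw [show p - q - 1 = p - (q + 1) - 1 + 1 by ring, zpow_add_one₀ (by norm_num)]
    module
  -- Every kernel `(1 + z)^s z^q` starts in degree `q` whatever `s` is, so one bound serves all `s`.
  have hvan : ∃ K, ∀ s q, K ≤ q → E s q = 0 := by
    obtain ⟨K₀, hK₀⟩ := res_eq_zero (k := k) a u
    choose K hK using fun j : ℕ => res_eq_zero (k := k) ((lOne k V V ^ j) a) (theta k V M u)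
    obtain ⟨K₁, hK₁⟩ := ((Finset.range J).image K).exists_le
    refine ⟨max K₀ K₁, fun s q hq => ?_⟩
    simp only [hE]
    rw [hK₀ _ ((kern_supp _ _).mono ((le_max_left _ _).trans hq)), map_zero,
      Finset.sum_eq_zero, smul_zero, sub_zero]
    intro j hj
    rw [hK j _ ((kern_supp _ _).mono
      ((hK₁ _ (Finset.mem_image_of_mem K hj)).trans ((le_max_right _ _).trans hq))), smul_zero]
  obtain ⟨K, hK⟩ := hvan
  intro s
  induction s using Int.induction_on with
  | zero =>
    intro q
    have : (kern 0 q : LaurentSeries k) = zpw q := by rw [kern_eq, zpow_zero, one_mul]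
    simp only [hE, this, sub_zero]
    rw [res_apply, residue_zpw_eq_mode, theta_mode ha q hJ, sub_self]
  | succ s ih => intro q; rw [hrec, ih, ih, add_zero]
  | pred s ih =>
    -- For decreasing `s` the recursion only relates `q` to `q + 1`. Iterating it moves `q` into the
    -- range where `E` vanishes.
    have hstep : ∀ q, E (-(s : ℤ) - 1) q = - E (-(s : ℤ) - 1) (q + 1) := by
      intro q
      have := hrec (-(s : ℤ) - 1) q
      rw [sub_add_cancel, ih] at this
      exact eq_neg_of_add_eq_zero_left this.symm
    have hm : ∀ (m : ℕ) (q : ℤ), K ≤ q + m → E (-(s : ℤ) - 1) q = 0 := by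
      intro m
      induction m with
      | zero => intro q hq; exact hK _ _ (by simpa using hq)
      | succ m ihm =>
        intro q hq
        rw [hstep, ihm (q + 1) (by push_cast at hq; omega), neg_zero]
    intro q
    exact hm (K - q).toNat q (by omega)

theorem exists_nat_gt_int (p : ℤ) : ∃ J : ℕ, p < J := ⟨(p + 1).toNat, by omega⟩

/-- For `s = p`, `q = -2` the new exponent of `1 + z` is `p - j`, the weight of `L(1)^j a`. So a
generator of `O(M)` goes to a combination of generators. -/
theorem theta_mem_zhuO {x : M} (hx : x ∈ zhuO k V M) : theta k V M x ∈ zhuO k V M := by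
  refine zhuO_le (fun a p ha u => ?_) hx
  obtain ⟨J, hJ⟩ := exists_nat_gt_int p
  rw [theta_res_kern ha hJ]
  refine Submodule.smul_mem _ _ (Submodule.sum_mem _ fun j _ => Submodule.smul_mem _ _ ?_)
  rw [show 2 * p - 2 - -2 - p - (j : ℤ) = p - j by ring]
  exact zhuO_hom (lOne_pow_hom ha j) _

/-- For `s = p`, `q = -1` the new exponent is `(p - j) - 1`, that of the right product with `L(1)^j
a`. The sign `(-1)^p` and the sum over `j` then reassemble `θ a`. -/
theorem theta_leftStar (a : V) (u : M) :
    theta k V M (leftStar k M a u) = rightStar k M (theta k V V a) (theta k V M u) := by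
  suffices h : theta k V M ∘ₗ (leftStar k M).flip u =
      (rightStar k M).flip (theta k V M u) ∘ₗ theta k V V from LinearMap.congr_fun h a
  refine degree_linear_ext (k := k) (V := V) (M := V) fun p a ha => ?_
  have ha : Hom k a p := ha
  obtain ⟨J, hJ⟩ := exists_nat_gt_int p
  simp only [LinearMap.comp_apply, LinearMap.flip_apply]
  rw [leftStar_hom ha, theta_res_kern ha hJ, theta_adjoint ha hJ, map_smul, map_sum,
    LinearMap.smul_apply, LinearMap.sum_apply, show (p : ℤ) - -1 - 1 = p by ring]
  congr 1
  refine Finset.sum_congr rfl fun j _ => ?_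
  rw [map_smul, LinearMap.smul_apply, rightStar_hom (lOne_pow_hom ha j),
    show 2 * (p : ℤ) - 2 - -1 - p - (j : ℤ) = p - j - 1 by ring]

/-- As before with `s = p - 1`: the new exponent is `p - j`, that of the left product with `L(1)^j
a`. -/
theorem theta_rightStar (a : V) (u : M) :
    theta k V M (rightStar k M a u) = leftStar k M (theta k V V a) (theta k V M u) := by
  suffices h : theta k V M ∘ₗ (rightStar k M).flip u =
      (leftStar k M).flip (theta k V M u) ∘ₗ theta k V V from LinearMap.congr_fun h a
  refine degree_linear_ext (k := k) (V := V) (M := V) fun p a ha => ?_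
  have ha : Hom k a p := ha
  obtain ⟨J, hJ⟩ := exists_nat_gt_int p
  simp only [LinearMap.comp_apply, LinearMap.flip_apply]
  rw [rightStar_hom ha, theta_res_kern ha hJ, theta_adjoint ha hJ, map_smul, map_sum,
    LinearMap.smul_apply, LinearMap.sum_apply, show (p : ℤ) - -1 - 1 = p by ring]
  congr 1
  refine Finset.sum_congr rfl fun j _ => ?_
  rw [map_smul, LinearMap.smul_apply, leftStar_hom (lOne_pow_hom ha j),
    show 2 * (p : ℤ) - 2 - -1 - (p - 1) - (j : ℤ) = p - j by ring]

end Theta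

/-! ### The swap on the associated graded of a tensor product -/

/-! ### Lower filtration steps and equality of classes in the associated graded space. -/

section Below

variable {k A B : Type*} [CommRing k] [AddCommGroup A] [Module k A] [AddCommGroup B] [Module k B]

theorem below_mono {F : ℕ → Submodule k A} (hF : Monotone F) : Monotone (below F) := by
  intro m n h
  cases m with
  | zero => exact bot_le
  | succ m =>
    obtain ⟨n, rfl⟩ := Nat.exists_eq_succ_of_ne_zero (by omega : n ≠ 0)
    exact hF (by omega)

theorem below_le {F : ℕ → Submodule k A} (hF : Monotone F) (n : ℕ) : below F n ≤ F n := by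
  cases n with
  | zero => exact bot_le
  | succ n => exact hF (Nat.le_succ n)

theorem le_below {F : ℕ → Submodule k A} (hF : Monotone F) {m n : ℕ} (h : m < n) :
    F m ≤ below F n := by
  obtain ⟨n, rfl⟩ := Nat.exists_eq_succ_of_ne_zero (by omega : n ≠ 0)
  exact hF (by omega)

theorem below_map (F : ℕ → Submodule k A) (f : A →ₗ[k] B) (n : ℕ) :
    below (fun n => (F n).map f) n = (below F n).map f := by
  cases n with
  | zero => exact Submodule.map_bot f |>.symm
  | succ n => rfl

theorem Gr.symbol_eq_symbol (F : ℕ → Submodule k A) {n : ℕ} {x y : F n}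
    (h : (x : A) - y ∈ below F n) : Gr.symbol F n x = Gr.symbol F n y :=
  congrArg (Gr.incl F n) ((Submodule.Quotient.eq _).2 h)

theorem Gr.symbol_eq_zero (F : ℕ → Submodule k A) {n : ℕ} {x : F n}
    (h : (x : A) ∈ below F n) : Gr.symbol F n x = 0 := by
  rw [← map_zero (Gr.symbol F n)]
  exact Gr.symbol_eq_symbol F (by simpa using h)

/-- The map of associated graded spaces which is induced by `(-1) ^ n f` in degree `n`. -/
def Gr.signedMap (F : ℕ → Submodule k A) (G : ℕ → Submodule k B) (f : A →ₗ[k] B)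
    (hf : ∀ n, F n ≤ (G n).comap f) : Gr F →ₗ[k] Gr G :=
  Gr.lift F fun n => Submodule.liftQ _
    ((-1 : k) ^ n • (Gr.symbol G n ∘ₗ f.restrict (hf n))) fun x hx => by
      rw [LinearMap.mem_ker, LinearMap.smul_apply, LinearMap.comp_apply, Gr.symbol_eq_zero,
        smul_zero]
      have hx : (x : A) ∈ below F n := hx
      cases n with
      | zero =>
        rw [LinearMap.coe_restrict_apply, (Submodule.mem_bot k).1 hx, map_zero]
        exact Submodule.zero_mem _
      | succ n => exact hf n hx

theorem Gr.signedMap_symbol (F : ℕ → Submodule k A) (G : ℕ → Submodule k B) (f : A →ₗ[k] B)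
    (hf : ∀ n, F n ≤ (G n).comap f) (n : ℕ) (x : F n) :
    Gr.signedMap F G f hf (Gr.symbol F n x) =
      (-1 : k) ^ n • Gr.symbol G n ⟨f x, hf n x.2⟩ := by
  rw [Gr.signedMap, Gr.symbol, LinearMap.comp_apply, Gr.lift_incl]
  rfl

end Below

/-! ### The swap for filtered bimodules over a filtered algebra. -/

section Swap

open MulOpposite

variable {k A X Y : Type*} [CommRing k] [Ring A] [Algebra k A]
  [AddCommGroup X] [Module k X] [Module A X] [Module Aᵐᵒᵖ X]
  [AddCommGroup Y] [Module k Y] [Module A Y] [Module Aᵐᵒᵖ Y]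

/-- The map `x ⊗ y ↦ f' y ⊗ f x` for `f`, `f'` compatible with an anti-involution `τ` of `A`. -/
def BalTensor.antiSwap (τ : A → A) (f : X →ₗ[k] X) (f' : Y →ₗ[k] Y)
    (hf : ∀ (a : A) x, f (op a • x) = τ a • f x)
    (hf' : ∀ (a : A) y, f' (a • y) = op (τ a) • f' y) :
    BalTensor k A X Y →ₗ[k] BalTensor k A Y X :=
  (balRel k A X Y).liftQ (TensorProduct.lift ((BalTensor.mk k A Y X).compl₁₂ f' f).flip) <| by
    refine Submodule.span_le.2 ?_
    rintro _ ⟨x, a, y, rfl⟩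
    rw [SetLike.mem_coe, LinearMap.mem_ker, map_sub, TensorProduct.lift.tmul,
      TensorProduct.lift.tmul, sub_eq_zero]
    -- The two sides of a relation go to `f' y ⊗ τ a • f x` and `f' y • τ a ⊗ f x`, which are equal
    -- in `Y ⊗_A X`. No multiplicativity of `τ` is needed.
    simp only [LinearMap.flip_apply, LinearMap.compl₁₂_apply, hf, hf']
    exact (BalTensor.balanced _ _ _).symm

variable {F : ℕ → Submodule k A} {G : ℕ → Submodule k X} {H : ℕ → Submodule k Y}

/-- Lowering one factor by one filtration step lowers the tensor by one step. With its companion for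
the other factor, this allows factors to be changed modulo lower terms without changing the class.
-/
theorem mk_mem_below_left {n r s : ℕ} (h : r + s ≤ n) {x : X} (hx : x ∈ below G r) {y : Y}
    (hy : y ∈ H s) : BalTensor.mk k A X Y x y ∈ below (tensorFil A G H) n :=
  below_mono (tensorFil_mono G H) h ((mem_below G H (tensorFil A G H) (BalTensor.mk k A X Y)
    (fun _ _ _ ha _ hb => mk_mem_tensorFil le_rfl ha hb) r s).1 x hx y hy)

theorem mk_mem_below_right {n r s : ℕ} (h : r + s ≤ n) {x : X} (hx : x ∈ G r) {y : Y}
    (hy : y ∈ below H s) : BalTensor.mk k A X Y x y ∈ below (tensorFil A G H) n :=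
  below_mono (tensorFil_mono G H) h ((mem_below G H (tensorFil A G H) (BalTensor.mk k A X Y)
    (fun _ _ _ ha _ hb => mk_mem_tensorFil le_rfl ha hb) r s).2 x hx y hy)

/-- Classes of pure tensors span, so identities linear in `z` need only be checked there. The zero
class needs no hypothesis of its own, being `0` times a class. -/
theorem Gr.tensor_induction_on {P : Gr (tensorFil A G H) → Prop} (z : Gr (tensorFil A G H))
    (hadd : ∀ x y, P x → P y → P (x + y)) (hsmul : ∀ (c : k) x, P x → P (c • x))
    (hmk : ∀ (n r s : ℕ) (h : r + s ≤ n) (x : X) (hx : x ∈ G r) (y : Y) (hy : y ∈ H s),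
      P (Gr.symbol (tensorFil A G H) n ⟨BalTensor.mk k A X Y x y, mk_mem_tensorFil h hx hy⟩)) :
    P z := by
  have h0 : P 0 := by
    have := hsmul 0 _ (hmk 0 0 0 le_rfl 0 (Submodule.zero_mem _) 0 (Submodule.zero_mem _))
    rwa [zero_smul] at this
  induction z using Gr.induction_on with
  | h0 => exact h0
  | hadd x y hx hy => exact hadd x y hx hy
  | hs n t =>
    obtain ⟨t, ht⟩ := t
    induction ht using Submodule.span_induction with
    | mem t ht =>
      obtain ⟨r, s, h, x, hx, y, hy, rfl⟩ := ht
      exact hmk n r s h x hx y hy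
    | zero => exact (map_zero (Gr.symbol (tensorFil A G H) n)).symm ▸ h0
    | add x y hx hy hPx hPy =>
      have := hadd _ _ hPx hPy
      rwa [← map_add] at this
    | smul c x hx hPx =>
      have := hsmul c _ hPx
      rwa [← map_smul] at this

/-- `φ` maps the class of `x ⊗ y` to the class of `y ⊗ x`. -/
def IsGrSwap (φ : Gr (tensorFil A G H) →ₗ[k] Gr (tensorFil A H G)) : Prop :=
  ∀ (n r s : ℕ) (h : r + s ≤ n) (x : X) (hx : x ∈ G r) (y : Y) (hy : y ∈ H s),
    φ (Gr.symbol (tensorFil A G H) n ⟨BalTensor.mk k A X Y x y, mk_mem_tensorFil h hx hy⟩) =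
      Gr.symbol (tensorFil A H G) n
        ⟨BalTensor.mk k A Y X y x, mk_mem_tensorFil ((Nat.add_comm s r).trans_le h) hy hx⟩

/-- The map `x ⊗ y ↦ f' y ⊗ f x` exists before passing to `gr`. On leading terms `f` and `f'`
contribute `(-1)^r` and `(-1)^s`, and the sign `(-1)^n` in `Gr.signedMap` removes them when `r + s =
n`. -/
theorem exists_isGrSwap (hG : Monotone G) (hH : Monotone H) (τ : A → A) (f : X →ₗ[k] X)
    (f' : Y →ₗ[k] Y) (hf : ∀ (a : A) x, f (op a • x) = τ a • f x)
    (hf' : ∀ (a : A) y, f' (a • y) = op (τ a) • f' y)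
    (hfG : ∀ r, ∀ x ∈ G r, f x - (-1 : k) ^ r • x ∈ below G r)
    (hfH : ∀ s, ∀ y ∈ H s, f' y - (-1 : k) ^ s • y ∈ below H s) :
    ∃ φ : Gr (tensorFil A G H) →ₗ[k] Gr (tensorFil A H G), IsGrSwap φ := by
  have hG' : ∀ r, ∀ x ∈ G r, f x ∈ G r := fun r x hx => by
    have := Submodule.add_mem _ (below_le hG r (hfG r x hx)) (Submodule.smul_mem _ ((-1 : k) ^ r) hx)
    rwa [sub_add_cancel] at this
  have hH' : ∀ s, ∀ y ∈ H s, f' y ∈ H s := fun s y hy => by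
    have := Submodule.add_mem _ (below_le hH s (hfH s y hy)) (Submodule.smul_mem _ ((-1 : k) ^ s) hy)
    rwa [sub_add_cancel] at this
  set Θ := BalTensor.antiSwap τ f f' hf hf' with hΘ
  have hmem : ∀ n, tensorFil A G H n ≤ (tensorFil A H G n).comap Θ := fun n => by
    refine Submodule.span_le.2 ?_
    rintro _ ⟨r, s, h, x, hx, y, hy, rfl⟩
    exact mk_mem_tensorFil (by omega : s + r ≤ n) (hH' s y hy) (hG' r x hx)
  refine ⟨Gr.signedMap _ _ Θ hmem, fun n r s h x hx y hy => ?_⟩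
  rw [Gr.signedMap_symbol, ← map_smul]
  refine Gr.symbol_eq_symbol _ ?_
  change (-1 : k) ^ n • BalTensor.mk k A Y X (f' y) (f x) - BalTensor.mk k A Y X y x ∈ _
  -- If `r + s < n`, both tensors lie in a lower step, so the sign plays no role.
  rcases h.lt_or_eq with hlt | rfl
  · refine le_below (tensorFil_mono H G) hlt (Submodule.sub_mem _ (Submodule.smul_mem _ _ ?_) ?_)
    · exact mk_mem_tensorFil (by omega) (hH' s y hy) (hG' r x hx)
    · exact mk_mem_tensorFil (by omega) hy hx
  -- The factors are replaced one at a time by their leading terms; each summand has one factor in a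
  -- lower step.
  · have e : (-1 : k) ^ (r + s) • BalTensor.mk k A Y X (f' y) (f x) - BalTensor.mk k A Y X y x =
        (-1 : k) ^ (r + s) • BalTensor.mk k A Y X (f' y - (-1 : k) ^ s • y) (f x) +
        (-1 : k) ^ r • BalTensor.mk k A Y X y (f x - (-1 : k) ^ r • x) := by
      have h1 : (-1 : k) ^ (r + s) * (-1) ^ s = (-1) ^ r := by
        rw [pow_add, mul_assoc, ← mul_pow]; simp
      have h2 : (-1 : k) ^ r * (-1) ^ r = 1 := by
        rw [← mul_pow]; simp
      simp only [map_sub, LinearMap.sub_apply, map_smul, LinearMap.smul_apply, smul_sub, smul_smul,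
        h1, h2]
      module
    rw [e]
    exact Submodule.add_mem _
      (Submodule.smul_mem _ _ (mk_mem_below_left (by omega) (hfH s y hy) (hG' r x hx)))
      (Submodule.smul_mem _ _ (mk_mem_below_right (by omega) hy (hfG r x hx)))

/-- Two swaps in opposite directions fix every class of a pure tensor, and these span. -/
theorem IsGrSwap.leftInverse {φ : Gr (tensorFil A G H) →ₗ[k] Gr (tensorFil A H G)}
    {ψ : Gr (tensorFil A H G) →ₗ[k] Gr (tensorFil A G H)} (hφ : IsGrSwap φ) (hψ : IsGrSwap ψ)
    (z : Gr (tensorFil A G H)) : ψ (φ z) = z := by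
  induction z using Gr.tensor_induction_on with
  | hadd x y hx hy => rw [map_add, map_add, hx, hy]
  | hsmul c x hx => rw [map_smul, map_smul, hx]
  | hmk n r s h x hx y hy => rw [hφ n r s h x hx y hy, hψ n s r (by omega) y hy x hx]

theorem IsGrSwap.map_part_le {φ : Gr (tensorFil A G H) →ₗ[k] Gr (tensorFil A H G)}
    (hφ : IsGrSwap φ) (n : ℕ) :
    (Gr.part (tensorFil A G H) n).map φ ≤ Gr.part (tensorFil A H G) n := by
  rintro _ ⟨_, ⟨⟨t, ht⟩, rfl⟩, rfl⟩
  induction ht using Submodule.span_induction with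
  | mem t ht =>
    obtain ⟨r, s, h, x, hx, y, hy, rfl⟩ := ht
    exact (hφ n r s h x hx y hy).symm ▸ LinearMap.mem_range_self _ _
  | zero =>
    have : Gr.symbol (tensorFil A G H) n ⟨0, Submodule.zero_mem _⟩ = 0 := map_zero _
    rw [this, map_zero]
    exact Submodule.zero_mem _
  | add x y hx hy hPx hPy =>
    have := Submodule.add_mem _ hPx hPy
    rwa [← map_add, ← map_add] at this
  | smul c x hx hPx =>
    have := Submodule.smul_mem _ c hPx
    rwa [← map_smul, ← map_smul] at this

variable [IsScalarTower k A X] [IsScalarTower k Aᵐᵒᵖ X] [SMulCommClass A Aᵐᵒᵖ X]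
  [IsScalarTower k A Y] [IsScalarTower k Aᵐᵒᵖ Y] [SMulCommClass A Aᵐᵒᵖ Y]
  [IsFilteredAlgebra F] [IsFilteredModule F G] [IsFilteredRightModule F G]
  [IsFilteredModule F H] [IsFilteredRightModule F H]

/-- The left action moves `x` on the source and `y` on the target. Balancing gives `y ⊗ a x = y a ⊗
x`, and `y a` agrees with `a y` modulo a lower step by the hypothesis `hH`. -/
theorem IsGrSwap.map_smul {φ : Gr (tensorFil A G H) →ₗ[k] Gr (tensorFil A H G)} (hφ : IsGrSwap φ)
    (hH : ∀ i s, ∀ a ∈ F i, ∀ y ∈ H s, op a • y - a • y ∈ below H (i + s))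
    (a : Gr F) (z : Gr (tensorFil A G H)) : φ (a • z) = a • φ z := by
  induction a using Gr.induction_on with
  | h0 => simp only [zero_smul, map_zero]
  | hadd a b ha hb => simp only [add_smul, map_add, ha, hb]
  | hs i a =>
  induction z using Gr.tensor_induction_on with
  | hadd x y hx hy => simp only [smul_add, map_add, hx, hy]
  | hsmul c x hx =>
    -- The action of `gr A` commutes with scalars because it is the bilinear map `Gr.lact`.
    have e1 : Gr.symbol F i a • c • x = c • Gr.symbol F i a • x :=
      LinearMap.map_smul (Gr.lact F (tensorFil A G H) (Gr.symbol F i a)) c x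
    have e2 : Gr.symbol F i a • c • φ x = c • Gr.symbol F i a • φ x :=
      LinearMap.map_smul (Gr.lact F (tensorFil A H G) (Gr.symbol F i a)) c (φ x)
    rw [e1, LinearMap.map_smul, hx, LinearMap.map_smul, e2]
  | hmk n r s h x hx y hy =>
    rw [hφ n r s h x hx y hy, Gr.symbol_smul_symbol, Gr.symbol_smul_symbol]
    refine (hφ (i + n) (i + r) s (by omega) ((a : A) • x)
      (IsFilteredModule.smul_mem (F := F) i r a a.2 x hx) y hy).trans
      (Gr.symbol_eq_symbol _ ?_)
    change BalTensor.mk k A Y X y ((a : A) • x) - BalTensor.mk k A Y X ((a : A) • y) x ∈ _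
    rw [← BalTensor.balanced, ← LinearMap.sub_apply, ← map_sub]
    exact mk_mem_below_left (by omega) (hH i s a a.2 y hy) hx

/-- The mirror argument: `y a ⊗ x = y ⊗ a x`, and `a x` agrees with `x a` modulo a lower step. The
commutator estimate is now needed on `X`. -/
theorem IsGrSwap.map_op_smul {φ : Gr (tensorFil A G H) →ₗ[k] Gr (tensorFil A H G)}
    (hφ : IsGrSwap φ) (hG : ∀ i r, ∀ a ∈ F i, ∀ x ∈ G r, op a • x - a • x ∈ below G (i + r))
    (a : Gr F) (z : Gr (tensorFil A G H)) : φ (op a • z) = op a • φ z := by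
  induction a using Gr.induction_on with
  | h0 => simp only [op_zero, zero_smul, map_zero]
  | hadd a b ha hb => simp only [op_add, add_smul, map_add, ha, hb]
  | hs i a =>
  induction z using Gr.tensor_induction_on with
  | hadd x y hx hy => simp only [smul_add, map_add, hx, hy]
  | hsmul c x hx =>
    have e1 : op (Gr.symbol F i a) • c • x = c • op (Gr.symbol F i a) • x :=
      LinearMap.map_smul (Gr.ract F (tensorFil A G H) (Gr.symbol F i a)) c x
    have e2 : op (Gr.symbol F i a) • c • φ x = c • op (Gr.symbol F i a) • φ x :=
      LinearMap.map_smul (Gr.ract F (tensorFil A H G) (Gr.symbol F i a)) c (φ x)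
    rw [e1, LinearMap.map_smul, hx, LinearMap.map_smul, e2]
  | hmk n r s h x hx y hy =>
    rw [hφ n r s h x hx y hy, Gr.op_symbol_smul_symbol, Gr.op_symbol_smul_symbol]
    refine (hφ (i + n) r (i + s) (by omega) x hx (op (a : A) • y)
      (IsFilteredRightModule.smul_mem (F := F) i s a a.2 y hy)).trans
      (Gr.symbol_eq_symbol _ ?_)
    change BalTensor.mk k A Y X (op (a : A) • y) x - BalTensor.mk k A Y X y (op (a : A) • x) ∈ _
    rw [BalTensor.balanced, ← map_sub, ← neg_sub, map_neg]
    exact Submodule.neg_mem _ (mk_mem_below_right (by omega) hy (hG i r a a.2 x hx))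

/-- Expresses the action of a class of the enveloping algebra through the two one-sided actions of
`gr A`, which are already understood. -/
theorem Gr.symbol_tmul_smul (i j : ℕ) (a : F i) (b : F j) (z : Gr (tensorFil A G H)) :
    Gr.symbol (envFil F) (i + j)
      ⟨(a : A) ⊗ₜ[k] op (b : A), Submodule.subset_span ⟨i, j, le_rfl, a, a.2, b, b.2, rfl⟩⟩ • z =
      Gr.symbol F i a • op (Gr.symbol F j b) • z := by
  induction z using Gr.induction_on with
  | h0 => simp only [smul_zero]
  | hadd x y hx hy => simp only [smul_add, hx, hy]
  | hs n t =>
    rw [Gr.symbol_smul_symbol, Gr.op_symbol_smul_symbol, Gr.symbol_smul_symbol]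
    exact Gr.symbol_congr _ (add_assoc i j n) _ _ rfl

/-- Degree `m` of the graded enveloping algebra is spanned by classes of `a ⊗ b` with `a ∈ F i`, `b
∈ F j`, `i + j ≤ m`. Those with `i + j < m` vanish, and the others act by a left and a right
multiplication. -/
theorem map_env_smul {φ : Gr (tensorFil A G H) →ₗ[k] Gr (tensorFil A H G)}
    (hl : ∀ (a : Gr F) z, φ (a • z) = a • φ z) (hr : ∀ (a : Gr F) z, φ (op a • z) = op a • φ z)
    (c : Gr (envFil F)) (z : Gr (tensorFil A G H)) : φ (c • z) = c • φ z := by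
  set D : Gr (envFil F) →ₗ[k] Gr (tensorFil A H G) :=
    φ ∘ₗ (Gr.lact (envFil F) (tensorFil A G H)).flip z -
      (Gr.lact (envFil F) (tensorFil A H G)).flip (φ z) with hD
  suffices h : ∀ c, D c = 0 from sub_eq_zero.1 (h c)
  intro c
  induction c using Gr.induction_on with
  | h0 => exact LinearMap.map_zero D
  | hadd a b ha hb => exact (LinearMap.map_add D a b).trans (by rw [ha, hb, add_zero])
  | hs m t =>
    -- Vanishing of `D` on classes of degree `m` is phrased as an inclusion of submodules of `A ⊗
    -- Aᵒᵖ`, so that it can be tested on the spanning set.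
    have hle : envFil F m ≤ (LinearMap.ker (D ∘ₗ Gr.symbol (envFil F) m)).map
        (envFil F m).subtype := by
      refine Submodule.span_le.2 ?_
      rintro _ ⟨i, j, h, a, ha, b, hb, rfl⟩
      refine ⟨⟨a ⊗ₜ[k] op b, Submodule.subset_span ⟨i, j, h, a, ha, b, hb, rfl⟩⟩, ?_, rfl⟩
      rw [SetLike.mem_coe, LinearMap.mem_ker, LinearMap.comp_apply]
      rcases h.lt_or_eq with hlt | rfl
      · refine (congrArg D (Gr.symbol_eq_zero _ ?_)).trans (LinearMap.map_zero D)
        exact le_below (IsFilteredAlgebra.mono (F := envFil F)) hlt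
          (Submodule.subset_span ⟨i, j, le_rfl, a, ha, b, hb, rfl⟩)
      · have e1 := Gr.symbol_tmul_smul i j (⟨a, ha⟩ : F i) (⟨b, hb⟩ : F j) z
        have e2 := Gr.symbol_tmul_smul i j (⟨a, ha⟩ : F i) (⟨b, hb⟩ : F j) (φ z)
        refine sub_eq_zero.2 ((congrArg φ e1).trans ?_)
        rw [hl, hr]
        exact e2.symm
    obtain ⟨t, ht⟩ := t
    obtain ⟨t', ht', rfl⟩ := hle ht
    exact ht'

end Swap

/-! ### The anti-involution of `A(M)` and the filtrations -/

section ZhuTheta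

open VertexOperatorAlgebra AdmissibleModule MulOpposite

theorem mem_below_iSup_of_intPart {k E : Type*} [Field k] [AddCommGroup E] [Module k E]
    {W : ℕ → Submodule k E} {d : ℤ} {n : ℕ} (h : d < n) {x : E} (hx : x ∈ intPart W d) :
    x ∈ below (fun n : ℕ => ⨆ i : ℕ, ⨆ _ : i ≤ n, W i) n := by
  rcases mem_intPart hx with rfl | ⟨i, rfl, hi⟩
  · exact Submodule.zero_mem _
  · exact le_below (mono_iSup W) (by omega : i < n)
      (Submodule.mem_iSup_of_mem i (Submodule.mem_iSup_of_mem le_rfl hi))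

theorem bilin_iSup_mem {k E E' E'' : Type*} [Field k] [AddCommGroup E] [Module k E]
    [AddCommGroup E'] [Module k E'] [AddCommGroup E''] [Module k E'']
    {W : ℕ → Submodule k E} {W' : ℕ → Submodule k E'} (φ : E →ₗ[k] E' →ₗ[k] E'')
    {m n : ℕ} {S : Submodule k E''}
    (h : ∀ i ≤ m, ∀ j ≤ n, ∀ a ∈ W i, ∀ u ∈ W' j, φ a u ∈ S)
    {a : E} (ha : a ∈ ⨆ i : ℕ, ⨆ _ : i ≤ m, W i) {u : E'} (hu : u ∈ ⨆ i : ℕ, ⨆ _ : i ≤ n, W' i) :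
    φ a u ∈ S := by
  have h1 : (⨆ i : ℕ, ⨆ _ : i ≤ m, W i) ≤ S.comap (φ.flip u) :=
    iSup₂_le fun i hi a ha => by
      have h2 : (⨆ j : ℕ, ⨆ _ : j ≤ n, W' j) ≤ S.comap (φ a) :=
        iSup₂_le fun j hj u hu => h i hi j hj a ha u hu
      exact h2 hu
  exact h1 ha

variable (k V M : Type*) [Field k] [AddCommGroup V] [Module k V]
  [VertexOperatorAlgebra k V] [AddCommGroup M] [Module k M] [AdmissibleModule k V M]

variable {k V M} in
theorem ZhuBimodule.below_fil (n : ℕ) : below (ZhuBimodule.fil k V M) n =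
    (below (fun n : ℕ => ⨆ i : ℕ, ⨆ _ : i ≤ n, degree (k := k) (M := M) V i) n).map
      (ZhuBimodule.mk k V M) :=
  below_map _ _ n

variable [CharZero k]

/-- The map of `A(M)` induced by `e^{L(1)} (-1)^{deg}`. -/
def ZhuBimodule.theta : ZhuBimodule k V M →ₗ[k] ZhuBimodule k V M :=
  (zhuO k V M).mapQ (zhuO k V M) (Zhu.theta k V M) fun _ => theta_mem_zhuO

/-- The anti-involution of `A(V)` induced by `e^{L(1)} (-1)^{wt}`. -/
def ZhuAlgebra.theta : ZhuAlgebra k V →ₗ[k] ZhuAlgebra k V :=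
  (zhuO k V V).mapQ (zhuO k V V) (Zhu.theta k V V) fun _ => theta_mem_zhuO

variable {k V M}

theorem ZhuBimodule.theta_smul (a : ZhuAlgebra k V) (x : ZhuBimodule k V M) :
    ZhuBimodule.theta k V M (a • x) = op (ZhuAlgebra.theta k V a) • ZhuBimodule.theta k V M x := by
  obtain ⟨a, rfl⟩ := ZhuAlgebra.mk_surjective a
  obtain ⟨u, rfl⟩ := ZhuBimodule.mk_surjective x
  exact congrArg (ZhuBimodule.mk k V M) (theta_leftStar a u)

theorem ZhuBimodule.theta_op_smul (a : ZhuAlgebra k V) (x : ZhuBimodule k V M) :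
    ZhuBimodule.theta k V M (op a • x) = ZhuAlgebra.theta k V a • ZhuBimodule.theta k V M x := by
  obtain ⟨a, rfl⟩ := ZhuAlgebra.mk_surjective a
  obtain ⟨u, rfl⟩ := ZhuBimodule.mk_surjective x
  exact congrArg (ZhuBimodule.mk k V M) (theta_rightStar a u)

/-- Only the constant term of `e^{L(1)}` preserves the degree; the other terms lower it. -/
theorem ZhuBimodule.theta_sub_mem_below (r : ℕ) (x : ZhuBimodule k V M)
    (hx : x ∈ ZhuBimodule.fil k V M r) :
    ZhuBimodule.theta k V M x - (-1 : k) ^ r • x ∈ below (ZhuBimodule.fil k V M) r := by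
  obtain ⟨u, hu, rfl⟩ := hx
  rw [ZhuBimodule.below_fil]
  refine Submodule.mem_map_of_mem (f := ZhuBimodule.mk k V M)
    (r := Zhu.theta k V M u - (-1 : k) ^ r • u) ?_
  have hle : (⨆ i : ℕ, ⨆ _ : i ≤ r, degree (k := k) (M := M) V i) ≤
      (below (fun n : ℕ => ⨆ i : ℕ, ⨆ _ : i ≤ n, degree (k := k) (M := M) V i) r).comap
        (Zhu.theta k V M - (-1 : k) ^ r • LinearMap.id) := by
    refine iSup₂_le fun i hi u hu => ?_
    have hu' := mem_intPart_of_mem hu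
    rw [Submodule.mem_comap, LinearMap.sub_apply, LinearMap.smul_apply, LinearMap.id_apply,
      theta_apply hu' (N := i + 1) (by push_cast; omega), Finset.sum_range_succ', smul_add,
      zpow_natCast, add_sub_assoc]
    refine Submodule.add_mem _ (Submodule.smul_mem _ _ (Submodule.sum_mem _ fun l _ =>
      Submodule.smul_mem _ _ (mem_below_iSup_of_intPart ?_ (lOne_pow_mem hu' (l + 1))))) ?_
    · push_cast; omega
    -- For `i < r` the vector itself is already in the lower step, so the mismatch of signs is
    -- harmless. For `i = r` the leading terms cancel.
    · rcases hi.lt_or_eq with hlt | rfl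
      · have hu'' := mem_below_iSup_of_intPart (by exact_mod_cast hlt) hu'
        refine Submodule.sub_mem _ (Submodule.smul_mem _ _ ?_) (Submodule.smul_mem _ _ hu'')
        simpa using hu''
      · simp
  exact hle hu

/-- The kernels of the two products differ by `(1 + z)^{wt a - 1}`, without a pole. So `a * u - u *
a` involves only modes `a_l` with `l ≥ 0`, and `a_l u` has degree `wt a + deg u - l - 1`. -/
theorem ZhuBimodule.op_smul_sub_smul_mem_below (i s : ℕ) (a : ZhuAlgebra k V)
    (ha : a ∈ ZhuAlgebra.fil k V i) (x : ZhuBimodule k V M) (hx : x ∈ ZhuBimodule.fil k V M s) :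
    op a • x - a • x ∈ below (ZhuBimodule.fil k V M) (i + s) := by
  obtain ⟨a, ha, rfl⟩ := ha
  obtain ⟨u, hu, rfl⟩ := hx
  rw [ZhuBimodule.below_fil]
  refine Submodule.mem_map_of_mem (f := ZhuBimodule.mk k V M)
    (r := rightStar k M a u - leftStar k M a u) ?_
  refine bilin_iSup_mem (rightStar k M - leftStar k M) (fun i' hi j hj a ha u hu => ?_) ha hu
  have ha' : Hom k a i' := mem_intPart_of_mem ha
  rw [LinearMap.sub_apply, LinearMap.sub_apply, left_sub_right ha', sub_add_cancel_left, cOp]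
  obtain ⟨N₀, hN⟩ := res_kern (k := k) ((i' : ℤ) - 1) 0 a u
  rw [hN N₀ le_rfl]
  refine Submodule.neg_mem _ (Submodule.sum_mem _ fun l _ => Submodule.smul_mem _ _
    (mem_below_iSup_of_intPart ?_ (module_mode_hom ha' (mem_intPart_of_mem hu) _)))
  push_cast
  omega

theorem exists_zhuTensor_isGrSwap (k V M N : Type*) [Field k] [CharZero k] [AddCommGroup V]
    [Module k V] [VertexOperatorAlgebra k V] [AddCommGroup M] [Module k M] [AdmissibleModule k V M]
    [AddCommGroup N] [Module k N] [AdmissibleModule k V N] :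
    ∃ φ : Gr (ZhuTensor.fil k V M N) →ₗ[k] Gr (ZhuTensor.fil k V N M), IsGrSwap φ :=
  exists_isGrSwap ZhuBimodule.fil_mono ZhuBimodule.fil_mono (ZhuAlgebra.theta k V)
    (ZhuBimodule.theta k V M) (ZhuBimodule.theta k V N) ZhuBimodule.theta_op_smul
    ZhuBimodule.theta_smul ZhuBimodule.theta_sub_mem_below ZhuBimodule.theta_sub_mem_below

end ZhuTheta

end Zhu

end

/-! ### The isomorphism for `A(M)` and `A(N)`. -/

theorem proposition4p13 {V M N : Type*} [AddCommGroup V] [Module ℂ V]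
    [Zhu.VertexOperatorAlgebra ℂ V] (hV : Zhu.VertexOperatorAlgebra.IsCFTType ℂ V)
    [AddCommGroup M] [Module ℂ M] [Zhu.AdmissibleModule ℂ V M]
    [AddCommGroup N] [Module ℂ N] [Zhu.AdmissibleModule ℂ V N] :
    ∃ φ : Zhu.Gr (Zhu.ZhuTensor.fil ℂ V M N) ≃ₗ[ℂ] Zhu.Gr (Zhu.ZhuTensor.fil ℂ V N M),
      (∀ (n r s : ℕ) (h : r + s ≤ n) (u : Zhu.ZhuBimodule.fil ℂ V M r)
        (v : Zhu.ZhuBimodule.fil ℂ V N s),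
        φ (Zhu.Gr.symbol (Zhu.ZhuTensor.fil ℂ V M N) n
            ⟨Zhu.ZhuTensor.mk V u.1 v.1, Zhu.mk_mem_tensorFil h u.2 v.2⟩) =
          Zhu.Gr.symbol (Zhu.ZhuTensor.fil ℂ V N M) n
            ⟨Zhu.ZhuTensor.mk V v.1 u.1,
              Zhu.mk_mem_tensorFil ((Nat.add_comm s r).trans_le h) v.2 u.2⟩) ∧
      (∀ n, (Zhu.Gr.part (Zhu.ZhuTensor.fil ℂ V M N) n).map φ.toLinearMap =
        Zhu.Gr.part (Zhu.ZhuTensor.fil ℂ V N M) n) ∧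
      (∀ (a : Zhu.Gr (Zhu.ZhuAlgebra.fil ℂ V)) (x : Zhu.Gr (Zhu.ZhuTensor.fil ℂ V M N)),
        φ (a • x) = a • φ x) ∧
      (∀ (a : Zhu.Gr (Zhu.ZhuAlgebra.fil ℂ V)) (x : Zhu.Gr (Zhu.ZhuTensor.fil ℂ V M N)),
        φ (MulOpposite.op a • x) = MulOpposite.op a • φ x) ∧
      (∀ (c : Zhu.Gr (Zhu.ZhuAlgebra.envFil ℂ V)) (x : Zhu.Gr (Zhu.ZhuTensor.fil ℂ V M N)),
        φ (c • x) = c • φ x) := by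
  obtain ⟨φ, hφ⟩ := Zhu.exists_zhuTensor_isGrSwap ℂ V M N
  -- The swap in the opposite direction, which will be the inverse.
  obtain ⟨ψ, hψ⟩ := Zhu.exists_zhuTensor_isGrSwap ℂ V N M
  -- Linearity on the left uses the commutator estimate in `A(N)`, linearity on the right that in
  -- `A(M)`.
  have hl : ∀ (a : Zhu.Gr (Zhu.ZhuAlgebra.fil ℂ V)) (x : Zhu.Gr (Zhu.ZhuTensor.fil ℂ V M N)),
      φ (a • x) = a • φ x := hφ.map_smul Zhu.ZhuBimodule.op_smul_sub_smul_mem_below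
  have hr : ∀ (a : Zhu.Gr (Zhu.ZhuAlgebra.fil ℂ V)) (x : Zhu.Gr (Zhu.ZhuTensor.fil ℂ V M N)),
      φ (MulOpposite.op a • x) = MulOpposite.op a • φ x :=
    hφ.map_op_smul Zhu.ZhuBimodule.op_smul_sub_smul_mem_below
  refine ⟨LinearEquiv.ofLinearMap φ ψ (LinearMap.ext (hψ.leftInverse hφ))
    (LinearMap.ext (hφ.leftInverse hψ)), fun n r s h u v => hφ n r s h u u.2 v v.2, fun n => ?_,
    hl, hr, Zhu.map_env_smul hl hr⟩
  refine le_antisymm (hφ.map_part_le n) fun y hy => ?_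
  -- Each component is reached because the inverse swap also preserves degrees.
  exact ⟨ψ y, hψ.map_part_le n (Submodule.mem_map_of_mem hy), hψ.leftInverse hφ y⟩
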